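/- \textbf{Setting.} Let $\mathcal V$ be a finite set of modules and $(\Omega,\mathcal F,Q)$ a probability space. Each $V\in\mathcal V$ has a real random variable $V_0$ (its initial outcome), which occurs at a time point $T(V_0)\le 0$; put $p(V)=\{V'\in\mathcal V: T(V'_0)<T(V_0)\}$. Let $N$ be a multivariate point process on $(0,T]$ (finitely many points, at most one at any time) with mark space a Lusin space $(J,\mathcal J)$, and let $J=\coprod_{V\in\mathcal V}J_V$ be a measurable partition. Say that $X$ is a \emph{process of the form $(V)$} if $X_t=V_0+\int_{J_V}\int_0^t g(s,x)\,N(ds,dx)$ on $[0,T]$ with $g$ bounded and predictable with respect to the filtration generated by $V_0$ and $N|_{J_V}$; each module $V$ is itself a process of the form $(V)$. Under $Q$ the variables $(V_0)_{V\in\mathcal V}$ are mutually independent, $(V_0)_{V\in\mathcal V}$ is independent of $N$, and the restrictions $(N|_{J_V})_{V\in\mathcal V}$ are mutually independent. For $\mathcal W\subset\mathcal V$ let $\mathcal F^{\mathcal W}_t$ be the filtration generated by $V_0$ and $N|_{J_V}$, $V\in\mathcal W$, augmented by the $Q$-null events and made right-continuous, and let $\mathcal P^{\mathcal W}$ be its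 predictable $\sigma$-algebra; a field $h(s,\omega,x)$ with $x\in J$ is called $\mathcal P^{\mathcal W}$-measurable if it is $\mathcal P^{\mathcal W}\otimes\mathcal J$-measurable. Let $U$ be (a version of) the dual predictable projection of $N$ with respect to $Q$ and $\mathcal F_t=\mathcal F_t^{\mathcal V}$. Let $P\ll Q$ be a probability measure under which each $V_0$ is independent of the other initial outcomes with the same time point, conditionally on the initial outcomes of the modules in $p(V)$. \textbf{Local independence.} Let $V\in\mathcal V$ and $\mathcal B,\mathcal V'\subset\mathcal V$. Then $V$ is \emph{locally independent of $\mathcal B$ at baseline, given $\mathcal V'$}, if for every $P$-integrable $\mathcal F_0^{V}$-measurable $\eta$ there is a $P$-integrable $\mathcal F_0^{p(V)\cap(\mathcal V'\setminus\mathcal B)}$-measurable $\tilde\eta$ with $E_P[\eta h]=E_P[\tilde\eta h]$ for all bounded $\mathcal F_0^{p(V)\cap\mathcal V'}$-measurable $h$. It is \emph{locally independent of $\mathcal B$ during follow-up, given $\mathcal V'$}, if for every process $X$ of the form $(V)$ there is a $\mathcal P^{\{V\}\cup(\mathcal V'\setminus\mathcal B)}$-measurable process $\Lambda$, with $P$-almost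 all paths right-continuous and of finite variation on $[0,T]$, such that $$E_P\Big[\int_0^T h_s\,dX_s\Big]=E_P\Big[\int_0^T h_s\,d\Lambda_s\Big]$$ (the integral on the right being $P$-integrable) for every bounded $\mathcal P^{\{V\}\cup\mathcal V'}$-measurable process $h$ with $E_P[\int_{J_V}\int_0^T|h_s|\,N(ds,dx)]<\infty$. Write $\mathcal B\nrightarrow V\mid\mathcal V'$ if both hold. \textbf{Lemma.} Suppose that $V$ is locally independent of $\mathcal B$ at baseline, given $\mathcal V'$. Then $\mathcal B\nrightarrow V\mid\mathcal V'$ if and only if there is a nonnegative $\mathcal P^{\{V\}\cup(\mathcal V'\setminus\mathcal B)}$-measurable field $\lambda^V(s,x)$ such that $$E_P\Big[\int_{J_V}\int_0^T h(s,x)\,N(ds,dx)\Big]=E_P\Big[\int_{J_V}\int_0^T h(s,x)\,\lambda^V(s,x)\,U(ds,dx)\Big]$$ (the inner integral on the right existing $P$-a.s. and being $P$-integrable) for every bounded $\mathcal P^{\{V\}\cup\mathcal V'}$-measurable field $h$ with $E_P[\int_{J_V}\int_0^T|h(s,x)|\,N(ds,dx)]<\infty$. (If $E_P[N((0,T]\times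 J_V)]<\infty$, the last condition on the test functions $h$ holds for every bounded $h$.) -/

import Mathlib

open MeasureTheory ProbabilityTheory Set
open scoped NNReal ENNReal

noncomputable section

namespace LocalIndependence

/-! ### Predictable fields, finite variation paths, Stieltjes integrals -/

/-- The field `g(t, ω, x)` is `𝒫 ⊗ 𝒥`-measurable, where `𝒫` is the predictable σ-algebra of `𝓕`
and `𝒥` is the σ-algebra of the mark space `J`. -/
def IsPredictableField {Ω J E : Type*} [mΩ : MeasurableSpace Ω] [mJ : MeasurableSpace J]
    [MeasurableSpace E] (𝓕 : Filtration ℝ≥0 mΩ) (g : ℝ≥0 → Ω → J → E) : Prop :=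
  Measurable[𝓕.predictable.prod mJ] fun p : (ℝ≥0 × Ω) × J => g p.1.1 p.1.2 p.2

/-- The process `X` is measurable with respect to the predictable σ-algebra of `𝓕`. -/
def IsPredictable {Ω : Type*} [mΩ : MeasurableSpace Ω]
    (𝓕 : Filtration ℝ≥0 mΩ) (X : ℝ≥0 → Ω → ℝ) : Prop :=
  Measurable[𝓕.predictable] fun p : ℝ≥0 × Ω => X p.1 p.2

/-- The path `f` on `[0, T]`, continued by the constant `f T` after `T`. -/
def stopped (T : ℝ≥0) (f : ℝ≥0 → ℝ) : ℝ≥0 → ℝ := fun t => f (min t T)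

/-- On `[0, T]` the path `f` is right-continuous and of finite variation. -/
def IsFiniteVariationPath (T : ℝ≥0) (f : ℝ≥0 → ℝ) : Prop :=
  BoundedVariationOn (stopped T f) univ ∧
    ∀ t, ContinuousWithinAt (stopped T f) (Ici t) t

open Classical in
/-- The pathwise Lebesgue-Stieltjes integral `∫_0^T h_s df_s` over `(0, T]`
(with value `0` if `f` is not of bounded variation on `[0, T]`). -/
def stieltjesIntegral (T : ℝ≥0) (h f : ℝ≥0 → ℝ) : ℝ :=
  if hf : BoundedVariationOn (stopped T f) univ then
    ∫ᵛ t in Ioc 0 T, h t ∂•hf.vectorMeasure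
  else 0

/-! ### Usual conditions, dual predictable projections, conditional independence -/

/-- The σ-algebra generated by the measurable `Q`-null sets. -/
@[reducible]
def nullSigma {Ω : Type*} [MeasurableSpace Ω] (Q : Measure Ω) : MeasurableSpace Ω :=
  MeasurableSpace.generateFrom {A | MeasurableSet A ∧ Q A = 0}

/-- The `Q`-augmentation of a filtration: all `Q`-null events are added, and then the right
limits are taken. -/
def augmentation {Ω : Type*} [mΩ : MeasurableSpace Ω] (Q : Measure Ω)
    (𝓕 : Filtration ℝ≥0 mΩ) : Filtration ℝ≥0 mΩ :=
  Filtration.rightCont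
    { seq := fun t => 𝓕 t ⊔ nullSigma Q
      mono' := fun _ _ hst => sup_le_sup_right (𝓕.mono hst) _
      le' := fun t => sup_le (𝓕.le t)
        (MeasurableSpace.generateFrom_le fun _ hA => hA.1) }

/-- The random measure `U` is a version of the dual predictable projection (compensator) of the
random measure `N` with respect to `Q` and `𝓕`: it is predictable, that is, integrals of
nonnegative predictable fields against it are predictable processes, and
`E_Q[∫ W dN] = E_Q[∫ W dU]` for every nonnegative predictable field `W`. -/
structure IsDualPredictableProjection {Ω J : Type*} [mΩ : MeasurableSpace Ω]
    [MeasurableSpace J] (𝓕 : Filtration ℝ≥0 mΩ) (Q : Measure Ω)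
    (N U : Kernel Ω (ℝ≥0 × J)) : Prop where
  predictable : ∀ W : ℝ≥0 → Ω → J → ℝ≥0∞, IsPredictableField 𝓕 W →
    Measurable[𝓕.predictable] fun p : ℝ≥0 × Ω =>
      ∫⁻ q in Iic p.1 ×ˢ univ, W q.1 p.2 q.2 ∂(U p.2)
  projection : ∀ W : ℝ≥0 → Ω → J → ℝ≥0∞, IsPredictableField 𝓕 W →
    ∫⁻ ω, ∫⁻ q, W q.1 ω q.2 ∂(N ω) ∂Q = ∫⁻ ω, ∫⁻ q, W q.1 ω q.2 ∂(U ω) ∂Q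

/-- Conditional independence of the σ-algebras `m₁` and `m₂` given the σ-algebra `m'`
(Mathlib's notion asks for a standard Borel `Ω`). -/
def CondIndepSigma {Ω : Type*} [mΩ : MeasurableSpace Ω] (P : Measure Ω)
    (m' m₁ m₂ : MeasurableSpace Ω) : Prop :=
  ∀ A B : Set Ω, MeasurableSet[m₁] A → MeasurableSet[m₂] B →
    P⟦A ∩ B|m'⟧ =ᵐ[P] P⟦A|m'⟧ * P⟦B|m'⟧

/-! ### Systems of modules -/

/-- The data of a system of modules indexed by `ι`, with mark space `J` and horizon `T`. -/
structure ModuleSystem (Ω ι J : Type*) [MeasurableSpace Ω] [MeasurableSpace J] where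
  /-- end of the follow-up period `[0, T]` -/
  T : ℝ≥0
  /-- initial outcomes `V₀` -/
  init : ι → Ω → ℝ
  measurable_init : ∀ V, Measurable (init V)
  /-- time points `T(V₀)` of the initial outcomes -/
  time : ι → ℝ
  /-- the multivariate point process, as a random measure on times and marks -/
  N : Kernel Ω (ℝ≥0 × J)
  /-- marks `J_V` belonging to the module `V` -/
  marks : ι → Set J
  /-- the processes `(V_t)` -/
  proc : ι → ℝ≥0 → Ω → ℝ

namespace ModuleSystem

variable {Ω ι J : Type*} [mΩ : MeasurableSpace Ω] [MeasurableSpace J]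

/-- The past `p(V)`: modules whose initial outcome occurs strictly before that of `V`. -/
def past (S : ModuleSystem Ω ι J) (V : ι) : Set ι := {V' | S.time V' < S.time V}

/-- The σ-algebra generated by the initial outcomes of the modules in `W`. -/
@[reducible]
def initSigma (S : ModuleSystem Ω ι J) (W : Set ι) : MeasurableSpace Ω :=
  ⨆ V ∈ W, MeasurableSpace.comap (S.init V) inferInstance

/-- The filtration generated by `V₀` and `N|_{J_V}` for `V ∈ W`. -/
def rawFiltration (S : ModuleSystem Ω ι J) (W : Set ι) : Filtration ℝ≥0 mΩ where
  seq t := S.initSigma W ⊔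
    ⨆ V ∈ W, ⨆ C ∈ {C : Set (ℝ≥0 × J) | MeasurableSet C ∧ C ⊆ Iic t ×ˢ S.marks V},
      MeasurableSpace.comap (fun ω => S.N ω C) inferInstance
  mono' s t hst := by
    refine sup_le_sup_left (iSup₂_mono fun V _ => ?_) _
    refine biSup_mono fun C hC => ⟨hC.1, hC.2.trans ?_⟩
    exact prod_mono (Iic_subset_Iic.2 hst) subset_rfl
  le' t := by
    refine sup_le (iSup₂_le fun V _ => (S.measurable_init V).comap_le) ?_
    exact iSup₂_le fun V _ => iSup₂_le fun C hC => (S.N.measurable_coe hC.1).comap_le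

/-- The filtration `𝓕_t^W`: generated by `V₀` and `N|_{J_V}` for `V ∈ W`, and made to satisfy the
usual conditions under `Q`. -/
def filtration (S : ModuleSystem Ω ι J) (Q : Measure Ω) (W : Set ι) : Filtration ℝ≥0 mΩ :=
  augmentation Q (S.rawFiltration W)

/-- `X_t = V₀ + ∫_{J_V} ∫_0^t g(s, x) N(ds, dx)` on `[0, T]` for a bounded field `g` that is
predictable with respect to the filtration generated by `V₀` and `N|_{J_V}`. -/
def HasModuleForm (S : ModuleSystem Ω ι J) (V : ι) (X : ℝ≥0 → Ω → ℝ) : Prop :=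
  ∃ g : ℝ≥0 → Ω → J → ℝ, IsPredictableField (S.rawFiltration {V}) g ∧
    (∃ C : ℝ, ∀ s ω x, |g s ω x| ≤ C) ∧
    ∀ t ≤ S.T, ∀ ω, X t ω = S.init V ω + ∫ q in Ioc 0 t ×ˢ S.marks V, g q.1 ω q.2 ∂(S.N ω)

/-- The standing assumptions on the system of modules and the reference measure `Q`. -/
structure IsReference (S : ModuleSystem Ω ι J) (Q : Measure Ω) : Prop where
  time_nonpos : ∀ V, S.time V ≤ 0
  /-- `N` is a multivariate point process on `(0, T]`: finitely many points, at most one at any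
  time. -/
  point_process : ∀ ω, ∃ s : Finset (ℝ≥0 × J), (∀ p ∈ s, 0 < p.1 ∧ p.1 ≤ S.T) ∧
    InjOn Prod.fst (s : Set (ℝ≥0 × J)) ∧ S.N ω = ∑ p ∈ s, Measure.dirac p
  measurableSet_marks : ∀ V, MeasurableSet (S.marks V)
  disjoint_marks : Pairwise fun V V' => Disjoint (S.marks V) (S.marks V')
  iUnion_marks : ⋃ V, S.marks V = univ
  hasModuleForm_proc : ∀ V, S.HasModuleForm V (S.proc V)
  indep_init : iIndepFun S.init Q
  indep_init_N : IndepFun (fun ω V => S.init V ω) (fun ω => (S.N ω : Measure (ℝ≥0 × J))) Q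
  indep_N : iIndepFun (fun V ω => (S.N ω).restrict (univ ×ˢ S.marks V)) Q

/-- `P` is a possible factual distribution: `P ≪ Q`, and every `V₀` is `P`-independent of the
other initial outcomes at the same time point, conditionally on the past. -/
structure IsFactual (S : ModuleSystem Ω ι J) (Q P : Measure Ω) : Prop where
  absolutelyContinuous : P ≪ Q
  contemporaneous : ∀ V, CondIndepSigma P (S.initSigma (S.past V)) (S.initSigma {V})
    (S.initSigma {V' | S.time V' = S.time V ∧ V' ≠ V})

/-! ### Local independence -/

/-- `V` is locally independent of `B` at baseline, conditionally on `V'`. -/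
def LocIndepBaseline (S : ModuleSystem Ω ι J) (Q P : Measure Ω) (V : ι) (B V' : Set ι) : Prop :=
  ∀ η : Ω → ℝ, Measurable[S.filtration Q {V} 0] η → Integrable η P →
    ∃ η' : Ω → ℝ, Measurable[S.filtration Q (S.past V ∩ (V' \ B)) 0] η' ∧ Integrable η' P ∧
      ∀ h : Ω → ℝ, Measurable[S.filtration Q (S.past V ∩ V') 0] h → (∃ C : ℝ, ∀ ω, |h ω| ≤ C) →
        ∫ ω, η ω * h ω ∂P = ∫ ω, η' ω * h ω ∂P

/-- `V` is locally independent of `B` during follow-up, conditionally on `V'`. The integrability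
condition on the bounded test process `h` holds automatically if `N|_{J_V}` has finite
`P`-expectation; in general it is what gives the left-hand expectation a meaning. -/
def LocIndepFollowUp (S : ModuleSystem Ω ι J) (Q P : Measure Ω) (V : ι) (B V' : Set ι) : Prop :=
  ∀ X : ℝ≥0 → Ω → ℝ, S.HasModuleForm V X →
    ∃ Λ : ℝ≥0 → Ω → ℝ, IsPredictable (S.filtration Q ({V} ∪ (V' \ B))) Λ ∧
      (∀ᵐ ω ∂P, IsFiniteVariationPath S.T fun t => Λ t ω) ∧
      ∀ h : ℝ≥0 → Ω → ℝ, IsPredictable (S.filtration Q ({V} ∪ V')) h →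
        (∃ C : ℝ, ∀ s ω, |h s ω| ≤ C) →
        ∫⁻ ω, ∫⁻ q in Ioc 0 S.T ×ˢ S.marks V, ‖h q.1 ω‖ₑ ∂(S.N ω) ∂P < ∞ →
        Integrable (fun ω => stieltjesIntegral S.T (fun s => h s ω) fun s => Λ s ω) P ∧
        ∫ ω, stieltjesIntegral S.T (fun s => h s ω) (fun s => X s ω) ∂P =
          ∫ ω, stieltjesIntegral S.T (fun s => h s ω) (fun s => Λ s ω) ∂P

/-- `B ↛ V | V'`: local independence both at baseline and during follow-up. -/
def LocIndep (S : ModuleSystem Ω ι J) (Q P : Measure Ω) (V : ι) (B V' : Set ι) : Prop :=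
  S.LocIndepBaseline Q P V B V' ∧ S.LocIndepFollowUp Q P V B V'

/-- `lam` is a nonnegative intensity for `N|_{J_V}` relative to `U` under `P` and the history of
`{V} ∪ V'`, predictable with respect to the history of `{V} ∪ (V' ∖ B)`. -/
structure IsIntensity (S : ModuleSystem Ω ι J) (Q P : Measure Ω) (U : Kernel Ω (ℝ≥0 × J))
    (V : ι) (B V' : Set ι) (lam : ℝ≥0 → Ω → J → ℝ) : Prop where
  nonneg : ∀ s ω x, 0 ≤ lam s ω x
  predictable : IsPredictableField (S.filtration Q ({V} ∪ (V' \ B))) lam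
  expectation : ∀ h : ℝ≥0 → Ω → J → ℝ, IsPredictableField (S.filtration Q ({V} ∪ V')) h →
    (∃ C : ℝ, ∀ s ω x, |h s ω x| ≤ C) →
    ∫⁻ ω, ∫⁻ q in Ioc 0 S.T ×ˢ S.marks V, ‖h q.1 ω q.2‖ₑ ∂(S.N ω) ∂P < ∞ →
    (∀ᵐ ω ∂P, IntegrableOn (fun q => h q.1 ω q.2 * lam q.1 ω q.2)
      (Ioc 0 S.T ×ˢ S.marks V) (U ω)) ∧
    Integrable (fun ω => ∫ q in Ioc 0 S.T ×ˢ S.marks V, h q.1 ω q.2 * lam q.1 ω q.2 ∂(U ω)) P ∧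
    ∫ ω, ∫ q in Ioc 0 S.T ×ˢ S.marks V, h q.1 ω q.2 ∂(S.N ω) ∂P =
      ∫ ω, ∫ q in Ioc 0 S.T ×ˢ S.marks V, h q.1 ω q.2 * lam q.1 ω q.2 ∂(U ω) ∂P

end ModuleSystem

end LocalIndependence

end

/-!
The statement compares two descriptions of the behaviour under `P` of the events `N|_{J_V}` of one
module, seen from the history of `{V} ∪ V'`: compensators `Λ` of the processes of the form `(V)`,
and an intensity relative to the `Q`-compensator `U`. Both are required to be predictable for the
smaller history of `{V} ∪ (V' ∖ B)`. Three facts carry the equivalence.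

*The compensator of one module is predictable for the history of that module*
(`IsReference.exists_predictable_compensator_lintegral`). Under `Q` the history of `V` is
independent of that of the other modules. A version of `t ↦ U((0, t] × C)`, `C ⊆ J_V`, predictable
for the joint history is a function of the history of `V` and of the other modules; integrating
out the latter (`exists_kernel_integrate_out`) gives a process predictable for the history of `V`
with the same expectations. Its paths have to be distribution functions of measures. For the
original process this is known almost surely, which is transferred to almost every point of the
product of the two laws by measurable projection (`ae_map_forall_notMem`), since the exceptional
set is a projection along time. Consequently `∫ f dU` over `(0, t] × J_V` has a predictable
version for every history that contains the one of `V` and predicts the field `f`.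

*A predictable process `D` of finite variation with `E[∫ h dD] = 0` for all bounded predictable
`h` is constant in time* (`eq_initial_of_integral_stieltjesIntegral_eq_zero`). With `D_0 = 0`, the
test process `h_s = 1_{s ≤ t} (D_s + D_{s-})`, suitably truncated, gives `E[D_t²] = 0`. The number
of events of `N|_{J_V}` before `s` is predictable, and all test processes are localized to the
sets where it is at most `n` (`ModuleSystem.levelSet`), so no moment condition on `N` is needed.

*Under `P` the events have a density `ρ` relative to the compensator on the predictable fields of
any history that contains the one of `V`* (`IsReference.exists_density`). This is the
Radon–Nikodym theorem for the measures `E_P[N(E)]` and `E_P[U(E)]`; absolute continuity follows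
from the defining property of `U` under `Q` and from `P ≪ Q`.

If there is an intensity `λ`, the compensator of `∫ g dN` is `Λ = ∫ g λ dU`, by the first fact
predictable for the smaller history (`IsIntensity.locIndepFollowUp`). Conversely, let `λ` be the
density `ρ` for the smaller history. For a set `C` of marks, local independence provides a
compensator `Λ` of the process that counts the events with marks in `C`, and by uniqueness `Λ = ∫
1_C λ dU` up to the initial value, because both are compensators for the smaller history. Since
`Λ` is a compensator for the larger history too, the measures `E_P[N(E)]` and `E_P[∫_E λ dU]`
agree on the fields `E = D × C` with `D` predictable for the larger history. These generate all
predictable fields, so `λ` is an intensity (`LocIndepFollowUp.exists_isIntensity`).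
-/

namespace LocalIndependence

open Filter Topology

/-! ### Paths of finite variation and pairs of finite measures -/

/-- On `[0, T]` the path `F` is, up to its initial value, the difference of the distribution
functions of the measures `μ₁` and `μ₂`. -/
def IsDistributionPath (T : ℝ≥0) (F : ℝ≥0 → ℝ) (μ₁ μ₂ : Measure ℝ≥0) : Prop :=
  ∀ t ≤ T, F t = F 0 + μ₁.real (Ioc 0 t) - μ₂.real (Ioc 0 t)

lemma continuousWithinAt_measureReal_Ioc (μ : Measure ℝ≥0) [IsFiniteMeasure μ] (t : ℝ≥0) :
    ContinuousWithinAt (fun t => μ.real (Ioc 0 t)) (Ici t) t := by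
  rw [← continuousWithinAt_Ioi_iff_Ici]
  have h := tendsto_measure_biInter_gt (μ := μ) (s := fun r : ℝ≥0 => Ioc 0 r) (a := t)
    (fun r _ => measurableSet_Ioc.nullMeasurableSet) (fun i j _ hij => Ioc_subset_Ioc_right hij)
    ⟨t + 1, by simp, measure_ne_top _ _⟩
  have hI : (⋂ r > t, Ioc 0 r) = Ioc 0 t := by
    ext x
    simp only [gt_iff_lt, mem_iInter, mem_Ioc]
    refine ⟨fun hx => ⟨(hx (t + 1) (by simp)).1, ?_⟩, fun hx r hr => ⟨hx.1, hx.2.trans hr.le⟩⟩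
    exact le_of_forall_gt_imp_ge_of_dense fun r hr => (hx r hr).2
  rw [hI] at h
  exact (ENNReal.tendsto_toReal (measure_ne_top _ _)).comp h

lemma IsDistributionPath.stopped_eq {T : ℝ≥0} {F : ℝ≥0 → ℝ} {μ₁ μ₂ : Measure ℝ≥0}
    (h : IsDistributionPath T F μ₁ μ₂) :
    stopped T F = fun t => F 0 +
      (μ₁.real (Ioc 0 (min t T)) - μ₂.real (Ioc 0 (min t T))) := by
  funext t
  rw [stopped, h _ (min_le_right _ _)]
  ring

lemma boundedVariationOn_measureReal_Ioc (μ : Measure ℝ≥0) [IsFiniteMeasure μ] (T : ℝ≥0) :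
    BoundedVariationOn (fun t => μ.real (Ioc 0 (min t T))) univ := by
  refine MonotoneOn.boundedVariationOn (C := μ.real univ) ?_ ?_
  · intro s _ t _ hst
    exact measureReal_mono (Ioc_subset_Ioc_right (min_le_min_right _ hst))
  · intro x _
    rw [abs_of_nonneg measureReal_nonneg]
    exact measureReal_mono (subset_univ _)

lemma IsDistributionPath.isFiniteVariationPath {T : ℝ≥0} {F : ℝ≥0 → ℝ} {μ₁ μ₂ : Measure ℝ≥0}
    [IsFiniteMeasure μ₁] [IsFiniteMeasure μ₂] (h : IsDistributionPath T F μ₁ μ₂) :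
    IsFiniteVariationPath T F := by
  have hc : ∀ (μ : Measure ℝ≥0) [IsFiniteMeasure μ] (t : ℝ≥0),
      ContinuousWithinAt (fun t => μ.real (Ioc 0 (min t T))) (Ici t) t := by
    intro μ _ t
    have h2 : ContinuousWithinAt (fun s : ℝ≥0 => min s T) (Ici t) t :=
      (continuous_id.min continuous_const).continuousWithinAt
    exact ContinuousWithinAt.comp (g := fun t => μ.real (Ioc 0 t)) (t := Ici (min t T))
      (continuousWithinAt_measureReal_Ioc μ (min t T)) h2
      (fun s hs => min_le_min_right T (mem_Ici.1 hs))
  rw [IsFiniteVariationPath, h.stopped_eq]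
  refine ⟨?_, fun t => continuousWithinAt_const.add ((hc μ₁ t).sub (hc μ₂ t))⟩
  -- The variation is dominated by that of the distribution function of `μ₁ + μ₂`.
  refine ne_top_of_le_ne_top (boundedVariationOn_measureReal_Ioc (μ₁ + μ₂) T) ?_
  refine iSup_mono fun p => Finset.sum_le_sum fun i _ => ?_
  have hm : ∀ (μ : Measure ℝ≥0) [IsFiniteMeasure μ], μ.real (Ioc 0 (min (p.2.1 i) T)) ≤
      μ.real (Ioc 0 (min (p.2.1 (i + 1)) T)) := fun μ _ =>
    measureReal_mono (Ioc_subset_Ioc_right (min_le_min_right _ (p.2.2.1 (Nat.le_succ i))))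
  have h1 := hm μ₁
  have h2 := hm μ₂
  simp only [edist_dist, Real.dist_eq]
  rw [measureReal_add_apply,
    measureReal_add_apply]
  refine ENNReal.ofReal_le_ofReal (le_trans ?_ (le_abs_self _))
  rw [abs_le]
  constructor <;> linarith

lemma IsFiniteVariationPath.vectorMeasure_Ioc {T : ℝ≥0} {F : ℝ≥0 → ℝ}
    (h : IsFiniteVariationPath T F) {t : ℝ≥0} (ht : t ≤ T) :
    h.1.vectorMeasure (Ioc 0 t) = F t - F 0 := by
  have hr : ∀ s, Function.rightLim (stopped T F) s = stopped T F s := fun s =>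
    ContinuousWithinAt.rightLim_eq (h.2 s)
  rw [h.1.vectorMeasure_Ioc (by simp), hr, hr]
  simp [stopped, ht]

lemma IsDistributionPath.restrict_vectorMeasure {T : ℝ≥0} {F : ℝ≥0 → ℝ} {μ₁ μ₂ : Measure ℝ≥0}
    [IsFiniteMeasure μ₁] [IsFiniteMeasure μ₂] (h : IsDistributionPath T F μ₁ μ₂)
    (hF : IsFiniteVariationPath T F) :
    hF.1.vectorMeasure.restrict (Ioc 0 T) =
      (μ₁.restrict (Ioc 0 T)).toSignedMeasure - (μ₂.restrict (Ioc 0 T)).toSignedMeasure := by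
  have key : ∀ s, s ≤ T → hF.1.vectorMeasure (Ioc 0 s) =
      μ₁.real (Ioc 0 s) - μ₂.real (Ioc 0 s) := by
    intro s hs
    rw [hF.vectorMeasure_Ioc hs, h s hs]
    ring
  have hI : ∀ t, Iic t ∩ Ioc 0 T = Ioc 0 (min t T) := by
    intro t
    ext x
    simp only [mem_inter_iff, mem_Iic, mem_Ioc, le_min_iff]
    tauto
  refine VectorMeasure.ext_of_generateFrom (range Iic) ?_ ?_ isPiSystem_Iic ?_
  · rintro _ ⟨t, rfl⟩
    rw [VectorMeasure.restrict_apply _ measurableSet_Ioc measurableSet_Iic, hI,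
      key _ (min_le_right _ _), sub_apply,
      Measure.toSignedMeasure_apply_measurable measurableSet_Iic,
      Measure.toSignedMeasure_apply_measurable measurableSet_Iic,
      measureReal_restrict_apply measurableSet_Iic,
      measureReal_restrict_apply measurableSet_Iic, hI]
  · rw [← borel_eq_generateFrom_Iic, BorelSpace.measurable_eq (α := ℝ≥0)]
  · rw [VectorMeasure.restrict_apply _ measurableSet_Ioc MeasurableSet.univ, univ_inter,
      key _ le_rfl, sub_apply,
      Measure.toSignedMeasure_apply_measurable MeasurableSet.univ,
      Measure.toSignedMeasure_apply_measurable MeasurableSet.univ,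
      measureReal_restrict_apply MeasurableSet.univ,
      measureReal_restrict_apply MeasurableSet.univ, univ_inter]

/-- The Stieltjes integral against a difference of distribution functions is the difference of
the integrals against the measures. -/
lemma IsDistributionPath.stieltjesIntegral_eq {T : ℝ≥0} {F : ℝ≥0 → ℝ} {μ₁ μ₂ : Measure ℝ≥0}
    [IsFiniteMeasure μ₁] [IsFiniteMeasure μ₂] (h : IsDistributionPath T F μ₁ μ₂)
    {k : ℝ≥0 → ℝ} (hk₁ : IntegrableOn k (Ioc 0 T) μ₁) (hk₂ : IntegrableOn k (Ioc 0 T) μ₂) :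
    stieltjesIntegral T k F = ∫ s in Ioc 0 T, k s ∂μ₁ - ∫ s in Ioc 0 T, k s ∂μ₂ := by
  have hF := h.isFiniteVariationPath
  have hflip : ContinuousLinearMap.lsmul ℝ ℝ (E := ℝ) = (ContinuousLinearMap.lsmul ℝ ℝ).flip := by
    ext
    simp
  rw [stieltjesIntegral, dif_pos hF.1, h.restrict_vectorMeasure hF, hflip,
    VectorMeasure.integral_sub_vectorMeasure, VectorMeasure.integral_toSignedMeasure,
    VectorMeasure.integral_toSignedMeasure]
  · rw [VectorMeasure.Integrable, Measure.variation_toSignedMeasure]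
    exact hk₁
  · rw [VectorMeasure.Integrable, Measure.variation_toSignedMeasure]
    exact hk₂

lemma IsFiniteVariationPath.exists_isDistributionPath {T : ℝ≥0} {F : ℝ≥0 → ℝ}
    (h : IsFiniteVariationPath T F) :
    ∃ μ₁ μ₂ : Measure ℝ≥0, IsFiniteMeasure μ₁ ∧ IsFiniteMeasure μ₂ ∧
      IsDistributionPath T F μ₁ μ₂ := by
  let ν : SignedMeasure ℝ≥0 := h.1.vectorMeasure
  refine ⟨ν.toJordanDecomposition.posPart, ν.toJordanDecomposition.negPart,
    inferInstance, inferInstance, fun t ht => ?_⟩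
  have h1 := ν.apply_eq_posPart_real_sub_negPart_real (i := Ioc 0 t) measurableSet_Ioc
  have h2 : ν (Ioc 0 t) = F t - F 0 := h.vectorMeasure_Ioc ht
  linarith

lemma IsDistributionPath.sub {T : ℝ≥0} {F G : ℝ≥0 → ℝ} {μ₁ μ₂ ν₁ ν₂ : Measure ℝ≥0}
    [IsFiniteMeasure μ₁] [IsFiniteMeasure μ₂] [IsFiniteMeasure ν₁] [IsFiniteMeasure ν₂]
    (h : IsDistributionPath T F μ₁ μ₂) (h' : IsDistributionPath T G ν₁ ν₂) :
    IsDistributionPath T (fun t => F t - G t) (μ₁ + ν₂) (μ₂ + ν₁) := by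
  intro t ht
  simp only [h t ht, h' t ht]
  rw [measureReal_add_apply, measureReal_add_apply]
  ring

/-! ### The square of a path of finite variation -/

/-- Integration by parts for the distribution functions of two measures. -/
lemma lintegral_measure_Iic_add_lintegral_measure_Iio (μ ν : Measure ℝ≥0) [IsFiniteMeasure μ]
    [IsFiniteMeasure ν] :
    ∫⁻ s, μ (Iic s) ∂ν + ∫⁻ s, ν (Iio s) ∂μ = μ univ * ν univ := by
  have hm : MeasurableSet {p : ℝ≥0 × ℝ≥0 | p.1 ≤ p.2} :=
    measurableSet_le measurable_fst measurable_snd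
  have h1 : (μ.prod ν) {p : ℝ≥0 × ℝ≥0 | p.1 ≤ p.2} = ∫⁻ s, μ (Iic s) ∂ν := by
    rw [Measure.prod_apply_symm hm]
    rfl
  have h2 : (μ.prod ν) {p : ℝ≥0 × ℝ≥0 | p.1 ≤ p.2}ᶜ = ∫⁻ s, ν (Iio s) ∂μ := by
    rw [Measure.prod_apply hm.compl]
    congr! with s
    ext x
    simp
  rw [← h1, ← h2, measure_add_measure_compl hm, ← univ_prod_univ, Measure.prod_prod]

lemma measurable_measureReal_Iic (μ : Measure ℝ≥0) [IsFiniteMeasure μ] :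
    Measurable fun s => μ.real (Iic s) :=
  Monotone.measurable fun _ _ hst => measureReal_mono (Iic_subset_Iic.2 hst)

lemma measurable_measureReal_Iio (μ : Measure ℝ≥0) [IsFiniteMeasure μ] :
    Measurable fun s => μ.real (Iio s) :=
  Monotone.measurable fun _ _ hst => measureReal_mono (Iio_subset_Iio hst)

lemma integrable_of_abs_le {α : Type*} [MeasurableSpace α] {μ : Measure α} [IsFiniteMeasure μ]
    {f : α → ℝ} (hf : Measurable f) {C : ℝ} (hC : ∀ x, |f x| ≤ C) : Integrable f μ :=
  Integrable.of_bound hf.aestronglyMeasurable C (Eventually.of_forall hC)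

lemma integrable_measureReal_Iic (μ ν : Measure ℝ≥0) [IsFiniteMeasure μ] [IsFiniteMeasure ν] :
    Integrable (fun s => μ.real (Iic s)) ν :=
  integrable_of_abs_le (measurable_measureReal_Iic μ) (C := μ.real univ) fun x => by
    rw [abs_of_nonneg measureReal_nonneg]
    exact measureReal_mono (subset_univ _)

lemma integrable_measureReal_Iio (μ ν : Measure ℝ≥0) [IsFiniteMeasure μ] [IsFiniteMeasure ν] :
    Integrable (fun s => μ.real (Iio s)) ν :=
  integrable_of_abs_le (measurable_measureReal_Iio μ) (C := μ.real univ) fun x => by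
    rw [abs_of_nonneg measureReal_nonneg]
    exact measureReal_mono (subset_univ _)

lemma integral_measureReal_Iic_add_Iio (μ ν : Measure ℝ≥0) [IsFiniteMeasure μ]
    [IsFiniteMeasure ν] :
    ∫ s, μ.real (Iic s) ∂ν + ∫ s, ν.real (Iio s) ∂μ = μ.real univ * ν.real univ := by
  have h := congrArg ENNReal.toReal (lintegral_measure_Iic_add_lintegral_measure_Iio μ ν)
  rw [ENNReal.toReal_mul] at h
  rw [measureReal_def, measureReal_def, ← h, ENNReal.toReal_add,
    integral_eq_lintegral_of_nonneg_ae, integral_eq_lintegral_of_nonneg_ae]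
  · simp [measureReal_def]
  · exact Eventually.of_forall fun _ => measureReal_nonneg
  · exact (measurable_measureReal_Iio ν).aestronglyMeasurable
  · exact Eventually.of_forall fun _ => measureReal_nonneg
  · exact (measurable_measureReal_Iic μ).aestronglyMeasurable
  · refine ((lintegral_mono fun s => measure_mono (subset_univ _)).trans_lt ?_).ne (b := ∞)
    rw [lintegral_const]
    exact ENNReal.mul_lt_top (measure_lt_top _ _) (measure_lt_top _ _)
  · refine ((lintegral_mono fun s => measure_mono (subset_univ _)).trans_lt ?_).ne (b := ∞)
    rw [lintegral_const]
    exact ENNReal.mul_lt_top (measure_lt_top _ _) (measure_lt_top _ _)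

/-- The chain rule `d(f²) = (f + f₋) df` for the distribution function `f` of `μ₁ - μ₂`, integrated
over the whole line. -/
lemma integral_Iic_add_Iio_sub (μ₁ μ₂ : Measure ℝ≥0) [IsFiniteMeasure μ₁] [IsFiniteMeasure μ₂] :
    ∫ s, ((μ₁.real (Iic s) - μ₂.real (Iic s)) + (μ₁.real (Iio s) - μ₂.real (Iio s))) ∂μ₁ -
      ∫ s, ((μ₁.real (Iic s) - μ₂.real (Iic s)) + (μ₁.real (Iio s) - μ₂.real (Iio s))) ∂μ₂ =
      (μ₁.real univ - μ₂.real univ) ^ 2 := by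
  have e : ∀ (ν : Measure ℝ≥0) [IsFiniteMeasure ν],
      ∫ s, ((μ₁.real (Iic s) - μ₂.real (Iic s)) + (μ₁.real (Iio s) - μ₂.real (Iio s))) ∂ν =
      (∫ s, μ₁.real (Iic s) ∂ν - ∫ s, μ₂.real (Iic s) ∂ν) +
        (∫ s, μ₁.real (Iio s) ∂ν - ∫ s, μ₂.real (Iio s) ∂ν) := by
    intro ν _
    have a1 := integrable_measureReal_Iic μ₁ ν
    have a2 := integrable_measureReal_Iic μ₂ ν
    have b1 := integrable_measureReal_Iio μ₁ ν
    have b2 := integrable_measureReal_Iio μ₂ ν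
    rw [← integral_sub a1 a2, ← integral_sub b1 b2]
    exact integral_add (a1.sub a2) (b1.sub b2)
  rw [e, e]
  linear_combination integral_measureReal_Iic_add_Iio μ₁ μ₁ +
    integral_measureReal_Iic_add_Iio μ₂ μ₂ - integral_measureReal_Iic_add_Iio μ₁ μ₂ -
    integral_measureReal_Iic_add_Iio μ₂ μ₁

/-- The chain rule `d(f²) = (f + f₋) df` integrated over an initial interval `I` of `(0, ∞)`. -/
lemma setIntegral_Ioc_add_Ioo_sub (μ₁ μ₂ : Measure ℝ≥0) [IsFiniteMeasure μ₁] [IsFiniteMeasure μ₂]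
    {I : Set ℝ≥0} (hIm : MeasurableSet I) (hI0 : I ⊆ Ioi 0)
    (hI : ∀ s t, 0 < s → s ≤ t → t ∈ I → s ∈ I) :
    ∫ s in I, ((μ₁.real (Ioc 0 s) - μ₂.real (Ioc 0 s)) +
        (μ₁.real (Ioo 0 s) - μ₂.real (Ioo 0 s))) ∂μ₁ -
      ∫ s in I, ((μ₁.real (Ioc 0 s) - μ₂.real (Ioc 0 s)) +
        (μ₁.real (Ioo 0 s) - μ₂.real (Ioo 0 s))) ∂μ₂ =
      (μ₁.real I - μ₂.real I) ^ 2 := by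
  have h := integral_Iic_add_Iio_sub (μ₁.restrict I) (μ₂.restrict I)
  have h1 : ∀ s ∈ I, Iic s ∩ I = Ioc 0 s := fun s hs => by
    ext x
    exact ⟨fun hx => ⟨hI0 hx.2, hx.1⟩, fun hx => ⟨hx.2, hI x s hx.1 hx.2 hs⟩⟩
  have h2 : ∀ s ∈ I, Iio s ∩ I = Ioo 0 s := fun s hs => by
    ext x
    exact ⟨fun hx => ⟨hI0 hx.2, hx.1⟩, fun hx => ⟨hx.2, hI x s hx.1 hx.2.le hs⟩⟩
  simp only [measureReal_restrict_apply measurableSet_Iic,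
    measureReal_restrict_apply measurableSet_Iio, measureReal_restrict_apply MeasurableSet.univ,
    univ_inter] at h
  rw [← h]
  congr 1
  · exact setIntegral_congr_fun hIm fun s hs => by simp only [h1 s hs, h2 s hs]
  · exact setIntegral_congr_fun hIm fun s hs => by simp only [h1 s hs, h2 s hs]

/-! ### The predictable σ-algebra -/

section Predictable

variable {Ω : Type*} {mΩ : MeasurableSpace Ω}

lemma predictable_le_prod (𝓕 : Filtration ℝ≥0 mΩ) :
    𝓕.predictable ≤ Prod.instMeasurableSpace :=
  measurableSpace_le_predictable_of_measurableSet
    (fun _ hA => (measurableSet_singleton _).prod (𝓕.le _ _ hA))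
    (fun _ _ hA => measurableSet_Ioi.prod (𝓕.le _ _ hA))

lemma predictable_mono {𝓕 𝓖 : Filtration ℝ≥0 mΩ} (h : 𝓕 ≤ 𝓖) :
    𝓕.predictable ≤ 𝓖.predictable :=
  measurableSpace_le_predictable_of_measurableSet
    (fun _ hA => measurableSet_predictable_singleton_bot_prod (h _ _ hA))
    (fun _ _ hA => measurableSet_predictable_Ioi_prod (h _ _ hA))

lemma measurable_fst_predictable (𝓕 : Filtration ℝ≥0 mΩ) :
    Measurable[𝓕.predictable] (Prod.fst : ℝ≥0 × Ω → ℝ≥0) := by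
  rw [BorelSpace.measurable_eq (α := ℝ≥0), borel_eq_generateFrom_Ioi]
  refine @measurable_generateFrom _ _ 𝓕.predictable _ _ ?_
  rintro _ ⟨t, rfl⟩
  have h := measurableSet_predictable_Ioi_prod (𝓕 := 𝓕) (i := t) (s := univ) MeasurableSet.univ
  rwa [prod_univ] at h

lemma measurableSet_predictable_prod_of_zero (𝓕 : Filtration ℝ≥0 mΩ) {A : Set Ω}
    (hA : MeasurableSet[𝓕 0] A) : MeasurableSet[𝓕.predictable] ((univ : Set ℝ≥0) ×ˢ A) := by
  have h1 := measurableSet_predictable_singleton_bot_prod (𝓕 := 𝓕) hA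
  have h2 := measurableSet_predictable_Ioi_prod (𝓕 := 𝓕) hA
  have h := h1.union h2
  rwa [← union_prod, show ({⊥} ∪ Ioi 0 : Set ℝ≥0) = univ by
    ext x
    simp] at h

lemma measurable_predictable_of_zero (𝓕 : Filtration ℝ≥0 mΩ) {E : Type*} [MeasurableSpace E]
    {X : Ω → E} (hX : Measurable[𝓕 0] X) :
    Measurable[𝓕.predictable] fun p : ℝ≥0 × Ω => X p.2 := by
  intro B hB
  have h := measurableSet_predictable_prod_of_zero 𝓕 (hX hB)
  rwa [univ_prod] at h

lemma IsPredictable.measurable_apply {𝓕 : Filtration ℝ≥0 mΩ} {D : ℝ≥0 → Ω → ℝ}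
    (hD : IsPredictable 𝓕 D) (t : ℝ≥0) : Measurable[𝓕 t] (D t) := by
  have h : IsStronglyPredictable 𝓕 D := Measurable.stronglyMeasurable hD
  exact (h.stronglyAdapted t).measurable

lemma IsPredictable.measurable_path {𝓕 : Filtration ℝ≥0 mΩ} {D : ℝ≥0 → Ω → ℝ}
    (hD : IsPredictable 𝓕 D) (ω : Ω) : Measurable fun t => D t ω :=
  (hD.mono (predictable_le_prod 𝓕) le_rfl).comp measurable_prodMk_right

/-- The largest multiple of `2⁻ⁿ` strictly below `t > 0`. -/
noncomputable def dyadicBelow (n : ℕ) (t : ℝ≥0) : ℝ≥0 := ((⌈t * 2 ^ n⌉₊ - 1 : ℕ) : ℝ≥0) / 2 ^ n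

lemma dyadicBelow_lt (n : ℕ) {t : ℝ≥0} (ht : 0 < t) : dyadicBelow n t < t := by
  rw [dyadicBelow, div_lt_iff₀ (by positivity), ← Nat.lt_ceil]
  have : 0 < ⌈t * 2 ^ n⌉₊ := Nat.ceil_pos.2 (by positivity)
  omega

lemma le_dyadicBelow_add (n : ℕ) (t : ℝ≥0) : t ≤ dyadicBelow n t + (1 / 2) ^ n := by
  rw [dyadicBelow, one_div, inv_pow, ← one_div, ← add_div, le_div_iff₀ (by positivity)]
  refine (Nat.le_ceil _).trans ?_
  exact_mod_cast Nat.le_add_of_sub_le le_rfl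

lemma eventually_lt_dyadicBelow {x t : ℝ≥0} (hx : x < t) : ∀ᶠ n in atTop, x < dyadicBelow n t := by
  obtain ⟨y, hy, rfl⟩ : ∃ y, 0 < y ∧ t = x + y :=
    ⟨t - x, tsub_pos_of_lt hx, (add_tsub_cancel_of_le hx.le).symm⟩
  have h := tendsto_pow_atTop_nhds_zero_of_lt_one (r := (1 / 2 : ℝ≥0)) zero_le
    (by rw [one_div]; exact inv_lt_one_of_one_lt₀ one_lt_two)
  filter_upwards [h.eventually_lt_const hy] with n hn
  have h1 := le_dyadicBelow_add n (x + y)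
  by_contra hcon
  have h2 := h1.trans_lt (add_lt_add_of_le_of_lt (not_lt.1 hcon) hn)
  exact lt_irrefl _ h2

/-- Left-continuous step approximations of an adapted process are predictable. -/
lemma measurable_predictable_dyadicBelow (𝓕 : Filtration ℝ≥0 mΩ) {g : ℝ≥0 → Ω → ℝ}
    (hg : ∀ t, Measurable[𝓕 t] (g t)) (n : ℕ) :
    Measurable[𝓕.predictable] fun p : ℝ≥0 × Ω => g (dyadicBelow n p.1) p.2 := by
  intro B hB
  have hN : Measurable[𝓕.predictable] fun p : ℝ≥0 × Ω => ⌈p.1 * 2 ^ n⌉₊ :=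
    Nat.measurable_ceil.comp ((measurable_fst_predictable 𝓕).mul_const _)
  have hE : (fun p : ℝ≥0 × Ω => g (dyadicBelow n p.1) p.2) ⁻¹' B =
      ((fun p : ℝ≥0 × Ω => ⌈p.1 * 2 ^ n⌉₊) ⁻¹' {0} ∩ univ ×ˢ (g 0 ⁻¹' B)) ∪
        ⋃ j : ℕ, (fun p : ℝ≥0 × Ω => ⌈p.1 * 2 ^ n⌉₊) ⁻¹' {j + 1} ∩
          Ioi ((j : ℝ≥0) / 2 ^ n) ×ˢ (g ((j : ℝ≥0) / 2 ^ n) ⁻¹' B) := by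
    ext ⟨t, ω⟩
    simp only [mem_preimage, mem_union, mem_inter_iff, mem_singleton_iff, mem_prod, mem_univ,
      true_and, mem_iUnion, mem_Ioi, dyadicBelow]
    rcases hj : ⌈t * 2 ^ n⌉₊ with _ | j
    · simp
    · have hlt : (j : ℝ≥0) / 2 ^ n < t := by
        rw [div_lt_iff₀ (by positivity), ← Nat.lt_ceil, hj]
        exact Nat.lt_succ_self j
      simp [hlt]
  rw [hE]
  refine MeasurableSet.union ?_ (MeasurableSet.iUnion fun j => ?_)
  · exact (hN (measurableSet_singleton 0)).inter
      (measurableSet_predictable_prod_of_zero 𝓕 (hg 0 hB))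
  · exact (hN (measurableSet_singleton (j + 1))).inter
      (measurableSet_predictable_Ioi_prod (hg _ hB))

end Predictable

/-! ### Uniqueness of predictable processes of finite variation -/

lemma tendsto_measureReal_Ioc_dyadicBelow (μ : Measure ℝ≥0) [IsFiniteMeasure μ] {t : ℝ≥0}
    (ht : 0 < t) :
    Tendsto (fun n => μ.real (Ioc 0 (dyadicBelow n t))) atTop (𝓝 (μ.real (Ioo 0 t))) := by
  refine (ENNReal.tendsto_toReal (measure_ne_top _ _)).comp ?_
  refine tendsto_measure_of_tendsto_indicator_of_isFiniteMeasure atTop μ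
    (fun n => measurableSet_Ioc) ?_
  intro x
  by_cases hx : x < t
  · filter_upwards [eventually_lt_dyadicBelow hx] with n hn
    simp [hx, hn.le]
  · refine Eventually.of_forall fun n => ?_
    have : ¬ x ≤ dyadicBelow n t := fun h => hx (h.trans_lt (dyadicBelow_lt n ht))
    simp [hx, this]

/-- A right-continuous path that is in a closed set at rational times is always in that set. -/
lemma mem_of_forall_rat_mem {f : ℝ≥0 → ℝ} {t u : ℝ≥0} (hf : ContinuousWithinAt f (Ici t) t)
    {C : Set ℝ} (hC : IsClosed C) (htu : t < u)
    (h : ∀ r : ℚ, t < Real.toNNReal r → Real.toNNReal r < u → f (Real.toNNReal r) ∈ C) :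
    f t ∈ C := by
  have hf' : Tendsto f (𝓝[>] t) (𝓝 (f t)) := continuousWithinAt_Ioi_iff_Ici.2 hf
  refine hC.mem_of_frequently_of_tendsto ?_ hf'
  rw [frequently_iff]
  intro U hU
  obtain ⟨v, hv, hvU⟩ := (mem_nhdsGT_iff_exists_Ioo_subset' htu).1 hU
  obtain ⟨r, hr1, hr2⟩ : ∃ r : ℚ, t < Real.toNNReal r ∧ Real.toNNReal r < min u v := by
    obtain ⟨q, hq1, hq2⟩ := exists_rat_btwn
      (show (t : ℝ) < ((min u v : ℝ≥0) : ℝ) from by exact_mod_cast lt_min htu hv)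
    have hq0 : (0 : ℝ) ≤ q := t.2.trans hq1.le
    refine ⟨q, ?_, ?_⟩
    · rwa [← NNReal.coe_lt_coe, Real.coe_toNNReal _ hq0]
    · rwa [← NNReal.coe_lt_coe, Real.coe_toNNReal _ hq0]
  exact ⟨Real.toNNReal r, hvU ⟨hr1, hr2.trans_le (min_le_right _ _)⟩,
    h r hr1 (hr2.trans_le (min_le_left _ _))⟩

lemma IsDistributionPath.continuousWithinAt {T : ℝ≥0} {F : ℝ≥0 → ℝ} {μ₁ μ₂ : Measure ℝ≥0}
    [IsFiniteMeasure μ₁] [IsFiniteMeasure μ₂] (h : IsDistributionPath T F μ₁ μ₂) {t : ℝ≥0}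
    (ht : t < T) : ContinuousWithinAt F (Ici t) t := by
  have h1 : ContinuousWithinAt (stopped T F) (Ici t) t := h.isFiniteVariationPath.2 t
  refine h1.congr_of_eventuallyEq ?_ (by simp [stopped, ht.le])
  filter_upwards [nhdsWithin_le_nhds (Iio_mem_nhds ht)] with s hs
  simp [stopped, (mem_Iio.1 hs).le]

/-- The set of points `(t, ω)` such that the process `D` stays in `[-m, m]` at time `t` and at all
rational times before `t`. -/
def boundedUpTo {Ω : Type*} (D : ℝ≥0 → Ω → ℝ) (m : ℝ) : Set (ℝ≥0 × Ω) :=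
  {p | |D p.1 p.2| ≤ m ∧
    ∀ r : ℚ, Real.toNNReal r < p.1 → |D (Real.toNNReal r) p.2| ≤ m}

lemma measurableSet_boundedUpTo {Ω : Type*} {mΩ : MeasurableSpace Ω} {𝓕 : Filtration ℝ≥0 mΩ}
    {D : ℝ≥0 → Ω → ℝ} (hD : IsPredictable 𝓕 D) (m : ℝ) :
    MeasurableSet[𝓕.predictable] (boundedUpTo D m) := by
  have h1 : MeasurableSet[𝓕.predictable] {p : ℝ≥0 × Ω | |D p.1 p.2| ≤ m} :=
    hD (isClosed_le continuous_abs continuous_const).measurableSet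
  have h2 : ∀ r : ℚ, MeasurableSet[𝓕.predictable]
      {p : ℝ≥0 × Ω | Real.toNNReal r < p.1 → |D (Real.toNNReal r) p.2| ≤ m} := by
    intro r
    have hA : MeasurableSet[𝓕 (Real.toNNReal r)] {ω | |D (Real.toNNReal r) ω| ≤ m} :=
      hD.measurable_apply _ (isClosed_le continuous_abs continuous_const).measurableSet
    have h3 := (measurableSet_predictable_Ioi_prod hA.compl).compl
    convert! h3 using 1
    ext p
    simp only [mem_ofPred_eq, mem_compl_iff, mem_prod, mem_Ioi, not_and, not_not]
  have h4 := h1.inter (MeasurableSet.iInter h2)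
  convert! h4 using 1
  ext p
  simp [boundedUpTo]

lemma mem_boundedUpTo_of_le {Ω : Type*} {D : ℝ≥0 → Ω → ℝ} {m : ℝ} {T s t : ℝ≥0} {ω : Ω}
    {μ₁ μ₂ : Measure ℝ≥0} [IsFiniteMeasure μ₁] [IsFiniteMeasure μ₂]
    (h : IsDistributionPath T (fun t => D t ω) μ₁ μ₂) (hst : s ≤ t) (ht : t ≤ T)
    (hm : (t, ω) ∈ boundedUpTo D m) : (s, ω) ∈ boundedUpTo D m := by
  rcases hst.eq_or_lt with rfl | hlt
  · exact hm
  refine ⟨?_, fun r hr => hm.2 r (hr.trans hlt)⟩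
  have hC : IsClosed {x : ℝ | |x| ≤ m} := isClosed_le continuous_abs continuous_const
  exact mem_of_forall_rat_mem (h.continuousWithinAt (hlt.trans_le ht)) hC hlt
    fun r _ hr => hm.2 r hr

/-- A real number, truncated to `[-m, m]`. -/
noncomputable def truncate (m x : ℝ) : ℝ := max (-m) (min m x)

lemma abs_truncate_le {m : ℝ} (hm : 0 ≤ m) (x : ℝ) : |truncate m x| ≤ m := by
  rw [abs_le, truncate]
  exact ⟨le_max_left _ _, max_le (by linarith) (min_le_left _ _)⟩

lemma truncate_eq {m x : ℝ} (hx : |x| ≤ m) : truncate m x = x := by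
  rw [truncate, min_eq_right (abs_le.1 hx).2, max_eq_right (abs_le.1 hx).1]

lemma measurable_truncate (m : ℝ) : Measurable (truncate m) :=
  measurable_const.max (measurable_const.min measurable_id)

open Classical in
/-- The bounded test process `1_{(0, t]}(s) 1_L(s) (D_s + D_{s-})`, where `D` is truncated at `m`
and `L` is intersected with the set where `D` has been bounded by `m` so far. -/
noncomputable def squareTest {Ω : Type*} (D : ℝ≥0 → Ω → ℝ) (L : Set (ℝ≥0 × Ω)) (m : ℝ) (t : ℝ≥0)
    (s : ℝ≥0) (ω : Ω) : ℝ :=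
  if (s, ω) ∈ Ioc 0 t ×ˢ univ ∩ (L ∩ boundedUpTo D m) then
    truncate m (D s ω) + truncate m (limsup (fun n => D (dyadicBelow n s) ω) atTop) else 0

lemma isPredictable_squareTest {Ω : Type*} {mΩ : MeasurableSpace Ω} {𝓕 : Filtration ℝ≥0 mΩ}
    {D : ℝ≥0 → Ω → ℝ} (hD : IsPredictable 𝓕 D) {L : Set (ℝ≥0 × Ω)}
    (hL : MeasurableSet[𝓕.predictable] L) (m : ℝ) (t : ℝ≥0) :
    IsPredictable 𝓕 (squareTest D L m t) := by
  have h1 : Measurable[𝓕.predictable] fun p : ℝ≥0 × Ω =>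
      limsup (fun n => D (dyadicBelow n p.1) p.2) atTop :=
    Measurable.limsup fun n => measurable_predictable_dyadicBelow 𝓕 hD.measurable_apply n
  have h2 : MeasurableSet[𝓕.predictable] ((Ioc 0 t ×ˢ univ : Set (ℝ≥0 × Ω))) :=
    measurableSet_predictable_Ioc_prod 0 t MeasurableSet.univ
  exact Measurable.ite (h2.inter (hL.inter (measurableSet_boundedUpTo hD m)))
    (((measurable_truncate m).comp hD).add ((measurable_truncate m).comp h1)) measurable_const

lemma abs_squareTest_le {Ω : Type*} (D : ℝ≥0 → Ω → ℝ) (L : Set (ℝ≥0 × Ω)) {m : ℝ} (hm : 0 ≤ m)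
    (t s : ℝ≥0) (ω : Ω) : |squareTest D L m t s ω| ≤ m + m := by
  rw [squareTest]
  split_ifs
  · exact (abs_add_le _ _).trans (add_le_add (abs_truncate_le hm _) (abs_truncate_le hm _))
  · simp only [abs_zero]
    linarith

/-- On a path of finite variation the test process `squareTest` integrates to the square of the
increment over the random interval where it lives. -/
lemma stieltjesIntegral_squareTest {Ω : Type*} {D : ℝ≥0 → Ω → ℝ} {L : Set (ℝ≥0 × Ω)} {m : ℝ}
    (hm : 0 ≤ m) {T t : ℝ≥0} (ht : t ≤ T) {ω : Ω} {μ₁ μ₂ : Measure ℝ≥0} [IsFiniteMeasure μ₁]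
    [IsFiniteMeasure μ₂] (h : IsDistributionPath T (fun t => D t ω) μ₁ μ₂) (h0 : D 0 ω = 0)
    (hL : ∀ s t, s ≤ t → (t, ω) ∈ L → (s, ω) ∈ L)
    (hmeas : Measurable fun s => squareTest D L m t s ω) {I : Set ℝ≥0}
    (hI : I = {s | s ∈ Ioc 0 t ∧ (s, ω) ∈ L ∧ (s, ω) ∈ boundedUpTo D m})
    (hIm : MeasurableSet I) :
    stieltjesIntegral T (fun s => squareTest D L m t s ω) (fun s => D s ω) =
      (μ₁.real I - μ₂.real I) ^ 2 := by
  have hbd : ∀ (μ : Measure ℝ≥0) [IsFiniteMeasure μ],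
      Integrable (fun s => squareTest D L m t s ω) μ := fun μ _ =>
    integrable_of_abs_le hmeas (abs_squareTest_le D L hm t · ω)
  rw [h.stieltjesIntegral_eq (hbd μ₁).integrableOn (hbd μ₂).integrableOn]
  have hI0 : I ⊆ Ioc 0 T := fun s hs => by
    rw [hI] at hs
    exact ⟨hs.1.1, hs.1.2.trans ht⟩
  have hval : ∀ s ∈ I, squareTest D L m t s ω =
      (μ₁.real (Ioc 0 s) - μ₂.real (Ioc 0 s)) + (μ₁.real (Ioo 0 s) - μ₂.real (Ioo 0 s)) := by
    intro s hs
    have hsT := hI0 hs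
    rw [hI] at hs
    have hD : ∀ r ≤ T, D r ω = μ₁.real (Ioc 0 r) - μ₂.real (Ioc 0 r) := by
      intro r hr
      have := h r hr
      simp only [h0] at this
      linarith
    have hmem : (s, ω) ∈ Ioc 0 t ×ˢ univ ∩ (L ∩ boundedUpTo D m) :=
      ⟨⟨hs.1, mem_univ _⟩, hs.2.1, hs.2.2⟩
    have hq : ∀ n, dyadicBelow n s ≤ T := fun n => (dyadicBelow_lt n hsT.1).le.trans hsT.2
    have hlim : Tendsto (fun n => D (dyadicBelow n s) ω) atTop
        (𝓝 (μ₁.real (Ioo 0 s) - μ₂.real (Ioo 0 s))) := by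
      simp only [hD _ (hq _)]
      exact (tendsto_measureReal_Ioc_dyadicBelow μ₁ hsT.1).sub
        (tendsto_measureReal_Ioc_dyadicBelow μ₂ hsT.1)
    have hlim_le : |μ₁.real (Ioo 0 s) - μ₂.real (Ioo 0 s)| ≤ m := by
      refine le_of_tendsto hlim.abs (Eventually.of_forall fun n => ?_)
      exact (mem_boundedUpTo_of_le h (dyadicBelow_lt n hsT.1).le hsT.2 hs.2.2).1
    rw [squareTest, if_pos hmem, hlim.limsup_eq, truncate_eq hlim_le, truncate_eq hs.2.2.1,
      hD s hsT.2]
  have hzero : ∀ s ∈ Ioc 0 T \ I, squareTest D L m t s ω = 0 := by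
    intro s hs
    rw [squareTest, if_neg]
    rintro ⟨⟨h1, _⟩, h2, h3⟩
    exact hs.2 (by rw [hI]; exact ⟨h1, h2, h3⟩)
  rw [← setIntegral_Ioc_add_Ioo_sub μ₁ μ₂ hIm (fun s hs => (hI0 hs).1)]
  · congr 1
    · rw [setIntegral_eq_of_subset_of_forall_sdiff_eq_zero measurableSet_Ioc hI0 hzero]
      exact setIntegral_congr_fun hIm hval
    · rw [setIntegral_eq_of_subset_of_forall_sdiff_eq_zero measurableSet_Ioc hI0 hzero]
      exact setIntegral_congr_fun hIm hval
  · intro r s hr hrs hs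
    have hsT := (hI0 hs).2
    rw [hI] at hs ⊢
    exact ⟨⟨hr, hrs.trans hs.1.2⟩, hL r s hrs hs.2.1, mem_boundedUpTo_of_le h hrs hsT hs.2.2⟩

/-- A predictable process of finite variation that integrates all (localized) bounded predictable
processes to zero in mean is constant in time: test with `D_s + D_{s-}`, whose integral is the
square of the increment of `D`. -/
theorem eq_initial_of_integral_stieltjesIntegral_eq_zero {Ω : Type*} {mΩ : MeasurableSpace Ω}
    {P : Measure Ω} [IsProbabilityMeasure P] {𝓕 : Filtration ℝ≥0 mΩ} {T : ℝ≥0}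
    {D : ℝ≥0 → Ω → ℝ} (hD : IsPredictable 𝓕 D)
    (hfv : ∀ᵐ ω ∂P, IsFiniteVariationPath T fun t => D t ω)
    {L : ℕ → Set (ℝ≥0 × Ω)} (hLm : ∀ n, MeasurableSet[𝓕.predictable] (L n))
    (hLdown : ∀ n ω s t, s ≤ t → (t, ω) ∈ L n → (s, ω) ∈ L n)
    (hLex : ∀ ω, ∃ n, (T, ω) ∈ L n)
    (hzero : ∀ k : ℝ≥0 → Ω → ℝ, IsPredictable 𝓕 k → (∃ C : ℝ, ∀ s ω, |k s ω| ≤ C) →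
      (∃ n, ∀ s ω, (s, ω) ∉ L n → k s ω = 0) →
      Integrable (fun ω => stieltjesIntegral T (fun s => k s ω) fun s => D s ω) P ∧
      ∫ ω, stieltjesIntegral T (fun s => k s ω) (fun s => D s ω) ∂P = 0) :
    ∀ᵐ ω ∂P, ∀ t ≤ T, D t ω = D 0 ω := by
  -- Subtract the initial value.
  let D' : ℝ≥0 → Ω → ℝ := fun t ω => D t ω - D 0 ω
  have hD' : IsPredictable 𝓕 D' :=
    Measurable.sub hD (measurable_predictable_of_zero 𝓕 (hD.measurable_apply 0))
  have hpath : ∀ ω (μ₁ μ₂ : Measure ℝ≥0), IsDistributionPath T (fun t => D t ω) μ₁ μ₂ →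
      IsDistributionPath T (fun t => D' t ω) μ₁ μ₂ := by
    intro ω μ₁ μ₂ h t ht
    have := h t ht
    simp only [D']
    linarith
  have hrep : ∀ᵐ ω ∂P, ∃ μ₁ μ₂ : Measure ℝ≥0, IsFiniteMeasure μ₁ ∧ IsFiniteMeasure μ₂ ∧
      IsDistributionPath T (fun t => D t ω) μ₁ μ₂ := by
    filter_upwards [hfv] with ω hω using hω.exists_isDistributionPath
  -- The integral of the test process is a square with vanishing expectation.
  have key : ∀ (n m : ℕ) (t : ℝ≥0), t ≤ T → ∀ᵐ ω ∂P,
      stieltjesIntegral T (fun s => squareTest D' (L n) m t s ω) (fun s => D s ω) = 0 := by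
    intro n m t ht
    obtain ⟨hint, hval⟩ := hzero (squareTest D' (L n) m t)
      (isPredictable_squareTest hD' (hLm n) m t)
      ⟨_, fun s ω => abs_squareTest_le D' (L n) (Nat.cast_nonneg m) t s ω⟩
      ⟨n, fun s ω hs => by rw [squareTest, if_neg fun h => hs h.2.1]⟩
    refine (integral_eq_zero_iff_of_nonneg_ae ?_ hint).1 hval
    filter_upwards [hrep] with ω ⟨μ₁, μ₂, _, _, hμ⟩
    have hk := isPredictable_squareTest hD' (hLm n) m t
    have hIm : MeasurableSet
        {s | s ∈ Ioc 0 t ∧ (s, ω) ∈ L n ∧ (s, ω) ∈ boundedUpTo D' m} := by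
      have h1 : MeasurableSet (L n ∩ boundedUpTo D' m) :=
        predictable_le_prod 𝓕 _ ((hLm n).inter (measurableSet_boundedUpTo hD' m))
      exact measurableSet_Ioc.inter (measurable_prodMk_right h1)
    have h1 := stieltjesIntegral_squareTest (L := L n) (Nat.cast_nonneg m) ht (hpath ω _ _ hμ)
      (by simp [D']) (hLdown n ω) (hk.measurable_path ω) rfl hIm
    have hbd : ∀ (μ : Measure ℝ≥0) [IsFiniteMeasure μ],
        Integrable (fun s => squareTest D' (L n) m t s ω) μ := fun μ _ =>
      integrable_of_abs_le (hk.measurable_path ω)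
        (abs_squareTest_le D' (L n) (Nat.cast_nonneg m) t · ω)
    rw [hμ.stieltjesIntegral_eq (hbd μ₁).integrableOn (hbd μ₂).integrableOn,
      ← (hpath ω _ _ hμ).stieltjesIntegral_eq (hbd μ₁).integrableOn (hbd μ₂).integrableOn, h1]
    exact sq_nonneg _
  -- A path lies in some `L n` up to time `T` and is bounded there, so for large `n` and `m` the
  -- test process lives on all of `(0, t]` and its integral is the square of `D' t`.
  have hrat : ∀ t ≤ T, ∀ᵐ ω ∂P, D' t ω = 0 := by
    intro t ht
    have hall : ∀ᵐ ω ∂P, ∀ n m : ℕ,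
        stieltjesIntegral T (fun s => squareTest D' (L n) m t s ω) (fun s => D s ω) = 0 :=
      ae_all_iff.2 fun n => ae_all_iff.2 fun m => key n m t ht
    filter_upwards [hall, hrep] with ω hω ⟨μ₁, μ₂, _, _, hμ⟩
    obtain ⟨n, hn⟩ := hLex ω
    obtain ⟨m, hm⟩ := exists_nat_ge (μ₁.real univ + μ₂.real univ)
    have hk := isPredictable_squareTest hD' (hLm n) m t
    have hbd : ∀ (μ : Measure ℝ≥0) [IsFiniteMeasure μ],
        Integrable (fun s => squareTest D' (L n) m t s ω) μ := fun μ _ =>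
      integrable_of_abs_le (hk.measurable_path ω)
        (abs_squareTest_le D' (L n) (Nat.cast_nonneg m) t · ω)
    have hval : ∀ r ≤ T, D' r ω = μ₁.real (Ioc 0 r) - μ₂.real (Ioc 0 r) := by
      intro r hr
      have := hμ r hr
      simp only [D']
      linarith
    have hle : ∀ r ≤ T, |D' r ω| ≤ m := by
      intro r hr
      have h1 : μ₁.real (Ioc 0 r) ≤ μ₁.real univ := measureReal_mono (subset_univ _)
      have h2 : μ₂.real (Ioc 0 r) ≤ μ₂.real univ := measureReal_mono (subset_univ _)
      have h3 : 0 ≤ μ₁.real (Ioc 0 r) := measureReal_nonneg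
      have h4 : 0 ≤ μ₂.real (Ioc 0 r) := measureReal_nonneg
      rw [hval r hr, abs_le]
      constructor <;> linarith
    have hI : Ioc 0 t = {s | s ∈ Ioc 0 t ∧ (s, ω) ∈ L n ∧ (s, ω) ∈ boundedUpTo D' m} := by
      ext s
      refine ⟨fun hs => ⟨hs, hLdown n ω s T (hs.2.trans ht) hn, hle s (hs.2.trans ht),
        fun r hr => hle _ (hr.le.trans (hs.2.trans ht))⟩, fun hs => hs.1⟩
    have h1 := stieltjesIntegral_squareTest (L := L n) (Nat.cast_nonneg m) ht (hpath ω _ _ hμ)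
      (by simp [D']) (hLdown n ω) (hk.measurable_path ω) hI measurableSet_Ioc
    have h2 := hω n m
    rw [hμ.stieltjesIntegral_eq (hbd μ₁).integrableOn (hbd μ₂).integrableOn,
      ← (hpath ω _ _ hμ).stieltjesIntegral_eq (hbd μ₁).integrableOn (hbd μ₂).integrableOn, h1,
      ← hval t ht] at h2
    exact pow_eq_zero_iff two_ne_zero |>.1 h2
  -- By right-continuity, rational times suffice.
  have hcount : ∀ᵐ ω ∂P, ∀ r : ℚ, Real.toNNReal r ≤ T → D' (Real.toNNReal r) ω = 0 :=
    ae_all_iff.2 fun r => by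
      by_cases hr : Real.toNNReal r ≤ T
      · filter_upwards [hrat _ hr] with ω hω _ using hω
      · exact Eventually.of_forall fun ω h => absurd h hr
  filter_upwards [hcount, hrat T le_rfl, hrep] with ω hω hT ⟨μ₁, μ₂, _, _, hμ⟩ t ht
  have : D' t ω = 0 := by
    rcases ht.eq_or_lt with rfl | hlt
    · exact hT
    · exact mem_of_forall_rat_mem ((hpath ω _ _ hμ).continuousWithinAt hlt)
        (isClosed_singleton (x := (0 : ℝ))) hlt fun r _ hr => hω r hr.le
  exact sub_eq_zero.1 this

/-! ### Measurable projection -/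

/-- An analytic set of positive outer measure contains a compact set of positive measure. -/
theorem exists_isCompact_subset_of_analyticSet {X : Type*} [TopologicalSpace X] [PolishSpace X]
    [MeasurableSpace X] [BorelSpace X] (μ : Measure X) [IsFiniteMeasure μ] {A : Set X}
    (hA : AnalyticSet A) (hpos : 0 < μ A) : ∃ K ⊆ A, IsCompact K ∧ 0 < μ K := by
  rw [AnalyticSet] at hA
  obtain rfl | ⟨f, hf, rfl⟩ := hA
  · simp at hpos
  obtain ⟨ε, hε0, hε⟩ := exists_between hpos
  -- The set of sequences whose first `n` terms are bounded by those of `b`.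
  let C : ℕ → (ℕ → ℕ) → Set (ℕ → ℕ) := fun n b => {x | ∀ i < n, x i ≤ b i}
  -- Bounding one more coordinate keeps the outer measure of the image above `ε`.
  have hstep : ∀ (n : ℕ) (b : {b : ℕ → ℕ // ε < μ (f '' C n b)}),
      ∃ b' : {b : ℕ → ℕ // ε < μ (f '' C (n + 1) b)}, ∀ i < n, b'.1 i = b.1 i := by
    intro n ⟨b, hb⟩
    have hU : f '' C n b = ⋃ m : ℕ, f '' C (n + 1) (Function.update b n m) := by
      rw [← image_iUnion]
      congr 1
      ext x
      simp only [C, mem_ofPred_eq, mem_iUnion]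
      constructor
      · intro hx
        refine ⟨x n, fun i hi => ?_⟩
        rcases (Nat.lt_succ_iff_lt_or_eq.1 hi) with hi | rfl
        · rw [Function.update_of_ne hi.ne]
          exact hx i hi
        · rw [Function.update_self]
      · rintro ⟨m, hm⟩ i hi
        have := hm i (hi.trans (Nat.lt_succ_self n))
        rwa [Function.update_of_ne hi.ne] at this
    have hmono : Monotone fun m : ℕ => f '' C (n + 1) (Function.update b n m) := by
      intro m m' hmm
      refine image_mono fun x hx i hi => ?_
      have h1 := hx i hi
      rcases (Nat.lt_succ_iff_lt_or_eq.1 hi) with hi | rfl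
      · rwa [Function.update_of_ne hi.ne] at h1 ⊢
      · rw [Function.update_self] at h1 ⊢
        exact h1.trans hmm
    rw [hU, hmono.measure_iUnion, lt_iSup_iff] at hb
    obtain ⟨m, hm⟩ := hb
    exact ⟨⟨_, hm⟩, fun i hi => Function.update_of_ne hi.ne _ _⟩
  choose F hF using hstep
  have h0 : ε < μ (f '' C 0 0) := by simpa [C] using hε
  let g : ∀ n, {b : ℕ → ℕ // ε < μ (f '' C n b)} := fun n => Nat.rec ⟨0, h0⟩ F n
  have hg : ∀ n k i, i < n → (g (n + k)).1 i = (g n).1 i := by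
    intro n k i hi
    induction k with
    | zero => rfl
    | succ k ih =>
      rw [← ih]
      exact hF (n + k) (g (n + k)) i (hi.trans_le (Nat.le_add_right _ _))
  -- The bounds stabilize coordinatewise to `b`, and the sequences below `b` form a compact set.
  let b : ℕ → ℕ := fun i => (g (i + 1)).1 i
  have hgb : ∀ n i, i < n → (g n).1 i = b i := by
    intro n i hi
    obtain ⟨k, rfl⟩ := Nat.exists_eq_add_of_lt hi
    rw [show i + k + 1 = (i + 1) + k by ring]
    exact hg (i + 1) k i (Nat.lt_succ_self i)
  have hCb : ∀ n, ε < μ (f '' C n b) := by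
    intro n
    have : C n b = C n (g n).1 := by
      ext x
      exact forall₂_congr fun i hi => by rw [hgb n i hi]
    rw [this]
    exact (g n).2
  have hK' : IsCompact {x : ℕ → ℕ | ∀ i, x i ≤ b i} := by
    have := isCompact_univ_pi fun i => (finite_Iic (b i)).isCompact
    convert! this using 1
    ext x
    simp [Pi.le_def]
  refine ⟨f '' {x | ∀ i, x i ≤ b i}, image_subset_range _ _, hK'.image hf, ?_⟩
  refine hε0.trans_le ?_
  rw [Set.measure_eq_iInf_isOpen]
  refine le_iInf₂ fun U hKU => le_iInf fun hU => ?_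
  -- An open set around the compact image contains the image of some `C n b`.
  obtain ⟨n, hn⟩ : ∃ n, f '' C n b ⊆ U := by
    by_contra! hcon
    have hx : ∀ n, ∃ x ∈ C n b, f x ∉ U := by
      intro n
      obtain ⟨_, ⟨x, hx, rfl⟩, hxU⟩ := not_subset.1 (hcon n)
      exact ⟨x, hx, hxU⟩
    choose x hxC hxU using hx
    obtain ⟨y, hy, φ, hφ, hlim⟩ := hK'.tendsto_subseq
      (x := fun n i => min (x n i) (b i)) (fun n i => min_le_right _ _)
    have hlim' : Tendsto (fun n => x (φ n)) atTop (𝓝 y) := by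
      rw [tendsto_pi_nhds] at hlim ⊢
      intro i
      refine (hlim i).congr' ?_
      filter_upwards [hφ.tendsto_atTop.eventually_gt_atTop i] with n hn
      exact min_eq_left (hxC (φ n) i hn)
    have hev := ((hf.tendsto y).comp hlim').eventually
      (hU.mem_nhds (hKU (mem_image_of_mem f hy)))
    obtain ⟨n, hn⟩ := hev.exists
    exact hxU _ hn
  exact (hCb n).le.trans (measure_mono hn)

/-- A measurable subset of `Y × E` depends on `E` only through a measurable map into the Cantor
space. -/
lemma exists_measurable_cantor_preimage {Y E : Type*} [MeasurableSpace Y] [MeasurableSpace E]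
    {S : Set (Y × E)} (hS : MeasurableSet S) :
    ∃ (c : E → ℕ → Bool) (S' : Set (Y × (ℕ → Bool))), Measurable c ∧ MeasurableSet S' ∧
      S = (fun p : Y × E => (p.1, c p.2)) ⁻¹' S' := by
  classical
  induction S, hS using MeasurableSpace.induction_on_inter generateFrom_prod.symm
    isPiSystem_prod with
  | empty => exact ⟨fun _ _ => false, ∅, measurable_const, MeasurableSet.empty, by simp⟩
  | basic t ht =>
    obtain ⟨B, hB, F, hF, rfl⟩ := ht
    refine ⟨fun e _ => decide (e ∈ F), B ×ˢ {z | z 0 = true}, ?_, ?_, ?_⟩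
    · refine measurable_pi_iff.2 fun n => measurable_to_bool ?_
      convert! (show MeasurableSet F from hF) using 1
      ext e
      simp
    · refine MeasurableSet.prod hB ?_
      exact measurableSet_eq_fun (measurable_pi_apply 0) measurable_const
    · ext p
      simp
  | compl t htm ih =>
    obtain ⟨c, S', hc, hS', rfl⟩ := ih
    exact ⟨c, S'ᶜ, hc, hS'.compl, rfl⟩
  | iUnion f hfd hfm ih =>
    choose c S' hc hS' hf using ih
    refine ⟨fun e k => c k.unpair.1 e k.unpair.2,
      ⋃ n, (fun p : Y × (ℕ → Bool) => (p.1, fun k => p.2 (Nat.pair n k))) ⁻¹' S' n, ?_, ?_, ?_⟩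
    · exact measurable_pi_iff.2 fun k =>
        (measurable_pi_apply (k.unpair.2)).comp (hc k.unpair.1)
    · refine MeasurableSet.iUnion fun n => ?_
      have : Measurable fun p : Y × (ℕ → Bool) => (p.1, fun k => p.2 (Nat.pair n k)) :=
        measurable_fst.prodMk (measurable_pi_iff.2 fun k =>
          (measurable_pi_apply (Nat.pair n k)).comp measurable_snd)
      exact this (hS' n)
    · ext p
      simp only [mem_iUnion, mem_preimage, Nat.unpair_pair]
      exact exists_congr fun n => by rw [hf n]; rfl

/-- **Measurable projection**, in the form of a transfer principle: if almost surely no point of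
the section of `S` at `f ω` exists, then the same holds almost everywhere for the law of `f`. -/
theorem ae_map_forall_notMem {Y E Ω : Type*} [MeasurableSpace Y] [StandardBorelSpace Y]
    [MeasurableSpace E] [MeasurableSpace Ω] {Q : Measure Ω} [IsFiniteMeasure Q] {f : Ω → E}
    (hf : Measurable f) {S : Set (Y × E)} (hS : MeasurableSet S)
    (h : ∀ᵐ ω ∂Q, ∀ y, (y, f ω) ∉ S) : ∀ᵐ e ∂(Q.map f), ∀ y, (y, e) ∉ S := by
  obtain ⟨c, S', hc, hS', rfl⟩ := exists_measurable_cantor_preimage hS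
  -- The projection of `S'` to the Cantor space is analytic. A compact subset of positive measure
  -- would have a measurable preimage consisting of points `ω` whose section is nonempty.
  let A : Set (ℕ → Bool) := Prod.snd '' S'
  have hA : AnalyticSet A := hS'.analyticSet_image measurable_snd
  have hcf : Measurable (c ∘ f) := hc.comp hf
  have hA0 : (Q.map (c ∘ f)) A = 0 := by
    by_contra hne
    have : PolishSpace (ℕ → Bool) := { }
    obtain ⟨K, hKA, hK, hKpos⟩ := exists_isCompact_subset_of_analyticSet (Q.map (c ∘ f)) hA
      (pos_iff_ne_zero.2 hne)
    rw [Measure.map_apply hcf hK.measurableSet] at hKpos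
    refine hKpos.ne' ?_
    rw [← nonpos_iff_eq_zero, ← ae_iff.1 h]
    refine measure_mono fun ω hω => ?_
    obtain ⟨⟨y, z⟩, hyz, hz⟩ := hKA hω
    simp only [mem_ofPred_eq, not_forall, not_not]
    refine ⟨y, ?_⟩
    simp only at hz
    subst hz
    exact hyz
  rw [← Measure.map_map hc hf] at hA0
  have h1 : ∀ᵐ e ∂(Q.map f), c e ∉ A :=
    ae_of_ae_map hc.aemeasurable (measure_eq_zero_iff_ae_notMem.1 hA0)
  filter_upwards [h1] with e he y hy
  exact he ⟨_, hy, rfl⟩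

/-! ### Kernels of finite measures -/

/-- A kernel all of whose measures are finite is s-finite. -/
lemma isSFiniteKernel_of_forall_lt_top {α β : Type*} [MeasurableSpace α] [MeasurableSpace β]
    (κ : Kernel α β) (h : ∀ a, κ a univ < ∞) : IsSFiniteKernel κ := by
  classical
  let E : ℕ → Set α := fun n => {a | ⌊(κ a univ).toReal⌋₊ = n}
  have hE : ∀ n, MeasurableSet (E n) := fun n =>
    (Nat.measurable_floor.comp (κ.measurable_coe MeasurableSet.univ).ennreal_toReal)
      (measurableSet_singleton n)
  have hfin : ∀ n, IsFiniteKernel (Kernel.piecewise (hE n) κ 0) := by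
    refine fun n => ⟨⟨ENNReal.ofReal (n + 1), ENNReal.ofReal_lt_top, fun a => ?_⟩⟩
    rw [Kernel.piecewise_apply]
    split_ifs with ha
    · rw [← ENNReal.ofReal_toReal (h a).ne]
      refine ENNReal.ofReal_le_ofReal ?_
      have := (Nat.lt_floor_add_one (κ a univ).toReal).le
      rwa [show ⌊(κ a univ).toReal⌋₊ = n from ha] at this
    · simp
  refine ⟨fun n => Kernel.piecewise (hE n) κ 0, hfin, ?_⟩
  ext a s hs
  rw [Kernel.sum_apply' _ _ hs, tsum_eq_single ⌊(κ a univ).toReal⌋₊]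
  · rw [Kernel.piecewise_apply, if_pos (show a ∈ E _ from rfl)]
  · intro n hn
    rw [Kernel.piecewise_apply, if_neg fun h => hn h.symm]
    simp

open Classical in
/-- The kernel `κ`, set to `0` where its total mass is infinite. -/
noncomputable def finitePart {α β : Type*} [MeasurableSpace α] [MeasurableSpace β]
    (κ : Kernel α β) : Kernel α β :=
  Kernel.piecewise (s := {a | κ a univ < ∞})
    (measurableSet_lt (κ.measurable_coe MeasurableSet.univ) measurable_const) κ 0

lemma finitePart_apply_of_lt_top {α β : Type*} [MeasurableSpace α] [MeasurableSpace β]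
    {κ : Kernel α β} {a : α} (h : κ a univ < ∞) : finitePart κ a = κ a := by
  classical
  rw [finitePart, Kernel.piecewise_apply, if_pos (show a ∈ {a | κ a univ < ∞} from h)]

lemma finitePart_apply_univ_lt_top {α β : Type*} [MeasurableSpace α] [MeasurableSpace β]
    (κ : Kernel α β) (a : α) : finitePart κ a univ < ∞ := by
  classical
  rw [finitePart, Kernel.piecewise_apply]
  split_ifs with h
  · exact h
  · simp

instance {α β : Type*} [MeasurableSpace α] [MeasurableSpace β] (κ : Kernel α β) (a : α) :
    IsFiniteMeasure (finitePart κ a) := ⟨finitePart_apply_univ_lt_top κ a⟩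

instance {α β : Type*} [MeasurableSpace α] [MeasurableSpace β] (κ : Kernel α β) :
    IsSFiniteKernel (finitePart κ) :=
  isSFiniteKernel_of_forall_lt_top _ (finitePart_apply_univ_lt_top κ)

lemma right_continuous_of_eq_iInf {a : ℝ≥0 → ℝ≥0∞} (hmono : Monotone a)
    (hrc : ∀ t, a t = ⨅ n : ℕ, a (t + 1 / (n + 1))) (t : ℝ≥0) :
    ContinuousWithinAt a (Ici t) t := by
  rw [← continuousWithinAt_Ioi_iff_Ici]
  refine tendsto_order.2 ⟨fun b hb => ?_, fun b hb => ?_⟩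
  · filter_upwards [self_mem_nhdsWithin] with s hs using hb.trans_le (hmono (le_of_lt hs))
  · change a t < b at hb
    rw [hrc t, iInf_lt_iff] at hb
    obtain ⟨n, hn⟩ := hb
    have hlt : t < t + 1 / ((n : ℝ≥0) + 1) := lt_add_of_pos_right _ (by positivity)
    filter_upwards [nhdsWithin_le_nhds (Iio_mem_nhds hlt)] with s hs
    exact (hmono (le_of_lt hs)).trans_lt hn

/-- An increasing right-continuous function vanishing at `0` with finite limit is the distribution
function of a finite measure. -/
lemma exists_measure_Iic_eq {a : ℝ≥0 → ℝ≥0∞} (h0 : a 0 = 0) (hmono : Monotone a)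
    (hrc : ∀ t, a t = ⨅ n : ℕ, a (t + 1 / (n + 1))) (hfin : ⨆ n : ℕ, a n < ∞) :
    ∃ μ : Measure ℝ≥0, IsFiniteMeasure μ ∧ ∀ t, a t = μ (Iic t) := by
  have hle : ∀ t, a t ≤ ⨆ n : ℕ, a n := fun t => by
    obtain ⟨n, hn⟩ := exists_nat_ge t
    exact (hmono hn).trans (le_iSup (fun n : ℕ => a n) n)
  have hne : ∀ t, a t ≠ ∞ := fun t => ((hle t).trans_lt hfin).ne
  let F : StieltjesFunction ℝ≥0 :=
    { toFun := fun t => (a t).toReal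
      mono' := fun s t hst => ENNReal.toReal_mono (hne t) (hmono hst)
      right_continuous' := fun t =>
        (ENNReal.tendsto_toReal (hne t)).comp (right_continuous_of_eq_iInf hmono hrc t) }
  have hF : ∀ t, F t = (a t).toReal := fun _ => rfl
  refine ⟨F.measure, F.isFiniteMeasure_of_forall_abs_le (C := (⨆ n : ℕ, a n).toReal) ?_, ?_⟩
  · intro t
    rw [hF, abs_of_nonneg ENNReal.toReal_nonneg]
    exact ENNReal.toReal_mono hfin.ne (hle t)
  · intro t
    have hbot : F.measure {0} = 0 := by
      rw [← F.measure_botSet, botSet_eq_singleton_of_isBot]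
      exact fun x => zero_le
    have hu : Iic t = {0} ∪ Ioc 0 t := by
      ext x
      simp only [mem_Iic, mem_union, mem_singleton_iff, mem_Ioc]
      constructor
      · intro hx
        rcases eq_or_ne x 0 with h | h
        · exact Or.inl h
        · exact Or.inr ⟨pos_iff_ne_zero.2 h, hx⟩
      · rintro (rfl | h)
        · exact zero_le
        · exact h.2
    rw [hu, measure_union (by simp) measurableSet_Ioc, hbot, zero_add, F.measure_Ioc, hF, hF, h0]
    simp [ENNReal.ofReal_toReal (hne t)]

/-- A measurable process that is almost surely increasing, right-continuous, finite and vanishing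
at `0` is almost surely the distribution function of a kernel. -/
lemma exists_kernel_Iic_eq {E : Type*} [MeasurableSpace E] {μ : Measure E}
    {a : ℝ≥0 × E → ℝ≥0∞} (ha : Measurable a)
    (h : ∀ᵐ e ∂μ, a (0, e) = 0 ∧ (Monotone fun t => a (t, e)) ∧
      (∀ t, a (t, e) = ⨅ n : ℕ, a (t + 1 / (n + 1), e)) ∧ ⨆ n : ℕ, a (n, e) < ∞) :
    ∃ α : Kernel E ℝ≥0, (∀ e, IsFiniteMeasure (α e)) ∧ ∀ᵐ e ∂μ, ∀ t, a (t, e) = α e (Iic t) := by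
  classical
  obtain ⟨G, hG, hGm, hGμ⟩ := h.exists_measurable_mem
  have hex : ∀ e ∈ G, ∃ m : Measure ℝ≥0, IsFiniteMeasure m ∧ ∀ t, a (t, e) = m (Iic t) :=
    fun e he => exists_measure_Iic_eq (hGμ e he).1 (hGμ e he).2.1 (hGμ e he).2.2.1
      (hGμ e he).2.2.2
  let m : E → Measure ℝ≥0 := fun e => if he : e ∈ G then (hex e he).choose else 0
  have hm : ∀ e ∈ G, m e = m e ∧ ∀ t, a (t, e) = m e (Iic t) := by
    intro e he
    refine ⟨rfl, fun t => ?_⟩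
    simp only [m, dif_pos he]
    exact (hex e he).choose_spec.2 t
  have hm0 : ∀ e ∉ G, m e = 0 := fun e he => by simp only [m, dif_neg he]
  have hfin : ∀ e, IsFiniteMeasure (m e) := by
    intro e
    by_cases he : e ∈ G
    · simp only [m, dif_pos he]
      exact (hex e he).choose_spec.1
    · rw [hm0 e he]
      infer_instance
  have hIic : ∀ t, Measurable fun e => m e (Iic t) := by
    intro t
    have : (fun e => m e (Iic t)) = G.indicator fun e => a (t, e) := by
      funext e
      by_cases he : e ∈ G
      · rw [indicator_of_mem he, (hm e he).2]
      · rw [indicator_of_notMem he, hm0 e he]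
        simp
    rw [this]
    exact (ha.comp measurable_prodMk_left).indicator hGm
  have hmeas : Measurable m := by
    refine Measurable.measure_of_isPiSystem (S := range Iic) ?_ isPiSystem_Iic ?_ ?_
    · rw [← borel_eq_generateFrom_Iic, BorelSpace.measurable_eq (α := ℝ≥0)]
    · rintro _ ⟨t, rfl⟩
      exact hIic t
    · have hU : ∀ e, m e univ = ⨆ n : ℕ, m e (Iic (n : ℝ≥0)) := by
        intro e
        rw [← Monotone.measure_iUnion]
        · congr 1
          refine (eq_univ_of_forall fun t => ?_).symm
          obtain ⟨n, hn⟩ := exists_nat_ge t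
          exact mem_iUnion.2 ⟨n, hn⟩
        · exact fun i j hij => Iic_subset_Iic.2 (Nat.cast_le.2 hij)
      simp only [hU]
      exact Measurable.iSup fun n => hIic n
  refine ⟨⟨m, hmeas⟩, hfin, ?_⟩
  filter_upwards [hG] with e he t using (hm e he).2 t

lemma measure_univ_eq_iSup_Iic (μ : Measure ℝ≥0) : μ univ = ⨆ n : ℕ, μ (Iic (n : ℝ≥0)) := by
  rw [← Monotone.measure_iUnion]
  · congr 1
    refine (eq_univ_of_forall fun t => ?_).symm
    obtain ⟨n, hn⟩ := exists_nat_ge t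
    exact mem_iUnion.2 ⟨n, hn⟩
  · exact fun i j hij => Iic_subset_Iic.2 (Nat.cast_le.2 hij)

/-! ### Integrating out an independent component of a predictable process -/

lemma measure_Iic_eq_iInf (μ : Measure ℝ≥0) [IsFiniteMeasure μ] (t : ℝ≥0) :
    μ (Iic t) = ⨅ n : ℕ, μ (Iic (t + 1 / (n + 1))) := by
  rw [← Antitone.measure_iInter]
  · congr 1
    ext x
    simp only [mem_Iic, mem_iInter]
    refine ⟨fun hx n => hx.trans (le_add_of_nonneg_right zero_le), fun hx => ?_⟩
    refine le_of_forall_pos_le_add fun ε hε => ?_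
    obtain ⟨n, hn⟩ := exists_nat_one_div_lt (K := ℝ) (ε := ε) (by exact_mod_cast hε)
    refine (hx n).trans (add_le_add_right ?_ t)
    rw [← NNReal.coe_le_coe]
    push_cast
    exact hn.le
  · intro i j hij
    refine Iic_subset_Iic.2 (add_le_add_right ?_ t)
    exact one_div_le_one_div_of_le (by positivity) (by simpa using hij)
  · exact fun n => measurableSet_Iic.nullMeasurableSet
  · exact ⟨0, measure_ne_top _ _⟩

/-- Let `a(t, φ₁, φ₂)` be the distribution function of a random measure, where `φ₁` and `φ₂` are
independent. Integrating out `φ₂` gives the distribution function of a random measure again. That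
the paths of `a` are distribution functions is known on the range of `(φ₁, φ₂)` only, and measurable
projection transfers it to almost every pair of points. -/
theorem exists_kernel_integrate_out {Ω Ω₁ Ω₂ : Type*} [MeasurableSpace Ω] [MeasurableSpace Ω₁]
    [MeasurableSpace Ω₂] {Q : Measure Ω} [IsProbabilityMeasure Q] {φ₁ : Ω → Ω₁} {φ₂ : Ω → Ω₂}
    (hφ₁ : Measurable φ₁) (hφ₂ : Measurable φ₂) (hind : IndepFun φ₁ φ₂ Q)
    {mp : MeasurableSpace (ℝ≥0 × Ω₁)} (hmp : mp ≤ Prod.instMeasurableSpace)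
    {a : (ℝ≥0 × Ω₁) × Ω₂ → ℝ≥0∞} (ha : Measurable[mp.prod inferInstance] a)
    {κ : Kernel Ω ℝ≥0} (hfin : ∫⁻ ω, κ ω univ ∂Q < ∞) (h0 : ∀ᵐ ω ∂Q, κ ω {0} = 0)
    (hκ : ∀ᵐ ω ∂Q, ∀ t, a ((t, φ₁ ω), φ₂ ω) = κ ω (Iic t)) :
    ∃ (p : ℝ≥0 × Ω₁ → ℝ≥0∞) (β : Kernel Ω₁ ℝ≥0), Measurable[mp] p ∧
      (∀ x, IsFiniteMeasure (β x)) ∧ (∀ᵐ ω ∂Q, ∀ t, p (t, φ₁ ω) = β (φ₁ ω) (Iic t)) ∧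
      ∀ t A, MeasurableSet A → ∫⁻ ω in φ₁ ⁻¹' A, β (φ₁ ω) (Iic t) ∂Q =
        ∫⁻ ω in φ₁ ⁻¹' A, κ ω (Iic t) ∂Q := by
  have hf : Measurable fun ω => (φ₁ ω, φ₂ ω) := hφ₁.prodMk hφ₂
  have hmap : Q.map (fun ω => (φ₁ ω, φ₂ ω)) = (Q.map φ₁).prod (Q.map φ₂) :=
    (indepFun_iff_map_prod_eq_prod_map_map hφ₁.aemeasurable hφ₂.aemeasurable).1 hind
  have hQ₁ : IsProbabilityMeasure (Q.map φ₁) := Measure.isProbabilityMeasure_map hφ₁.aemeasurable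
  have hQ₂ : IsProbabilityMeasure (Q.map φ₂) := Measure.isProbabilityMeasure_map hφ₂.aemeasurable
  let a' : ℝ≥0 × (Ω₁ × Ω₂) → ℝ≥0∞ := fun x => a ((x.1, x.2.1), x.2.2)
  have hfst : @Measurable _ _ _ mp fun x : ℝ≥0 × (Ω₁ × Ω₂) => (x.1, x.2.1) :=
    (measurable_fst.prodMk measurable_snd.fst).mono le_rfl hmp
  have ha'm : Measurable a' := ha.comp (hfst.prodMk measurable_snd.snd)
  have hκfin : ∀ᵐ ω ∂Q, κ ω univ < ∞ :=
    ae_lt_top (κ.measurable_coe MeasurableSet.univ) hfin.ne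
  -- The regularity of the paths, transferred to the product of the laws.
  have hmono : ∀ᵐ e ∂((Q.map φ₁).prod (Q.map φ₂)), ∀ y : ℝ≥0 × ℝ≥0,
      (y, e) ∉ {x : (ℝ≥0 × ℝ≥0) × (Ω₁ × Ω₂) |
        x.1.1 ≤ x.1.2 ∧ a' (x.1.2, x.2) < a' (x.1.1, x.2)} := by
    rw [← hmap]
    refine ae_map_forall_notMem hf ?_ ?_
    · exact (measurableSet_le (by fun_prop) (by fun_prop)).inter
        (measurableSet_lt (ha'm.comp (by fun_prop)) (ha'm.comp (by fun_prop)))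
    · filter_upwards [hκ] with ω hω y hy
      simp only [a', hω] at hy
      exact absurd hy.2 (not_lt.2 (measure_mono (Iic_subset_Iic.2 hy.1)))
  have hrc : ∀ᵐ e ∂((Q.map φ₁).prod (Q.map φ₂)), ∀ t : ℝ≥0,
      (t, e) ∉ {x : ℝ≥0 × (Ω₁ × Ω₂) |
        a' x = ⨅ n : ℕ, a' (x.1 + 1 / (n + 1), x.2)}ᶜ := by
    rw [← hmap]
    refine ae_map_forall_notMem hf ?_ ?_
    · refine (measurableSet_eq_fun ha'm (Measurable.iInf fun n => ha'm.comp ?_)).compl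
      fun_prop
    · filter_upwards [hκ, hκfin] with ω hω hfinω t ht
      have : IsFiniteMeasure (κ ω) := ⟨hfinω⟩
      refine ht ?_
      simp only [mem_ofPred_eq, a', hω]
      exact measure_Iic_eq_iInf (κ ω) t
  have hpt : ∀ᵐ e ∂((Q.map φ₁).prod (Q.map φ₂)), a' (0, e) = 0 ∧ ⨆ n : ℕ, a' (n, e) < ∞ := by
    rw [← hmap, ae_map_iff hf.aemeasurable]
    · filter_upwards [hκ, h0, hκfin] with ω hω h0ω hfinω
      simp only [a', hω]
      refine ⟨?_, by rwa [← measure_univ_eq_iSup_Iic]⟩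
      rw [← h0ω]
      congr 1
      ext x
      simp
    · exact (measurableSet_eq_fun (ha'm.comp measurable_prodMk_left) measurable_const).inter
        (measurableSet_lt (Measurable.iSup fun n => ha'm.comp measurable_prodMk_left)
          measurable_const)
  obtain ⟨α, hαfin, hα⟩ := exists_kernel_Iic_eq (μ := (Q.map φ₁).prod (Q.map φ₂)) ha'm (by
    filter_upwards [hmono, hrc, hpt] with e h1 h2 h3
    refine ⟨h3.1, fun s t hst => ?_, fun t => not_not.1 (h2 t), h3.2⟩
    by_contra hlt
    exact h1 (s, t) ⟨hst, not_le.1 hlt⟩)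
  -- The kernel and the process obtained by integrating over the second component.
  let β₀ : Kernel Ω₁ ℝ≥0 :=
    { toFun := fun x => (Q.map φ₂).bind fun y => α (x, y)
      measurable' := by
        refine Measure.measurable_of_measurable_coe _ fun s hs => ?_
        have : (fun x => ((Q.map φ₂).bind fun y => α (x, y)) s) =
            fun x => ∫⁻ y, α (x, y) s ∂(Q.map φ₂) := by
          funext x
          exact Measure.bind_apply hs (α.measurable.comp measurable_prodMk_left).aemeasurable
        rw [this]
        exact (α.measurable_coe hs).lintegral_prod_right' }
  have hβ₀ : ∀ x {s : Set ℝ≥0}, MeasurableSet s → β₀ x s = ∫⁻ y, α (x, y) s ∂(Q.map φ₂) :=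
    fun x s hs => Measure.bind_apply hs (α.measurable.comp measurable_prodMk_left).aemeasurable
  let p : ℝ≥0 × Ω₁ → ℝ≥0∞ := fun x => ∫⁻ y, a (x, y) ∂(Q.map φ₂)
  have hp : Measurable[mp] p :=
    @Measurable.lintegral_prod_right' _ _ mp _ (Q.map φ₂) _ a ha
  have hpβ : ∀ᵐ x ∂(Q.map φ₁), ∀ t, p (t, x) = β₀ x (Iic t) := by
    filter_upwards [Measure.ae_ae_of_ae_prod hα] with x hx t
    rw [hβ₀ x measurableSet_Iic]
    refine lintegral_congr_ae ?_
    filter_upwards [hx] with y hy using hy t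
  have hint : ∀ t A, MeasurableSet A → ∫⁻ ω in φ₁ ⁻¹' A, β₀ (φ₁ ω) (Iic t) ∂Q =
      ∫⁻ ω in φ₁ ⁻¹' A, κ ω (Iic t) ∂Q := by
    intro t A hA
    have hm1 : Measurable fun e : Ω₁ × Ω₂ => a' (t, e) := ha'm.comp measurable_prodMk_left
    calc ∫⁻ ω in φ₁ ⁻¹' A, β₀ (φ₁ ω) (Iic t) ∂Q
        = ∫⁻ x in A, β₀ x (Iic t) ∂(Q.map φ₁) := by
          rw [setLIntegral_map hA (β₀.measurable_coe measurableSet_Iic) hφ₁]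
      _ = ∫⁻ x in A, ∫⁻ y, a' (t, (x, y)) ∂(Q.map φ₂) ∂(Q.map φ₁) := by
          refine lintegral_congr_ae (ae_restrict_of_ae ?_)
          filter_upwards [hpβ] with x hx using (hx t).symm
      _ = ∫⁻ e in A ×ˢ univ, a' (t, e) ∂((Q.map φ₁).prod (Q.map φ₂)) := by
          rw [← Measure.prod_restrict, Measure.restrict_univ, lintegral_prod _ hm1.aemeasurable]
      _ = ∫⁻ ω in φ₁ ⁻¹' A, a' (t, (φ₁ ω, φ₂ ω)) ∂Q := by
          rw [← hmap, setLIntegral_map (hA.prod MeasurableSet.univ) hm1 hf]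
          congr 2
          ext ω
          simp
      _ = ∫⁻ ω in φ₁ ⁻¹' A, κ ω (Iic t) ∂Q := by
          refine lintegral_congr_ae (ae_restrict_of_ae ?_)
          filter_upwards [hκ] with ω hω using hω t
  -- The mean of `β₀` is that of `κ`, hence almost all of its values are finite measures.
  have hβfin : ∀ᵐ ω ∂Q, β₀ (φ₁ ω) univ < ∞ := by
    refine ae_lt_top ((β₀.measurable_coe MeasurableSet.univ).comp hφ₁) (lt_of_le_of_lt ?_ hfin).ne
    simp only [measure_univ_eq_iSup_Iic (β₀ _)]
    rw [lintegral_iSup (f := fun (n : ℕ) ω => β₀ (φ₁ ω) (Iic (n : ℝ≥0)))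
      (fun n => (β₀.measurable_coe measurableSet_Iic).comp hφ₁)]
    · refine iSup_le fun n => ?_
      have h1 := hint n univ MeasurableSet.univ
      simp only [preimage_univ, Measure.restrict_univ] at h1
      rw [h1]
      exact lintegral_mono fun ω => measure_mono (subset_univ _)
    · exact fun i j hij ω => measure_mono (Iic_subset_Iic.2 (Nat.cast_le.2 hij))
  have hfp : ∀ᵐ ω ∂Q, finitePart β₀ (φ₁ ω) = β₀ (φ₁ ω) := by
    filter_upwards [hβfin] with ω hω using finitePart_apply_of_lt_top hω
  refine ⟨p, finitePart β₀, hp, fun x => inferInstance, ?_, ?_⟩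
  · filter_upwards [hfp, ae_of_ae_map hφ₁.aemeasurable hpβ] with ω h1 h2 t
    rw [h1, h2 t]
  · intro t A hA
    rw [← hint t A hA]
    refine lintegral_congr_ae (ae_restrict_of_ae ?_)
    filter_upwards [hfp] with ω hω
    rw [hω]

/-! ### Joins of σ-algebras -/

lemma sup_eq_generateFrom_inter {Ω : Type*} (m₁ m₂ : MeasurableSpace Ω) :
    m₁ ⊔ m₂ = MeasurableSpace.generateFrom
      (image2 (· ∩ ·) {s | MeasurableSet[m₁] s} {t | MeasurableSet[m₂] t}) := by
  refine le_antisymm (sup_le ?_ ?_) (MeasurableSpace.generateFrom_le ?_)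
  · exact fun s hs => MeasurableSpace.measurableSet_generateFrom
      ⟨s, hs, univ, MeasurableSet.univ, inter_univ s⟩
  · exact fun t ht => MeasurableSpace.measurableSet_generateFrom
      ⟨univ, MeasurableSet.univ, t, ht, univ_inter t⟩
  · rintro _ ⟨s, hs, t, ht, rfl⟩
    exact MeasurableSet.inter (le_sup_left (a := m₁) (b := m₂) _ hs)
      (le_sup_right (a := m₁) (b := m₂) _ ht)

lemma isPiSystem_inter {Ω : Type*} (m₁ m₂ : MeasurableSpace Ω) :
    IsPiSystem (image2 (· ∩ ·) {s | MeasurableSet[m₁] s} {t | MeasurableSet[m₂] t}) := by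
  rintro _ ⟨s, hs, t, ht, rfl⟩ _ ⟨s', hs', t', ht', rfl⟩ -
  exact ⟨s ∩ s', hs.inter hs', t ∩ t', ht.inter ht', inter_inter_inter_comm s s' t t'⟩

/-- If `a₁, a₂` are independent, `b₁, b₂` are independent, and so are the pairs, then the joins
may be regrouped as `a₁ ⊔ b₁` and `a₂ ⊔ b₂`. -/
lemma indep_sup_sup {Ω : Type*} {mΩ : MeasurableSpace Ω} {Q : Measure Ω} [IsProbabilityMeasure Q]
    {a₁ a₂ b₁ b₂ : MeasurableSpace Ω} (ha₁ : a₁ ≤ mΩ) (ha₂ : a₂ ≤ mΩ) (hb₁ : b₁ ≤ mΩ)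
    (hb₂ : b₂ ≤ mΩ) (ha : Indep a₁ a₂ Q) (hb : Indep b₁ b₂ Q) (hab : Indep (a₁ ⊔ a₂) (b₁ ⊔ b₂) Q) :
    Indep (a₁ ⊔ b₁) (a₂ ⊔ b₂) Q := by
  refine IndepSets.indep (sup_le ha₁ hb₁) (sup_le ha₂ hb₂) (isPiSystem_inter a₁ b₁)
    (isPiSystem_inter a₂ b₂) (sup_eq_generateFrom_inter a₁ b₁) (sup_eq_generateFrom_inter a₂ b₂) ?_
  rw [IndepSets_iff]
  rintro _ _ ⟨s, hs, t, ht, rfl⟩ ⟨s', hs', t', ht', rfl⟩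
  rw [Indep_iff] at ha hb hab
  have i1 : ∀ u, MeasurableSet[a₁] u → MeasurableSet[a₁ ⊔ a₂] u := fun u hu =>
    le_sup_left (a := a₁) (b := a₂) _ hu
  have i2 : ∀ u, MeasurableSet[a₂] u → MeasurableSet[a₁ ⊔ a₂] u := fun u hu =>
    le_sup_right (a := a₁) (b := a₂) _ hu
  have j1 : ∀ u, MeasurableSet[b₁] u → MeasurableSet[b₁ ⊔ b₂] u := fun u hu =>
    le_sup_left (a := b₁) (b := b₂) _ hu
  have j2 : ∀ u, MeasurableSet[b₂] u → MeasurableSet[b₁ ⊔ b₂] u := fun u hu =>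
    le_sup_right (a := b₁) (b := b₂) _ hu
  rw [inter_inter_inter_comm, hab _ _ ((i1 s hs).inter (i2 s' hs')) ((j1 t ht).inter (j2 t' ht')),
    ha _ _ hs hs', hb _ _ ht ht', hab _ _ (i1 s hs) (j1 t ht), hab _ _ (i2 s' hs') (j2 t' ht')]
  ring

/-! ### Measures on the predictable σ-algebra -/

lemma isPiSystem_predictable {Ω : Type*} {mΩ : MeasurableSpace Ω} (𝓕 : Filtration ℝ≥0 mΩ) :
    IsPiSystem ({s : Set (ℝ≥0 × Ω) | ∃ A, MeasurableSet[𝓕 ⊥] A ∧ s = {⊥} ×ˢ A} ∪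
      {s | ∃ i A, MeasurableSet[𝓕 i] A ∧ s = Ioi i ×ˢ A}) := by
  rintro _ (⟨A, hA, rfl⟩ | ⟨i, A, hA, rfl⟩) _ (⟨B, hB, rfl⟩ | ⟨j, B, hB, rfl⟩) hne
  · exact Or.inl ⟨A ∩ B, hA.inter hB, by rw [prod_inter_prod, inter_self]⟩
  · obtain ⟨x, hx⟩ := hne
    have h1 : x.1 = ⊥ := hx.1.1
    have h2 : j < x.1 := hx.2.1
    rw [h1] at h2
    exact absurd h2 not_lt_bot
  · obtain ⟨x, hx⟩ := hne
    have h1 : x.1 = ⊥ := hx.2.1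
    have h2 : i < x.1 := hx.1.1
    rw [h1] at h2
    exact absurd h2 not_lt_bot
  · refine Or.inr ⟨max i j, A ∩ B, ?_, by rw [prod_inter_prod, Ioi_inter_Ioi]⟩
    exact (𝓕.mono (le_max_left i j) _ hA).inter (𝓕.mono (le_max_right i j) _ hB)

/-- Two finite measures agree on the predictable σ-algebra if they agree on its generators. -/
lemma trim_predictable_eq {Ω : Type*} {mΩ : MeasurableSpace Ω} {𝓕 : Filtration ℝ≥0 mΩ}
    {μ ν : Measure (ℝ≥0 × Ω)} [IsFiniteMeasure μ] [IsFiniteMeasure ν]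
    (h0 : ∀ A, MeasurableSet[𝓕 0] A → μ ({0} ×ˢ A) = ν ({0} ×ˢ A))
    (h : ∀ s A, MeasurableSet[𝓕 s] A → μ (Ioi s ×ˢ A) = ν (Ioi s ×ˢ A)) :
    μ.trim (predictable_le_prod 𝓕) = ν.trim (predictable_le_prod 𝓕) := by
  have hle := predictable_le_prod 𝓕
  have hgen : ∀ s ∈ ({s : Set (ℝ≥0 × Ω) | ∃ A, MeasurableSet[𝓕 ⊥] A ∧ s = {⊥} ×ˢ A} ∪
      {s | ∃ i A, MeasurableSet[𝓕 i] A ∧ s = Ioi i ×ˢ A}), μ.trim hle s = ν.trim hle s := by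
    intro s hs
    have hsm : MeasurableSet[𝓕.predictable] s := MeasurableSpace.measurableSet_generateFrom hs
    rw [trim_measurableSet_eq hle hsm, trim_measurableSet_eq hle hsm]
    rcases hs with ⟨A, hA, rfl⟩ | ⟨i, A, hA, rfl⟩
    · exact h0 A hA
    · exact h i A hA
  have hfin : IsFiniteMeasure (μ.trim hle) := isFiniteMeasure_trim hle
  refine @ext_of_generate_finite _ 𝓕.predictable _ _ _ rfl (isPiSystem_predictable 𝓕) hfin hgen ?_
  rw [trim_measurableSet_eq hle MeasurableSet.univ, trim_measurableSet_eq hle MeasurableSet.univ]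
  have hu : (univ : Set (ℝ≥0 × Ω)) = {0} ×ˢ univ ∪ Ioi 0 ×ˢ univ := by
    rw [← union_prod, show ({0} ∪ Ioi 0 : Set ℝ≥0) = univ by
      ext x
      simp, univ_prod_univ]
  have hd : Disjoint (({0} : Set ℝ≥0) ×ˢ (univ : Set Ω)) (Ioi 0 ×ˢ univ) :=
    Disjoint.set_prod_left (by simp) _ _
  rw [hu, measure_union hd (measurableSet_Ioi.prod MeasurableSet.univ),
    measure_union hd (measurableSet_Ioi.prod MeasurableSet.univ), h0 _ MeasurableSet.univ,
    h _ _ MeasurableSet.univ]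

/-! ### Null sets and right limits do not enlarge the predictable σ-algebra essentially -/

lemma exists_measurableSet_ae_eq_of_sup_nullSigma {Ω : Type*} {m mΩ : MeasurableSpace Ω}
    {Q : Measure Ω} {A : Set Ω}
    (hA : MeasurableSet[m ⊔ nullSigma Q] A) : ∃ A', MeasurableSet[m] A' ∧ A =ᵐ[Q] A' := by
  have hle : m ⊔ nullSigma Q ≤ eventuallyMeasurableSpace m (ae Q) := by
    refine sup_le (fun B hB => ⟨B, hB, EventuallyEq.rfl⟩) (MeasurableSpace.generateFrom_le ?_)
    exact fun B hB => ⟨∅, @MeasurableSet.empty _ m, ae_eq_empty.2 hB.2⟩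
  exact hle _ hA

lemma measurableSet_augmentation {Ω : Type*} {mΩ : MeasurableSpace Ω}
    {Q : Measure Ω} {𝓕 : Filtration ℝ≥0 mΩ} {s t : ℝ≥0} (hst : s < t) {A : Set Ω}
    (hA : MeasurableSet[augmentation Q 𝓕 s] A) : MeasurableSet[𝓕 t ⊔ nullSigma Q] A := by
  rw [augmentation, Filtration.rightCont_eq] at hA
  exact iInf₂_le (f := fun (j : ℝ≥0) (_ : j > s) => 𝓕 j ⊔ nullSigma Q) t hst _ hA

lemma le_augmentation {Ω : Type*} {mΩ : MeasurableSpace Ω} (Q : Measure Ω)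
    (𝓕 : Filtration ℝ≥0 mΩ) : 𝓕 ≤ augmentation Q 𝓕 := by
  intro t
  rw [augmentation, Filtration.rightCont_eq]
  exact le_iInf₂ fun j hj => (𝓕.mono (le_of_lt hj)).trans le_sup_left

/-- A predictable set for the augmented filtration agrees on `(0, ∞)`, outside a null set of
paths, with a predictable set for the original filtration. -/
lemma exists_predictable_set_ae_eq {Ω : Type*} {mΩ : MeasurableSpace Ω}
    {Q : Measure Ω} {𝓕 : Filtration ℝ≥0 mΩ} {D : Set (ℝ≥0 × Ω)}
    (hD : MeasurableSet[(augmentation Q 𝓕).predictable] D) :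
    ∃ D', MeasurableSet[𝓕.predictable] D' ∧
      ∀ᵐ ω ∂Q, ∀ t, 0 < t → ((t, ω) ∈ D ↔ (t, ω) ∈ D') := by
  induction D, hD using MeasurableSpace.generateFrom_induction with
  | hC D hD _ =>
    rcases hD with ⟨A, hA, rfl⟩ | ⟨s, A, hA, rfl⟩
    · refine ⟨∅, @MeasurableSet.empty _ 𝓕.predictable, ae_of_all _ fun ω t ht => ?_⟩
      simp [ht.ne']
    · have hlt : ∀ n : ℕ, s < s + 1 / ((n : ℝ≥0) + 1) := fun n =>
        lt_add_of_pos_right _ (by positivity)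
      choose A' hA' hae using fun n : ℕ =>
        exists_measurableSet_ae_eq_of_sup_nullSigma (measurableSet_augmentation (hlt n) hA)
      refine ⟨⋃ n : ℕ, Ioi (s + 1 / ((n : ℝ≥0) + 1)) ×ˢ A' n,
        MeasurableSet.iUnion fun n => measurableSet_predictable_Ioi_prod (hA' n), ?_⟩
      filter_upwards [ae_all_iff.2 fun n => (hae n).mem_iff] with ω hω t _
      simp only [mem_prod, mem_Ioi, mem_iUnion]
      constructor
      · rintro ⟨hst, hωA⟩
        obtain ⟨u, hu, rfl⟩ : ∃ u, 0 < u ∧ t = s + u :=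
          ⟨t - s, tsub_pos_of_lt hst, (add_tsub_cancel_of_le hst.le).symm⟩
        obtain ⟨n, hn⟩ := exists_nat_one_div_lt (K := ℝ) (ε := u) (by exact_mod_cast hu)
        refine ⟨n, add_lt_add_right ?_ s, (hω n).1 hωA⟩
        rw [← NNReal.coe_lt_coe]
        push_cast
        exact hn
      · rintro ⟨n, hn, hωA⟩
        exact ⟨(hlt n).trans hn, (hω n).2 hωA⟩
  | empty => exact ⟨∅, @MeasurableSet.empty _ 𝓕.predictable, ae_of_all _ fun ω t _ => Iff.rfl⟩
  | compl D _ ih =>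
    obtain ⟨D', hD', h⟩ := ih
    refine ⟨D'ᶜ, hD'.compl, ?_⟩
    filter_upwards [h] with ω hω t ht
    simp only [mem_compl_iff, hω t ht]
  | iUnion D _ ih =>
    choose D' hD' h using ih
    refine ⟨⋃ n, D' n, MeasurableSet.iUnion hD', ?_⟩
    filter_upwards [ae_all_iff.2 h] with ω hω t ht
    simp only [mem_iUnion, hω _ t ht]

/-- A process that is predictable for the augmented filtration is indistinguishable on `(0, ∞)` from
a process that is predictable for the original filtration. -/
lemma exists_predictable_ae_eq {Ω : Type*} {mΩ : MeasurableSpace Ω}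
    {Q : Measure Ω} {𝓕 : Filtration ℝ≥0 mΩ} {f : ℝ≥0 × Ω → ℝ≥0∞}
    (hf : Measurable[(augmentation Q 𝓕).predictable] f) :
    ∃ f' : ℝ≥0 × Ω → ℝ≥0∞, Measurable[𝓕.predictable] f' ∧
      ∀ᵐ ω ∂Q, ∀ t, 0 < t → f (t, ω) = f' (t, ω) := by
  classical
  choose D' hD' h using fun q : ℚ≥0 => exists_predictable_set_ae_eq
    (hf (measurableSet_Ioi (a := ((q : ℝ≥0) : ℝ≥0∞))))
  refine ⟨fun p => ⨆ q : ℚ≥0, (D' q).indicator (fun _ => ((q : ℝ≥0) : ℝ≥0∞)) p,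
    Measurable.iSup fun q => measurable_const.indicator (hD' q), ?_⟩
  filter_upwards [ae_all_iff.2 h] with ω hω t ht
  refine le_antisymm ?_ (iSup_le fun q => ?_)
  · refine le_of_forall_lt fun c hc => ?_
    obtain ⟨q, hq, hcq, hqf⟩ := ENNReal.lt_iff_exists_rat_btwn.1 hc
    lift q to ℚ≥0 using hq
    have hq' : Real.toNNReal ((q : ℚ) : ℝ) = (q : ℝ≥0) := by
      ext
      rw [Real.coe_toNNReal _ (by exact_mod_cast q.2)]
      rfl
    rw [hq'] at hcq hqf
    refine hcq.trans_le (le_iSup_of_le q ?_)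
    rw [indicator_of_mem ((hω q t ht).1 hqf)]
  · by_cases hq : (t, ω) ∈ D' q
    · rw [indicator_of_mem hq]
      exact le_of_lt ((hω q t ht).2 hq)
    · rw [indicator_of_notMem hq]
      exact zero_le

/-! ### Predictable versions with respect to a part of the information -/

lemma predictable_le_prod_of_le {Ω : Type*} {m mΩ : MeasurableSpace Ω} {𝓕 : Filtration ℝ≥0 mΩ}
    (h : ∀ t, 𝓕 t ≤ m) : 𝓕.predictable ≤ @Prod.instMeasurableSpace ℝ≥0 Ω _ m :=
  measurableSpace_le_predictable_of_measurableSet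
    (fun _ hA => (measurableSet_singleton _).prod (h _ _ hA))
    (fun _ _ hA => measurableSet_Ioi.prod (h _ _ hA))

/-- A predictable process for a join of two filtrations is a function of a predictable process for
the first one and of the terminal information of the second one. -/
lemma predictable_le_comap {Ω : Type*} {m₂ mΩ : MeasurableSpace Ω}
    {𝓕 𝓕₁ 𝓕₂ : Filtration ℝ≥0 mΩ} (h₁₂ : ∀ t, 𝓕 t ≤ 𝓕₁ t ⊔ 𝓕₂ t) (h𝓕₂ : ∀ t, 𝓕₂ t ≤ m₂) :
    𝓕.predictable ≤ (@Prod.instMeasurableSpace (ℝ≥0 × Ω) Ω 𝓕₁.predictable m₂).comap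
      fun p => (p, p.2) := by
  let M : MeasurableSpace (ℝ≥0 × Ω) :=
    (@Prod.instMeasurableSpace (ℝ≥0 × Ω) Ω 𝓕₁.predictable m₂).comap fun p => (p, p.2)
  have hM₁ : ∀ s, MeasurableSet[𝓕₁.predictable] s → MeasurableSet[M] s := fun s hs =>
    ⟨s ×ˢ univ, @MeasurableSet.prod _ _ 𝓕₁.predictable m₂ _ _ hs MeasurableSet.univ, by
      ext
      simp⟩
  have hM₂ : ∀ A, MeasurableSet[m₂] A → MeasurableSet[M] (univ ×ˢ A) := fun A hA =>
    ⟨univ ×ˢ A, @MeasurableSet.prod _ _ 𝓕₁.predictable m₂ _ _ MeasurableSet.univ hA, by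
      ext
      simp⟩
  have key : ∀ (I : Set ℝ≥0) (t : ℝ≥0),
      (∀ A, MeasurableSet[𝓕₁ t] A → MeasurableSet[𝓕₁.predictable] (I ×ˢ A)) →
      ∀ A, MeasurableSet[𝓕 t] A → MeasurableSet[M] (I ×ˢ A) := by
    intro I t hI A hA
    replace hA := h₁₂ t _ hA
    rw [sup_eq_generateFrom_inter] at hA
    induction A, hA using MeasurableSpace.generateFrom_induction with
    | hC D hD _ =>
      obtain ⟨s, hs, u, hu, rfl⟩ := hD
      have : I ×ˢ (s ∩ u) = I ×ˢ s ∩ univ ×ˢ u := by rw [prod_inter_prod, inter_univ]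
      change MeasurableSet[M] (I ×ˢ (s ∩ u))
      rw [this]
      exact (hM₁ _ (hI s hs)).inter (hM₂ u (h𝓕₂ t _ hu))
    | empty =>
      rw [prod_empty]
      exact @MeasurableSet.empty _ M
    | compl D _ ih =>
      have : I ×ˢ Dᶜ = I ×ˢ univ \ I ×ˢ D := by
        ext x
        simp only [mem_prod, mem_compl_iff, Set.mem_sdiff, mem_univ]
        tauto
      rw [this]
      exact (hM₁ _ (hI univ MeasurableSet.univ)).diff ih
    | iUnion D _ ih =>
      rw [prod_iUnion]
      exact MeasurableSet.iUnion ih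
  exact measurableSpace_le_predictable_of_measurableSet
    (fun A hA => key {⊥} ⊥ (fun _ h => measurableSet_predictable_singleton_bot_prod h) A hA)
    (fun i A hA => key (Ioi i) i (fun _ h => measurableSet_predictable_Ioi_prod h) A hA)

lemma setLIntegral_kernel_eq_of_Iic {Ω : Type*} {mΩ : MeasurableSpace Ω} {μ : Measure Ω}
    {κ β : Kernel Ω ℝ≥0} (hfin : ∫⁻ ω, κ ω univ ∂μ < ∞)
    (h : ∀ t, ∫⁻ ω, β ω (Iic t) ∂μ = ∫⁻ ω, κ ω (Iic t) ∂μ) {B : Set ℝ≥0}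
    (hB : MeasurableSet B) : ∫⁻ ω, β ω B ∂μ = ∫⁻ ω, κ ω B ∂μ := by
  have hb : ∀ (η : Kernel Ω ℝ≥0) {C : Set ℝ≥0}, MeasurableSet C →
      μ.bind η C = ∫⁻ ω, η ω C ∂μ :=
    fun η C hC => Measure.bind_apply hC η.measurable.aemeasurable
  have hf : IsFiniteMeasure (μ.bind κ) := ⟨by rwa [hb κ MeasurableSet.univ]⟩
  have : μ.bind κ = μ.bind β := Measure.ext_of_Iic _ _ fun t => by
    rw [hb κ measurableSet_Iic, hb β measurableSet_Iic, h]
  rw [← hb β hB, ← hb κ hB, this]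

/-- The measure `B × A ↦ E[1_A κ(B)]` on the product of time and sample space. -/
noncomputable def timeSpaceMeasure {Ω : Type*} [MeasurableSpace Ω] (Q : Measure Ω)
    (κ : Kernel Ω ℝ≥0) : Measure (ℝ≥0 × Ω) := (Q ⊗ₘ κ).map Prod.swap

lemma timeSpaceMeasure_prod {Ω : Type*} [MeasurableSpace Ω] {Q : Measure Ω} [SFinite Q]
    {κ : Kernel Ω ℝ≥0} [IsSFiniteKernel κ] {A : Set Ω} (hA : MeasurableSet A) {B : Set ℝ≥0}
    (hB : MeasurableSet B) : timeSpaceMeasure Q κ (B ×ˢ A) = ∫⁻ ω in A, κ ω B ∂Q := by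
  rw [timeSpaceMeasure, Measure.map_apply measurable_swap (hB.prod hA), preimage_swap_prod,
    Measure.compProd_apply_prod hA hB]

lemma isFiniteMeasure_timeSpaceMeasure {Ω : Type*} [MeasurableSpace Ω] {Q : Measure Ω} [SFinite Q]
    {κ : Kernel Ω ℝ≥0} [IsSFiniteKernel κ] (h : ∫⁻ ω, κ ω univ ∂Q < ∞) :
    IsFiniteMeasure (timeSpaceMeasure Q κ) :=
  ⟨by rwa [← univ_prod_univ, timeSpaceMeasure_prod MeasurableSet.univ MeasurableSet.univ,
    Measure.restrict_univ]⟩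

lemma integral_timeSpaceMeasure {Ω : Type*} [MeasurableSpace Ω] {Q : Measure Ω} [SFinite Q]
    {κ : Kernel Ω ℝ≥0} [IsSFiniteKernel κ] (h : ∫⁻ ω, κ ω univ ∂Q < ∞) {k : ℝ≥0 × Ω → ℝ}
    (hk : Measurable k) {C : ℝ} (hC : ∀ x, |k x| ≤ C) :
    Integrable (fun ω => ∫ s, k (s, ω) ∂(κ ω)) Q ∧
      ∫ x, k x ∂(timeSpaceMeasure Q κ) = ∫ ω, ∫ s, k (s, ω) ∂(κ ω) ∂Q := by
  have hfm := isFiniteMeasure_timeSpaceMeasure h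
  have hint : Integrable k (timeSpaceMeasure Q κ) := integrable_of_abs_le hk hC
  have hint' : Integrable (fun x : Ω × ℝ≥0 => k x.swap) (Q ⊗ₘ κ) :=
    (integrable_map_measure hk.aestronglyMeasurable measurable_swap.aemeasurable).1 hint
  refine ⟨MeasureTheory.Integrable.integral_compProd (a := ()) (κ := Kernel.const Unit Q)
    (η := Kernel.prodMkLeft Unit κ) hint', ?_⟩
  rw [timeSpaceMeasure, integral_map measurable_swap.aemeasurable hk.aestronglyMeasurable,
    Measure.integral_compProd hint']
  rfl

/-- Let `κ` be a predictable random measure for the join of the filtrations `𝓕₁` and `𝓕₂`, which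
are independent. If its expectations factor as in `hprod`, then it is predictable for `𝓕₁` alone.
Integrating out `𝓕₂` gives a predictable random measure for `𝓕₁` with the same expectations, and
predictable processes of finite variation are determined by these. -/
theorem exists_predictable_version_of_indep {Ω : Type*} {m₁ m₂ mΩ : MeasurableSpace Ω}
    {Q : Measure Ω} [IsProbabilityMeasure Q] {𝓕 𝓕₁ 𝓕₂ : Filtration ℝ≥0 mΩ} (h₁ : 𝓕₁ ≤ 𝓕)
    (h₁₂ : ∀ t, 𝓕 t ≤ 𝓕₁ t ⊔ 𝓕₂ t) (hm₁ : m₁ ≤ mΩ) (hm₂ : m₂ ≤ mΩ) (h𝓕₁ : ∀ t, 𝓕₁ t ≤ m₁)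
    (h𝓕₂ : ∀ t, 𝓕₂ t ≤ m₂) (hind : Indep m₁ m₂ Q) {κ : Kernel Ω ℝ≥0}
    [∀ ω, IsFiniteMeasure (κ ω)] (hfin : ∫⁻ ω, κ ω univ ∂Q < ∞) (h0 : ∀ ω, κ ω {0} = 0)
    {a : ℝ≥0 × Ω → ℝ≥0∞} (ha : Measurable[𝓕.predictable] a)
    (hκ : ∀ᵐ ω ∂Q, ∀ t, a (t, ω) = κ ω (Iic t))
    (hprod : ∀ s F₁ F₂, MeasurableSet[𝓕₁ s] F₁ → MeasurableSet[𝓕₂ s] F₂ →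
      ∫⁻ ω in F₁ ∩ F₂, κ ω (Ioi s) ∂Q = (∫⁻ ω in F₁, κ ω (Ioi s) ∂Q) * Q F₂) (T : ℝ≥0) :
    ∃ p : ℝ≥0 × Ω → ℝ≥0∞, Measurable[𝓕₁.predictable] p ∧
      ∀ᵐ ω ∂Q, ∀ t ≤ T, p (t, ω) = κ ω (Iic t) := by
  have hκs : IsSFiniteKernel κ := isSFiniteKernel_of_forall_lt_top κ fun ω => measure_lt_top _ _
  -- The distribution function of `κ` as a function of an `𝓕₁`-predictable point and of an
  -- `m₂`-measurable variable, which is then integrated out.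
  obtain ⟨a', ha', rfl⟩ := @Measurable.exists_eq_measurable_comp (ℝ≥0 × Ω) ((ℝ≥0 × Ω) × Ω)
    ℝ≥0∞ (@Prod.instMeasurableSpace (ℝ≥0 × Ω) Ω 𝓕₁.predictable m₂) _ _ _ _ _
    (ha.mono (predictable_le_comap h₁₂ h𝓕₂) le_rfl)
  have hindf : @IndepFun Ω Ω Ω mΩ m₁ m₂ id id Q := by
    have : Indep (m₁.comap id) (m₂.comap id) Q := by
      rwa [MeasurableSpace.comap_id, MeasurableSpace.comap_id]
    exact this
  obtain ⟨p, β, hp, hβf, hpβ, hβκ⟩ := @exists_kernel_integrate_out Ω Ω Ω mΩ m₁ m₂ Q _ id id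
    (measurable_id'' hm₁) (measurable_id'' hm₂) hindf 𝓕₁.predictable (predictable_le_prod_of_le h𝓕₁)
    a' ha' κ hfin (ae_of_all _ h0) hκ
  let β' : Kernel Ω ℝ≥0 := ⟨β, β.measurable.mono hm₁ le_rfl⟩
  have hβ'f : ∀ ω, IsFiniteMeasure (β' ω) := hβf
  have hβs : IsSFiniteKernel β' := isSFiniteKernel_of_forall_lt_top β' fun ω => measure_lt_top _ _
  have hset : ∀ A, MeasurableSet[m₁] A → ∀ B : Set ℝ≥0, MeasurableSet B →
      ∫⁻ ω in A, β' ω B ∂Q = ∫⁻ ω in A, κ ω B ∂Q := by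
    intro A hA B hB
    refine setLIntegral_kernel_eq_of_Iic ((setLIntegral_le_lintegral _ _).trans_lt hfin)
      (fun t => hβκ t A hA) hB
  have hfinβ : ∫⁻ ω, β' ω univ ∂Q < ∞ := by
    have := hset univ MeasurableSet.univ univ MeasurableSet.univ
    rw [Measure.restrict_univ] at this
    rwa [this]
  have hMκ := isFiniteMeasure_timeSpaceMeasure hfin
  have hMβ := isFiniteMeasure_timeSpaceMeasure hfinβ
  have hβ0 : ∫⁻ ω, β' ω {0} ∂Q = 0 := by
    have := hset univ MeasurableSet.univ {0} (measurableSet_singleton 0)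
    rw [Measure.restrict_univ] at this
    simp [this, h0]
  -- On the generators of the predictable sets, `κ` and its average have the same expectations.
  have htrim : (timeSpaceMeasure Q κ).trim (predictable_le_prod 𝓕) =
      (timeSpaceMeasure Q β').trim (predictable_le_prod 𝓕) := by
    refine trim_predictable_eq (fun A hA => ?_) (fun s A hA => ?_)
    · rw [timeSpaceMeasure_prod (𝓕.le _ _ hA) (measurableSet_singleton 0),
        timeSpaceMeasure_prod (𝓕.le _ _ hA) (measurableSet_singleton 0)]
      have := (setLIntegral_le_lintegral A fun ω => β' ω {0}).trans_eq hβ0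
      rw [nonpos_iff_eq_zero.1 this]
      simp [h0]
    · rw [timeSpaceMeasure_prod (𝓕.le _ _ hA) measurableSet_Ioi,
        timeSpaceMeasure_prod (𝓕.le _ _ hA) measurableSet_Ioi,
        ← withDensity_apply _ (𝓕.le _ _ hA), ← withDensity_apply _ (𝓕.le _ _ hA)]
      have hfw : IsFiniteMeasure (Q.withDensity fun ω => κ ω (Ioi s)) :=
        isFiniteMeasure_withDensity
          ((lintegral_mono fun ω => measure_mono (subset_univ _)).trans_lt hfin).ne
      refine ext_on_measurableSpace_of_generate_finite mΩ _ ?_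
        (sup_le (𝓕₁.le s) (𝓕₂.le s)) (sup_eq_generateFrom_inter _ _) (isPiSystem_inter _ _) ?_
        (h₁₂ s _ hA)
      · rintro _ ⟨F₁, hF₁, F₂, hF₂, rfl⟩
        have hF₁' := 𝓕₁.le s _ hF₁
        have hF₂' := 𝓕₂.le s _ hF₂
        have hi₁ : Measurable[m₁] (F₁.indicator fun ω => β' ω (Ioi s)) :=
          (β.measurable_coe measurableSet_Ioi).indicator (h𝓕₁ s _ hF₁)
        have hi₂ : Measurable[m₂] (F₂.indicator (1 : Ω → ℝ≥0∞)) :=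
          (@measurable_const ℝ≥0∞ Ω _ m₂ 1).indicator (h𝓕₂ s _ hF₂)
        change (Q.withDensity fun ω => κ ω (Ioi s)) (F₁ ∩ F₂) =
          (Q.withDensity fun ω => β' ω (Ioi s)) (F₁ ∩ F₂)
        rw [withDensity_apply _ (hF₁'.inter hF₂'), withDensity_apply _ (hF₁'.inter hF₂'),
          hprod s F₁ F₂ hF₁ hF₂, ← hset F₁ (h𝓕₁ s _ hF₁) _ measurableSet_Ioi,
          ← lintegral_indicator (hF₁'.inter hF₂'), ← lintegral_indicator hF₁',
          ← lintegral_indicator_one hF₂',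
          ← lintegral_mul_eq_lintegral_mul_lintegral_of_independent_measurableSpace hm₁ hm₂ hind
            hi₁ hi₂]
        refine lintegral_congr fun ω => ?_
        by_cases h1 : ω ∈ F₁ <;> by_cases h2 : ω ∈ F₂ <;> simp [h1, h2, β']
      · rw [withDensity_apply _ MeasurableSet.univ, withDensity_apply _ MeasurableSet.univ,
          hset univ MeasurableSet.univ _ measurableSet_Ioi]
  refine ⟨p, hp, ?_⟩
  have hp' : Measurable[𝓕.predictable] p := hp.mono (predictable_mono h₁) le_rfl
  -- The difference of the two distribution functions is predictable for `𝓕` and integrates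
  -- predictable processes to zero in mean.
  let D : ℝ≥0 → Ω → ℝ := fun t ω => (a' ((t, ω), ω)).toReal - (p (t, ω)).toReal
  have hD : IsPredictable 𝓕 D := ha.ennreal_toReal.sub hp'.ennreal_toReal
  have hpath : ∀ᵐ ω ∂Q, IsDistributionPath T (fun t => D t ω) (κ ω) (β' ω) := by
    filter_upwards [hκ, hpβ] with ω h2 h3 t _
    have hIic : ∀ (μ : Measure ℝ≥0) [IsFiniteMeasure μ] (s : ℝ≥0),
        μ.real (Iic s) = μ.real (Iic 0) + μ.real (Ioc 0 s) := by
      intro μ _ s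
      rw [← Iic_union_Ioc_eq_Iic (zero_le : (0 : ℝ≥0) ≤ s),
        measureReal_union (by
          rw [Set.disjoint_left]
          exact fun x hx hx' => not_lt.2 hx hx'.1) measurableSet_Ioc]
    have e : ∀ s, D s ω = (κ ω).real (Iic s) - (β' ω).real (Iic s) := by
      intro s
      have h2' : a' ((s, ω), ω) = κ ω (Iic s) := h2 s
      have h3' : p (s, ω) = β' ω (Iic s) := h3 s
      simp only [D, h2', h3', measureReal_def]
    change D t ω = D 0 ω + _ - _
    rw [e, e, hIic (κ ω) t, hIic (β' ω) t]
    ring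
  have huniq := eq_initial_of_integral_stieltjesIntegral_eq_zero (P := Q) (T := T) hD
    (hpath.mono fun ω h => h.isFiniteVariationPath) (L := fun _ => univ)
    (fun _ => @MeasurableSet.univ _ 𝓕.predictable) (fun _ _ _ _ _ _ => mem_univ _)
    (fun _ => ⟨0, mem_univ _⟩) (fun k hk ⟨C, hC⟩ _ => by
      let k' : ℝ≥0 × Ω → ℝ := (Ioc 0 T ×ˢ univ).indicator fun x => k x.1 x.2
      have hk' : Measurable[𝓕.predictable] k' :=
        hk.indicator (measurableSet_predictable_Ioc_prod 0 T MeasurableSet.univ)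
      have hC' : ∀ x, |k' x| ≤ C := by
        intro x
        by_cases hx : x ∈ (Ioc 0 T ×ˢ univ : Set (ℝ≥0 × Ω))
        · simp only [k', indicator_of_mem hx, hC]
        · simp only [k', indicator_of_notMem hx, abs_zero]
          exact (abs_nonneg _).trans (hC 0 x.2)
      have hk'' : Measurable k' := hk'.mono (predictable_le_prod 𝓕) le_rfl
      obtain ⟨i1, e1⟩ := integral_timeSpaceMeasure hfin hk'' hC'
      obtain ⟨i2, e2⟩ := integral_timeSpaceMeasure hfinβ hk'' hC'
      have heq : (fun ω => stieltjesIntegral T (fun s => k s ω) (fun s => D s ω)) =ᵐ[Q]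
          fun ω => ∫ s, k' (s, ω) ∂(κ ω) - ∫ s, k' (s, ω) ∂(β' ω) := by
        filter_upwards [hpath] with ω h
        have hb : ∀ (μ : Measure ℝ≥0) [IsFiniteMeasure μ],
            IntegrableOn (fun s => k s ω) (Ioc 0 T) μ := fun μ _ =>
          (integrable_of_abs_le (hk.measurable_path ω) fun s => hC s ω).integrableOn
        have hi : ∀ (μ : Measure ℝ≥0), ∫ s, k' (s, ω) ∂μ = ∫ s in Ioc 0 T, k s ω ∂μ := by
          intro μ
          rw [← integral_indicator measurableSet_Ioc]
          congr 1
          funext s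
          by_cases hs : s ∈ Ioc 0 T <;> simp [k', indicator, hs, -mem_Ioc]
        rw [h.stieltjesIntegral_eq (hb _) (hb _), hi, hi]
      refine ⟨(i1.sub i2).congr heq.symm, ?_⟩
      have hk's : StronglyMeasurable[𝓕.predictable] k' := Measurable.stronglyMeasurable hk'
      have htr : ∫ x, k' x ∂(timeSpaceMeasure Q κ) = ∫ x, k' x ∂(timeSpaceMeasure Q β') := by
        rw [integral_trim (predictable_le_prod 𝓕) hk's, htrim,
          ← integral_trim (predictable_le_prod 𝓕) hk's]
      rw [integral_congr_ae heq, integral_sub i1 i2, ← e1, ← e2, htr, sub_self])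
  have hβ0' : ∀ᵐ ω ∂Q, β' ω {0} = 0 :=
    (lintegral_eq_zero_iff (β'.measurable_coe (measurableSet_singleton 0))).1 hβ0
  filter_upwards [huniq, hκ, hpβ, hβ0'] with ω hω h2 h3 h4 t ht
  have hz := hω t ht
  have hI0 : (Iic 0 : Set ℝ≥0) = {0} := by
    ext
    simp
  have e : ∀ s, D s ω = (κ ω (Iic s)).toReal - (β' ω (Iic s)).toReal := by
    intro s
    have h2' : a' ((s, ω), ω) = κ ω (Iic s) := h2 s
    have h3' : p (s, ω) = β' ω (Iic s) := h3 s
    simp only [D, h2', h3']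
  rw [e, e, hI0, h0, h4, sub_self, sub_eq_zero] at hz
  have h3' : p (t, ω) = β' ω (Iic t) := h3 t
  rw [h3', (ENNReal.toReal_eq_toReal_iff' (measure_ne_top _ _) (measure_ne_top _ _)).1 hz]

namespace ModuleSystem

/-! ### The histories of the modules -/

lemma measurable_measure_restrict {α : Type*} [MeasurableSpace α] {s : Set α}
    (hs : MeasurableSet s) : Measurable fun μ : Measure α => μ.restrict s := by
  refine Measure.measurable_of_measurable_coe _ fun t ht => ?_
  simp only [Measure.restrict_apply ht]
  exact Measure.measurable_coe (ht.inter hs)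

lemma initSigma_mono {Ω ι J : Type*} [MeasurableSpace Ω] [MeasurableSpace J]
    (S : ModuleSystem Ω ι J) {W W' : Set ι} (h : W ⊆ W') : S.initSigma W ≤ S.initSigma W' :=
  biSup_mono h

lemma rawFiltration_mono {Ω ι J : Type*} [MeasurableSpace Ω] [MeasurableSpace J]
    (S : ModuleSystem Ω ι J) {W W' : Set ι} (h : W ⊆ W') :
    S.rawFiltration W ≤ S.rawFiltration W' :=
  fun _ => sup_le_sup (S.initSigma_mono h) (biSup_mono h)

lemma filtration_mono {Ω ι J : Type*} [MeasurableSpace Ω] [MeasurableSpace J]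
    (S : ModuleSystem Ω ι J) (Q : Measure Ω) {W W' : Set ι} (h : W ⊆ W') :
    S.filtration Q W ≤ S.filtration Q W' := by
  intro t
  rw [filtration, filtration, augmentation, augmentation, Filtration.rightCont_eq,
    Filtration.rightCont_eq]
  exact iInf₂_mono fun j _ => sup_le_sup_right (S.rawFiltration_mono h j) _

lemma rawFiltration_le_filtration {Ω ι J : Type*} [MeasurableSpace Ω] [MeasurableSpace J]
    (S : ModuleSystem Ω ι J) (Q : Measure Ω) {W W' : Set ι} (h : W ⊆ W') :
    S.rawFiltration W ≤ S.filtration Q W' :=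
  (S.rawFiltration_mono h).trans (le_augmentation Q _)

/-- The σ-algebra generated by `V₀` and the whole of `N|_{J_V}`, for `V ∈ W`. -/
@[reducible]
noncomputable def historySigma {Ω ι J : Type*} [MeasurableSpace Ω] [MeasurableSpace J]
    (S : ModuleSystem Ω ι J) (W : Set ι) : MeasurableSpace Ω :=
  S.initSigma W ⊔ ⨆ V ∈ W,
    MeasurableSpace.comap (fun ω => (S.N ω).restrict (univ ×ˢ S.marks V)) inferInstance

lemma measurable_restrict_marks {Ω ι J : Type*} [MeasurableSpace Ω] [MeasurableSpace J]
    (S : ModuleSystem Ω ι J) {V : ι} (hV : MeasurableSet (S.marks V)) :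
    Measurable fun ω => (S.N ω).restrict (univ ×ˢ S.marks V) :=
  (measurable_measure_restrict (MeasurableSet.univ.prod hV)).comp S.N.measurable

lemma historySigma_le {Ω ι J : Type*} [mΩ : MeasurableSpace Ω] [MeasurableSpace J]
    (S : ModuleSystem Ω ι J) (hJ : ∀ V, MeasurableSet (S.marks V)) (W : Set ι) :
    S.historySigma W ≤ mΩ :=
  sup_le (iSup₂_le fun V _ => (S.measurable_init V).comap_le)
    (iSup₂_le fun V _ => (S.measurable_restrict_marks (hJ V)).comap_le)

lemma rawFiltration_le_historySigma {Ω ι J : Type*} [mΩ : MeasurableSpace Ω] [MeasurableSpace J]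
    (S : ModuleSystem Ω ι J) (W : Set ι) (t : ℝ≥0) :
    S.rawFiltration W t ≤ S.historySigma W := by
  refine sup_le_sup_left (iSup₂_mono fun V _ => iSup₂_le fun C hC => ?_) _
  have hsub : C ⊆ univ ×ˢ S.marks V := hC.2.trans (prod_mono_left (subset_univ _))
  have : (fun ω => S.N ω C) =
      (fun μ : Measure (ℝ≥0 × J) => μ C) ∘ fun ω => (S.N ω).restrict (univ ×ˢ S.marks V) := by
    funext ω
    rw [Function.comp_apply, Measure.restrict_apply hC.1, inter_eq_left.2 hsub]
  rw [this, ← MeasurableSpace.comap_comp]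
  exact MeasurableSpace.comap_mono (Measure.measurable_coe hC.1).comap_le

lemma rawFiltration_univ_le {Ω ι J : Type*} [MeasurableSpace Ω] [MeasurableSpace J]
    (S : ModuleSystem Ω ι J) (V : ι) (t : ℝ≥0) :
    S.rawFiltration univ t ≤ S.rawFiltration {V} t ⊔ S.rawFiltration {V}ᶜ t := by
  refine sup_le (iSup₂_le fun V' _ => ?_) (iSup₂_le fun V' _ => ?_)
  all_goals by_cases h : V' = V
  · exact le_sup_of_le_left (le_sup_of_le_left
      (le_iSup₂_of_le (f := fun V (_ : V ∈ _) => MeasurableSpace.comap (S.init V) inferInstance)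
        V' h le_rfl))
  · exact le_sup_of_le_right (le_sup_of_le_left
      (le_iSup₂_of_le (f := fun V (_ : V ∈ _) => MeasurableSpace.comap (S.init V) inferInstance)
        V' h le_rfl))
  · exact le_sup_of_le_left (le_sup_of_le_right (le_iSup₂_of_le V' h le_rfl))
  · exact le_sup_of_le_right (le_sup_of_le_right (le_iSup₂_of_le V' h le_rfl))

/-- The history of one module is independent of the history of the other modules. -/
lemma IsReference.indep_historySigma {Ω ι J : Type*} [MeasurableSpace Ω] [MeasurableSpace J]
    {S : ModuleSystem Ω ι J} {Q : Measure Ω} [IsProbabilityMeasure Q] (hQ : S.IsReference Q)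
    (V : ι) : Indep (S.historySigma {V}) (S.historySigma {V}ᶜ) Q := by
  have hd : Disjoint ({V} : Set ι) {V}ᶜ := disjoint_compl_right
  have hNle := fun V => (S.measurable_restrict_marks (hQ.measurableSet_marks V)).comap_le
  have hile := fun V => (S.measurable_init V).comap_le
  have hI : ∀ W, S.initSigma W ≤ MeasurableSpace.comap (fun ω V => S.init V ω) inferInstance := by
    intro W
    refine iSup₂_le fun V _ => ?_
    have : S.init V = (fun x : ι → ℝ => x V) ∘ fun ω V => S.init V ω := rfl
    rw [this, ← MeasurableSpace.comap_comp]
    exact MeasurableSpace.comap_mono (measurable_pi_apply V).comap_le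
  have hN : ∀ W : Set ι, (⨆ V ∈ W, MeasurableSpace.comap
      (fun ω => (S.N ω).restrict (univ ×ˢ S.marks V)) inferInstance) ≤
      MeasurableSpace.comap (fun ω => (S.N ω : Measure (ℝ≥0 × J))) inferInstance := by
    intro W
    refine iSup₂_le fun V _ => ?_
    have : (fun ω => (S.N ω).restrict (univ ×ˢ S.marks V)) =
      (fun μ : Measure (ℝ≥0 × J) => μ.restrict (univ ×ˢ S.marks V)) ∘ fun ω => S.N ω := rfl
    rw [this, ← MeasurableSpace.comap_comp]
    exact MeasurableSpace.comap_mono (measurable_measure_restrict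
      (MeasurableSet.univ.prod (hQ.measurableSet_marks V))).comap_le
  refine indep_sup_sup (iSup₂_le fun V _ => hile V) (iSup₂_le fun V _ => hile V)
    (iSup₂_le fun V _ => hNle V) (iSup₂_le fun V _ => hNle V) ?_ ?_ ?_
  · exact indep_iSup_of_disjoint hile hQ.indep_init hd
  · exact indep_iSup_of_disjoint hNle hQ.indep_N hd
  · exact indep_of_indep_of_le_left (indep_of_indep_of_le_right
      ((IndepFun_iff_Indep _ _ _).1 hQ.indep_init_N) (sup_le (hN _) (hN _))) (sup_le (hI _) (hI _))

/-! ### Localization by the number of events -/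

/-- The points `(t, ω)` such that at most `n` events of `N|_{J_V}` occur strictly before `t`. -/
def levelSet {Ω ι J : Type*} [MeasurableSpace Ω] [MeasurableSpace J]
    (S : ModuleSystem Ω ι J) (V : ι) (n : ℕ) : Set (ℝ≥0 × Ω) :=
  {p | S.N p.2 (Iio p.1 ×ˢ S.marks V) ≤ n}

lemma measurableSet_levelSet {Ω ι J : Type*} [MeasurableSpace Ω] [MeasurableSpace J]
    (S : ModuleSystem Ω ι J) {V : ι} (hV : MeasurableSet (S.marks V)) (n : ℕ) :
    MeasurableSet[(S.rawFiltration {V}).predictable] (S.levelSet V n) := by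
  have hcompl : (S.levelSet V n)ᶜ = ⋃ q : ℚ≥0,
      Ioi (q : ℝ≥0) ×ˢ {ω | (n : ℝ≥0∞) < S.N ω (Iic (q : ℝ≥0) ×ˢ S.marks V)} := by
    ext ⟨t, ω⟩
    simp only [levelSet, mem_compl_iff, mem_ofPred_eq, not_le, mem_iUnion, mem_prod, mem_Ioi]
    constructor
    · intro h
      have hU : Iio t ×ˢ S.marks V =
          ⋃ q : {q : ℚ≥0 // (q : ℝ≥0) < t}, Iic ((q : ℚ≥0) : ℝ≥0) ×ˢ S.marks V := by
        ext ⟨s, x⟩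
        simp only [mem_prod, mem_Iio, mem_iUnion, mem_Iic, Subtype.exists, exists_and_right,
          exists_prop]
        constructor
        · rintro ⟨hs, hx⟩
          obtain ⟨q, hq0, hq1, hq2⟩ := (NNReal.lt_iff_exists_rat_btwn s t).1 hs
          lift q to ℚ≥0 using hq0
          have hq' : Real.toNNReal ((q : ℚ) : ℝ) = (q : ℝ≥0) := by
            ext
            rw [Real.coe_toNNReal _ (by exact_mod_cast q.2)]
            rfl
          rw [hq'] at hq1 hq2
          exact ⟨⟨q, hq2, hq1.le⟩, hx⟩
        · rintro ⟨⟨q, hq, hsq⟩, hx⟩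
          exact ⟨hsq.trans_lt hq, hx⟩
      have hdir : Directed (· ⊆ ·) fun q : {q : ℚ≥0 // (q : ℝ≥0) < t} =>
          Iic ((q : ℚ≥0) : ℝ≥0) ×ˢ S.marks V := by
        intro q r
        rcases le_total (q : ℚ≥0) (r : ℚ≥0) with hqr | hqr
        · exact ⟨r, prod_mono_left (Iic_subset_Iic.2 (by exact_mod_cast hqr)), subset_rfl⟩
        · exact ⟨q, subset_rfl, prod_mono_left (Iic_subset_Iic.2 (by exact_mod_cast hqr))⟩
      rw [hU, hdir.measure_iUnion, lt_iSup_iff] at h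
      obtain ⟨q, hq⟩ := h
      exact ⟨q, q.2, hq⟩
    · rintro ⟨q, hq, hn⟩
      refine hn.trans_le (measure_mono (prod_mono_left fun x hx => ?_))
      exact lt_of_le_of_lt hx hq
  rw [← compl_compl (S.levelSet V n), hcompl]
  refine (MeasurableSet.iUnion fun q => measurableSet_predictable_Ioi_prod ?_).compl
  have hm : Measurable[S.rawFiltration {V} q] fun ω => S.N ω (Iic (q : ℝ≥0) ×ˢ S.marks V) := by
    refine Measurable.of_comap_le (le_sup_of_le_right ?_)
    refine le_iSup₂_of_le V rfl ?_
    exact le_iSup₂_of_le (f := fun C (_ : C ∈ {C : Set (ℝ≥0 × J) | MeasurableSet C ∧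
      C ⊆ Iic (q : ℝ≥0) ×ˢ S.marks V}) => MeasurableSpace.comap (fun ω => S.N ω C) inferInstance)
      (Iic (q : ℝ≥0) ×ˢ S.marks V) ⟨measurableSet_Iic.prod hV, subset_rfl⟩ le_rfl
  exact hm measurableSet_Ioi

lemma mem_levelSet_of_le {Ω ι J : Type*} [MeasurableSpace Ω] [MeasurableSpace J]
    (S : ModuleSystem Ω ι J) {V : ι} (n : ℕ) (ω : Ω) (s t : ℝ≥0) (hst : s ≤ t)
    (h : (t, ω) ∈ S.levelSet V n) : (s, ω) ∈ S.levelSet V n :=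
  (measure_mono (prod_mono_left (Iio_subset_Iio hst))).trans h

lemma levelSet_mono {Ω ι J : Type*} [MeasurableSpace Ω] [MeasurableSpace J]
    (S : ModuleSystem Ω ι J) (V : ι) {m n : ℕ} (h : m ≤ n) :
    S.levelSet V m ⊆ S.levelSet V n :=
  fun p hp => show S.N p.2 (Iio p.1 ×ˢ S.marks V) ≤ n from
    le_trans (show S.N p.2 (Iio p.1 ×ˢ S.marks V) ≤ m from hp) (by exact_mod_cast h)

lemma IsReference.isFiniteMeasure_N {Ω ι J : Type*} [MeasurableSpace Ω] [MeasurableSpace J]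
    {S : ModuleSystem Ω ι J} {Q : Measure Ω} (hQ : S.IsReference Q) (ω : Ω) :
    IsFiniteMeasure (S.N ω) := by
  obtain ⟨s, -, -, hs⟩ := hQ.point_process ω
  rw [hs]
  infer_instance

lemma IsReference.exists_mem_levelSet {Ω ι J : Type*} [MeasurableSpace Ω] [MeasurableSpace J]
    {S : ModuleSystem Ω ι J} {Q : Measure Ω} (hQ : S.IsReference Q) (V : ι) (t : ℝ≥0) (ω : Ω) :
    ∃ n, (t, ω) ∈ S.levelSet V n := by
  have := hQ.isFiniteMeasure_N ω
  obtain ⟨n, hn⟩ := ENNReal.exists_nat_gt (measure_ne_top (S.N ω) (Iio t ×ˢ S.marks V))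
  exact ⟨n, hn.le⟩

lemma measurableSet_levelSet_prod {Ω ι J : Type*} [MeasurableSpace Ω] [MeasurableSpace J]
    (S : ModuleSystem Ω ι J) {V : ι} (hV : MeasurableSet (S.marks V)) (n : ℕ) (ω : Ω) :
    MeasurableSet {t | (t, ω) ∈ S.levelSet V n} :=
  (predictable_le_prod _ _ (S.measurableSet_levelSet hV n)).preimage measurable_prodMk_right

/-- Events at distinct times: on the level set at most `n + 1` of them occur. -/
lemma IsReference.measure_levelSet_le {Ω ι J : Type*} [MeasurableSpace Ω] [MeasurableSpace J]
    {S : ModuleSystem Ω ι J} {Q : Measure Ω} (hQ : S.IsReference Q) (V : ι) (n : ℕ) (ω : Ω) :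
    S.N ω ({t | (t, ω) ∈ S.levelSet V n} ×ˢ S.marks V) ≤ n + 1 := by
  classical
  obtain ⟨s, -, hinj, hs⟩ := hQ.point_process ω
  have hV := hQ.measurableSet_marks V
  let c : Set (ℝ≥0 × J) → Finset (ℝ≥0 × J) := fun A => s.filter (· ∈ A)
  have hc : ∀ {A p}, p ∈ c A ↔ p ∈ s ∧ p ∈ A := Finset.mem_filter
  have hcount : ∀ A : Set (ℝ≥0 × J), MeasurableSet A → S.N ω A = ((c A).card : ℝ≥0∞) := by
    intro A hA
    rw [hs, Measure.finsetSum_apply]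
    simp only [Measure.dirac_apply' _ hA, indicator_apply, Pi.one_apply]
    rw [Finset.sum_boole]
  rw [hcount _ ((S.measurableSet_levelSet_prod hV n ω).prod hV)]
  set A := c ({t | (t, ω) ∈ S.levelSet V n} ×ˢ S.marks V)
  rcases A.eq_empty_or_nonempty with hne | hne
  · simp [hne]
  -- Apart from the last event of `A`, all its events occur before that one.
  obtain ⟨p, hpA, hp⟩ := Finset.exists_max_image A Prod.fst hne
  have hpA' := (hc.1 hpA).2
  have hlev : S.N ω (Iio p.1 ×ˢ S.marks V) ≤ n := hpA'.1
  rw [hcount _ (measurableSet_Iio.prod hV)] at hlev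
  have hsub : A.erase p ⊆ c (Iio p.1 ×ˢ S.marks V) := by
    intro q hq
    obtain ⟨hqp, hqA⟩ := Finset.mem_erase.1 hq
    have hqs := (hc.1 hqA).1
    refine hc.2 ⟨hqs, lt_of_le_of_ne (hp q hqA) fun h => hqp ?_,
      (hc.1 hqA).2.2⟩
    exact hinj hqs (hc.1 hpA).1 h
  have hcard := Finset.card_le_card hsub
  rw [Finset.card_erase_of_mem hpA] at hcard
  have h2 : (c (Iio p.1 ×ˢ S.marks V)).card ≤ n := by exact_mod_cast hlev
  have h3 : A.card ≤ n + 1 := by omega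
  exact_mod_cast h3

end ModuleSystem

/-! ### Integrals of predictable fields against predictable random measures -/

lemma measurable_prodMk_predictable {Ω : Type*} {mΩ : MeasurableSpace Ω} (𝓕 : Filtration ℝ≥0 mΩ)
    (s : ℝ≥0) : Measurable[𝓕 s, 𝓕.predictable] fun ω => (s, ω) := by
  refine @measurable_generateFrom _ _ (𝓕 s) _ _ ?_
  rintro _ (⟨A, hA, rfl⟩ | ⟨i, A, hA, rfl⟩)
  · by_cases h : s = ⊥
    · subst h
      convert hA using 1
      ext
      simp
    · convert @MeasurableSet.empty _ (𝓕 s) using 1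
      ext
      simp at h
      simp [h]
  · by_cases h : i < s
    · convert 𝓕.mono h.le _ hA using 1
      ext
      simp [h]
    · convert @MeasurableSet.empty _ (𝓕 s) using 1
      ext
      simp [h]

lemma measurable_indicator_Ioi_predictable {Ω : Type*} {mΩ : MeasurableSpace Ω}
    (𝓕 : Filtration ℝ≥0 mΩ) {s : ℝ≥0} {g : Ω → ℝ≥0∞} (hg : Measurable[𝓕 s] g) :
    Measurable[𝓕.predictable]
      ((Ioi s ×ˢ univ : Set (ℝ≥0 × Ω)).indicator fun x => g x.2) := by
  classical
  have hI : MeasurableSet[𝓕.predictable] (Ioi s ×ˢ univ : Set (ℝ≥0 × Ω)) :=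
    measurableSet_predictable_Ioi_prod MeasurableSet.univ
  intro B hB
  rw [indicator_preimage, Set.ite]
  refine MeasurableSet.union ?_
    (MeasurableSet.diff (@measurable_const _ _ _ 𝓕.predictable 0 _ hB) hI)
  have : (fun x : ℝ≥0 × Ω => g x.2) ⁻¹' B ∩ Ioi s ×ˢ univ = Ioi s ×ˢ (g ⁻¹' B) := by
    ext x
    simp [and_comm]
  rw [this]
  exact measurableSet_predictable_Ioi_prod (hg hB)

lemma predictable_prod_le {Ω J : Type*} {mΩ : MeasurableSpace Ω} [mJ : MeasurableSpace J]
    (𝓕 : Filtration ℝ≥0 mΩ) :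
    @Prod.instMeasurableSpace (ℝ≥0 × Ω) J 𝓕.predictable mJ ≤ Prod.instMeasurableSpace :=
  sup_le_sup (MeasurableSpace.comap_mono (predictable_le_prod 𝓕)) le_rfl

lemma predictable_prod_eq_generateFrom {Ω J : Type*} {mΩ : MeasurableSpace Ω}
    [mJ : MeasurableSpace J] (𝓕 : Filtration ℝ≥0 mΩ) :
    @Prod.instMeasurableSpace (ℝ≥0 × Ω) J 𝓕.predictable mJ = MeasurableSpace.generateFrom
      (image2 (· ×ˢ ·) ({s : Set (ℝ≥0 × Ω) | ∃ A, MeasurableSet[𝓕 ⊥] A ∧ s = {⊥} ×ˢ A} ∪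
        {s | ∃ i A, MeasurableSet[𝓕 i] A ∧ s = Ioi i ×ˢ A}) {C : Set J | MeasurableSet C}) := by
  refine (@generateFrom_eq_prod (ℝ≥0 × Ω) J 𝓕.predictable mJ _ _ rfl
    MeasurableSpace.generateFrom_measurableSet ?_ isCountablySpanning_measurableSet).symm
  refine ⟨fun n => if n = 0 then {⊥} ×ˢ univ else Ioi 0 ×ˢ univ, fun n => ?_, ?_⟩
  · dsimp only
    split_ifs
    · exact Or.inl ⟨univ, MeasurableSet.univ, rfl⟩
    · exact Or.inr ⟨0, univ, MeasurableSet.univ, rfl⟩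
  · refine eq_univ_of_forall fun x => mem_iUnion.2 ?_
    rcases eq_or_ne x.1 ⊥ with h | h
    · exact ⟨0, by simpa using h⟩
    · exact ⟨1, by simpa using bot_lt_iff_ne_bot.2 h⟩

/-- The random set `{(t, x) | (t, ω, x) ∈ E}` of times and marks. -/
def slice {Ω J : Type*} (E : Set ((ℝ≥0 × Ω) × J)) (ω : Ω) : Set (ℝ≥0 × J) :=
  {q | ((q.1, ω), q.2) ∈ E}

lemma measurable_slice_map {Ω J : Type*} [MeasurableSpace Ω] [MeasurableSpace J] (ω : Ω) :
    Measurable fun q : ℝ≥0 × J => ((q.1, ω), q.2) := by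
  fun_prop

lemma measurableSet_slice {Ω J : Type*} [MeasurableSpace Ω] [MeasurableSpace J]
    {E : Set ((ℝ≥0 × Ω) × J)} (hE : MeasurableSet E) (ω : Ω) : MeasurableSet (slice E ω) :=
  measurable_slice_map ω hE

lemma measurable_measure_slice {Ω J : Type*} [MeasurableSpace Ω] [MeasurableSpace J]
    {κ : Kernel Ω (ℝ≥0 × J)} [IsSFiniteKernel κ] {E : Set ((ℝ≥0 × Ω) × J)}
    (hE : MeasurableSet E) : Measurable fun ω => κ ω (slice E ω) := by
  have hm : Measurable fun x : Ω × (ℝ≥0 × J) => ((x.2.1, x.1), x.2.2) := by fun_prop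
  exact Kernel.measurable_kernel_prodMk_left (hm hE)

/-- If the distribution functions `κ((0, t] × C)` of a random measure have predictable versions,
then so do its integrals `∫_0^t G dκ` of nonnegative predictable fields. -/
theorem exists_predictable_lintegral {Ω J : Type*} {mΩ : MeasurableSpace Ω}
    [mJ : MeasurableSpace J] {Q : Measure Ω} {𝓕 : Filtration ℝ≥0 mΩ} {T : ℝ≥0}
    {κ : Kernel Ω (ℝ≥0 × J)} [∀ ω, IsFiniteMeasure (κ ω)]
    (h0 : ∀ ω, κ ω ({0} ×ˢ univ) = 0)
    (hκ : ∀ C : Set J, MeasurableSet C → ∃ p : ℝ≥0 × Ω → ℝ≥0∞, Measurable[𝓕.predictable] p ∧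
      ∀ᵐ ω ∂Q, ∀ t ≤ T, p (t, ω) = κ ω (Iic t ×ˢ C))
    {G : (ℝ≥0 × Ω) × J → ℝ≥0∞} (hG : Measurable[𝓕.predictable.prod mJ] G) :
    ∃ p : ℝ≥0 × Ω → ℝ≥0∞, Measurable[𝓕.predictable] p ∧
      ∀ᵐ ω ∂Q, ∀ t ≤ T, p (t, ω) = ∫⁻ q in Iic t ×ˢ univ, G ((q.1, ω), q.2) ∂(κ ω) := by
  have hset : ∀ D : Set ((ℝ≥0 × Ω) × J), MeasurableSet[𝓕.predictable.prod mJ] D →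
      ∃ p : ℝ≥0 × Ω → ℝ≥0∞, Measurable[𝓕.predictable] p ∧
        ∀ᵐ ω ∂Q, ∀ t ≤ T, p (t, ω) = κ ω (slice D ω ∩ Iic t ×ˢ univ) := by
    refine MeasurableSpace.induction_on_inter (predictable_prod_eq_generateFrom 𝓕)
      ((isPiSystem_predictable 𝓕).prod MeasurableSpace.isPiSystem_measurableSet) ?_ ?_ ?_ ?_
    · refine ⟨fun _ => 0, @measurable_const _ _ _ 𝓕.predictable 0, ae_of_all _ fun ω t _ => ?_⟩
      simp [slice]
    · rintro _ ⟨E, hE, C, hC, rfl⟩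
      rcases hE with ⟨A, hA, rfl⟩ | ⟨s, A, hA, rfl⟩
      · refine ⟨fun _ => 0, @measurable_const _ _ _ 𝓕.predictable 0, ae_of_all _ fun ω t _ => ?_⟩
        refine (measure_mono_null (fun q hq => ?_) (h0 ω)).symm
        exact ⟨hq.1.1.1, mem_univ _⟩
      · obtain ⟨p, hp, hpκ⟩ := hκ C hC
        refine ⟨(Ioi s ×ˢ A).indicator fun x => p x -
          (Ioi s ×ˢ univ : Set (ℝ≥0 × Ω)).indicator (fun y => p (s, y.2)) x,
          (hp.sub (measurable_indicator_Ioi_predictable 𝓕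
            (hp.comp (measurable_prodMk_predictable 𝓕 s)))).indicator
            (measurableSet_predictable_Ioi_prod hA), ?_⟩
        filter_upwards [hpκ] with ω hω t ht
        by_cases hmem : (t, ω) ∈ Ioi s ×ˢ A
        · have hst : s < t := hmem.1
          have hmem' : (t, ω) ∈ (Ioi s ×ˢ univ : Set (ℝ≥0 × Ω)) := ⟨hst, mem_univ _⟩
          rw [indicator_of_mem hmem, indicator_of_mem hmem', hω t ht, hω s (hst.le.trans ht),
            ← measure_sdiff (prod_mono_left (Iic_subset_Iic.2 hst.le))
              (measurableSet_Iic.prod hC).nullMeasurableSet (measure_ne_top _ _)]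
          congr 1
          ext q
          have hωA : ω ∈ A := hmem.2
          simp only [slice, Set.mem_sdiff, mem_prod, mem_Iic, mem_inter_iff, mem_ofPred_eq, mem_Ioi,
            hωA, mem_univ, and_true, not_and]
          constructor
          · rintro ⟨⟨h1, h2⟩, h3⟩
            exact ⟨⟨not_le.1 fun h => h3 h h2, h2⟩, h1⟩
          · rintro ⟨⟨h1, h2⟩, h3⟩
            exact ⟨⟨h3, h2⟩, fun h => absurd h (not_le.2 h1)⟩
        · rw [indicator_of_notMem hmem]
          have : slice ((Ioi s ×ˢ A) ×ˢ C) ω ∩ Iic t ×ˢ univ = ∅ := by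
            refine eq_empty_of_forall_notMem fun q hq => hmem ?_
            have h1 : s < q.1 := hq.1.1.1
            exact ⟨h1.trans_le hq.2.1, hq.1.1.2⟩
          rw [this, measure_empty]
    · rintro D hD ⟨p, hp, hpκ⟩
      obtain ⟨r, hr, hrκ⟩ := hκ univ MeasurableSet.univ
      refine ⟨fun x => r x - p x, hr.sub hp, ?_⟩
      filter_upwards [hpκ, hrκ] with ω h1 h2 t ht
      have hDm := measurableSet_slice (predictable_prod_le 𝓕 _ hD) ω
      rw [h1 t ht, h2 t ht, ← measure_sdiff inter_subset_right
        (hDm.inter (measurableSet_Iic.prod MeasurableSet.univ)).nullMeasurableSet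
        (measure_ne_top _ _)]
      congr 1
      ext q
      simp only [slice, Set.mem_sdiff, mem_inter_iff, mem_ofPred_eq, mem_compl_iff]
      tauto
    · intro D hdisj hD h
      choose p hp hpκ using h
      refine ⟨fun x => ∑' n, p n x,
        @Measurable.tsum _ _ _ 𝓕.predictable _ _ _ _ _ _ _ _ _ _ _ _ hp, ?_⟩
      filter_upwards [ae_all_iff.2 hpκ] with ω hω t ht
      have : slice (⋃ n, D n) ω ∩ Iic t ×ˢ univ = ⋃ n, (slice (D n) ω ∩ Iic t ×ˢ univ) := by
        ext q
        simp [slice]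
      rw [this, measure_iUnion]
      · exact tsum_congr fun n => hω n t ht
      · intro i j hij
        refine Disjoint.mono inter_subset_left inter_subset_left ?_
        exact Set.disjoint_left.2 fun q h1 h2 => Set.disjoint_left.1 (hdisj hij) h1 h2
      · exact fun n => (measurableSet_slice (predictable_prod_le 𝓕 _ (hD n)) ω).inter
          (measurableSet_Iic.prod MeasurableSet.univ)
  have hsec : ∀ {f : (ℝ≥0 × Ω) × J → ℝ≥0∞}, Measurable[𝓕.predictable.prod mJ] f → ∀ ω,
      Measurable fun q : ℝ≥0 × J => f ((q.1, ω), q.2) := fun hf ω =>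
    (hf.mono (predictable_prod_le 𝓕) le_rfl).comp (measurable_slice_map ω)
  refine @Measurable.ennreal_induction _ (𝓕.predictable.prod mJ) (fun G =>
    ∃ p : ℝ≥0 × Ω → ℝ≥0∞, Measurable[𝓕.predictable] p ∧ ∀ᵐ ω ∂Q, ∀ t ≤ T,
      p (t, ω) = ∫⁻ q in Iic t ×ˢ univ, G ((q.1, ω), q.2) ∂(κ ω)) ?_ ?_ ?_ G hG
  · intro c D hD
    obtain ⟨p, hp, hpκ⟩ := hset D hD
    refine ⟨fun x => c * p x, hp.const_mul c, ?_⟩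
    filter_upwards [hpκ] with ω hω t ht
    have hDm := measurableSet_slice (predictable_prod_le 𝓕 _ hD) ω
    have : (fun q : ℝ≥0 × J => D.indicator (fun _ => c) ((q.1, ω), q.2)) =
        (slice D ω).indicator fun _ => c := rfl
    rw [this, lintegral_indicator hDm, setLIntegral_const, Measure.restrict_apply hDm, hω t ht]
  · rintro f g - hf hg ⟨p, hp, hpκ⟩ ⟨r, hr, hrκ⟩
    refine ⟨fun x => p x + r x, hp.add hr, ?_⟩
    filter_upwards [hpκ, hrκ] with ω h1 h2 t ht
    simp only [Pi.add_apply]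
    rw [lintegral_add_left (hsec hf ω), h1 t ht, h2 t ht]
  · intro f hf hmono h
    choose p hp hpκ using h
    refine ⟨fun x => ⨆ n, p n x, Measurable.iSup hp, ?_⟩
    filter_upwards [ae_all_iff.2 hpκ] with ω hω t ht
    rw [lintegral_iSup (fun n => hsec (hf n) ω) (fun i j hij q => hmono hij _)]
    exact iSup_congr fun n => hω n t ht

/-- The random measure `B ↦ κ(E ∩ (B × J))` on the time axis, for a random set `E`. -/
noncomputable def timeMarginal {Ω J : Type*} [MeasurableSpace Ω] [MeasurableSpace J]
    (κ : Kernel Ω (ℝ≥0 × J)) [IsSFiniteKernel κ] {E : Set ((ℝ≥0 × Ω) × J)}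
    (hE : MeasurableSet E) : Kernel Ω ℝ≥0 where
  toFun ω := ((κ ω).restrict (slice E ω)).map Prod.fst
  measurable' := by
    refine Measure.measurable_of_measurable_coe _ fun B hB => ?_
    have h : ∀ ω, (((κ ω).restrict (slice E ω)).map Prod.fst) B =
        κ ω (slice ((B ×ˢ univ) ×ˢ univ ∩ E) ω) := by
      intro ω
      rw [Measure.map_apply measurable_fst hB, Measure.restrict_apply (measurable_fst hB)]
      congr 1
      ext q
      simp [slice]
    simp only [h]
    exact measurable_measure_slice (((hB.prod MeasurableSet.univ).prod MeasurableSet.univ).inter hE)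

lemma timeMarginal_apply {Ω J : Type*} [MeasurableSpace Ω] [MeasurableSpace J]
    (κ : Kernel Ω (ℝ≥0 × J)) [IsSFiniteKernel κ] {E : Set ((ℝ≥0 × Ω) × J)}
    (hE : MeasurableSet E) (ω : Ω) {B : Set ℝ≥0} (hB : MeasurableSet B) :
    timeMarginal κ hE ω B = κ ω (slice E ω ∩ B ×ˢ univ) := by
  change (((κ ω).restrict (slice E ω)).map Prod.fst) B = _
  rw [Measure.map_apply measurable_fst hB, Measure.restrict_apply (measurable_fst hB)]
  congr 1
  ext q
  simp [and_comm]

lemma IsDualPredictableProjection.lintegral_slice {Ω J : Type*} {mΩ : MeasurableSpace Ω}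
    [mJ : MeasurableSpace J] {𝓕 : Filtration ℝ≥0 mΩ} {Q : Measure Ω} {N U : Kernel Ω (ℝ≥0 × J)}
    (hU : IsDualPredictableProjection 𝓕 Q N U) {E : Set ((ℝ≥0 × Ω) × J)}
    (hE : MeasurableSet[𝓕.predictable.prod mJ] E) :
    ∫⁻ ω, N ω (slice E ω) ∂Q = ∫⁻ ω, U ω (slice E ω) ∂Q := by
  have hf : Measurable[𝓕.predictable.prod mJ] (E.indicator fun _ => (1 : ℝ≥0∞)) :=
    (@measurable_const _ _ _ (𝓕.predictable.prod mJ) 1).indicator hE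
  have h := hU.projection (fun t ω x => E.indicator (fun _ => 1) ((t, ω), x)) hf
  have hs : ∀ (κ : Kernel Ω (ℝ≥0 × J)) ω,
      ∫⁻ q, E.indicator (fun _ => (1 : ℝ≥0∞)) ((q.1, ω), q.2) ∂(κ ω) = κ ω (slice E ω) := by
    intro κ ω
    rw [← lintegral_indicator_one (measurableSet_slice (predictable_prod_le 𝓕 _ hE) ω)]
    rfl
  simpa only [hs] using h

lemma IsDualPredictableProjection.measurable_slice {Ω J : Type*} {mΩ : MeasurableSpace Ω}
    [mJ : MeasurableSpace J] {𝓕 : Filtration ℝ≥0 mΩ} {Q : Measure Ω} {N U : Kernel Ω (ℝ≥0 × J)}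
    (hU : IsDualPredictableProjection 𝓕 Q N U) {E : Set ((ℝ≥0 × Ω) × J)}
    (hE : MeasurableSet[𝓕.predictable.prod mJ] E) :
    Measurable[𝓕.predictable] fun p : ℝ≥0 × Ω => U p.2 (slice E p.2 ∩ Iic p.1 ×ˢ univ) := by
  have hf : Measurable[𝓕.predictable.prod mJ] (E.indicator fun _ => (1 : ℝ≥0∞)) :=
    (@measurable_const _ _ _ (𝓕.predictable.prod mJ) 1).indicator hE
  have h := hU.predictable (fun t ω x => E.indicator (fun _ => 1) ((t, ω), x)) hf
  have hs : ∀ p : ℝ≥0 × Ω, ∫⁻ q in Iic p.1 ×ˢ univ,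
      E.indicator (fun _ => (1 : ℝ≥0∞)) ((q.1, p.2), q.2) ∂(U p.2) =
        U p.2 (slice E p.2 ∩ Iic p.1 ×ˢ univ) := by
    intro p
    have hEm := measurableSet_slice (predictable_prod_le 𝓕 _ hE) p.2
    rw [← Measure.restrict_apply hEm, ← lintegral_indicator_one hEm]
    rfl
  simpa only [hs] using h

namespace ModuleSystem

/-! ### The compensator of one module -/

/-- The times in `(0, T]` on the level set of order `n`, with marks in `C ∩ J_V`. -/
def levelField {Ω ι J : Type*} [MeasurableSpace Ω] [MeasurableSpace J]
    (S : ModuleSystem Ω ι J) (V : ι) (n : ℕ) (C : Set J) : Set ((ℝ≥0 × Ω) × J) :=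
  (S.levelSet V n ∩ Ioc 0 S.T ×ˢ univ) ×ˢ (C ∩ S.marks V)

lemma measurableSet_levelField {Ω ι J : Type*} [MeasurableSpace Ω] [mJ : MeasurableSpace J]
    (S : ModuleSystem Ω ι J) {V : ι} (hV : MeasurableSet (S.marks V)) (n : ℕ) {C : Set J}
    (hC : MeasurableSet C) :
    MeasurableSet[(S.rawFiltration {V}).predictable.prod mJ] (S.levelField V n C) :=
  @MeasurableSet.prod _ _ (S.rawFiltration {V}).predictable mJ _ _
    ((S.measurableSet_levelSet hV n).inter
      (measurableSet_predictable_Ioc_prod 0 S.T MeasurableSet.univ)) (hC.inter hV)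

lemma slice_levelField_subset {Ω ι J : Type*} [MeasurableSpace Ω] [MeasurableSpace J]
    (S : ModuleSystem Ω ι J) (V : ι) (n : ℕ) (C : Set J) (ω : Ω) :
    slice (S.levelField V n C) ω ⊆ Ioc 0 S.T ×ˢ S.marks V :=
  fun _ hq => ⟨hq.1.2.1, hq.2.2⟩

lemma predictable_prod_mono {Ω ι J : Type*} [MeasurableSpace Ω] [mJ : MeasurableSpace J]
    (S : ModuleSystem Ω ι J) (Q : Measure Ω) {W W' : Set ι} (h : W ⊆ W') :
    (S.rawFiltration W).predictable.prod mJ ≤ (S.filtration Q W').predictable.prod mJ :=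
  sup_le_sup (MeasurableSpace.comap_mono
    (predictable_mono (S.rawFiltration_le_filtration Q h))) le_rfl

lemma IsReference.measure_slice_levelField_le {Ω ι J : Type*} [MeasurableSpace Ω]
    [MeasurableSpace J] {S : ModuleSystem Ω ι J} {Q : Measure Ω} (hQ : S.IsReference Q) (V : ι)
    (n : ℕ) (C : Set J) (ω : Ω) : S.N ω (slice (S.levelField V n C) ω) ≤ n + 1 :=
  (measure_mono fun q (hq : q ∈ slice (S.levelField V n C) ω) =>
    (⟨hq.1.1, hq.2.2⟩ : q ∈ {t | (t, ω) ∈ S.levelSet V n} ×ˢ S.marks V)).trans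
    (hQ.measure_levelSet_le V n ω)

lemma IsReference.lintegral_levelField_le {Ω ι J : Type*} [MeasurableSpace Ω]
    [MeasurableSpace J] {S : ModuleSystem Ω ι J} {Q : Measure Ω} [IsProbabilityMeasure Q]
    (hQ : S.IsReference Q) {U : Kernel Ω (ℝ≥0 × J)}
    (hU : IsDualPredictableProjection (S.filtration Q univ) Q S.N U) (V : ι) (n : ℕ) {C : Set J}
    (hC : MeasurableSet C) : ∫⁻ ω, U ω (slice (S.levelField V n C) ω) ∂Q ≤ n + 1 := by
  rw [← hU.lintegral_slice (S.predictable_prod_mono Q (subset_univ {V}) _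
    (S.measurableSet_levelField (hQ.measurableSet_marks V) n hC))]
  refine (lintegral_mono fun ω => hQ.measure_slice_levelField_le V n C ω).trans ?_
  simp

lemma slice_levelField_eq {Ω ι J : Type*} [MeasurableSpace Ω]
    [MeasurableSpace J] (S : ModuleSystem Ω ι J) (V : ι) {n : ℕ} (C : Set J) {ω : Ω}
    (h : (S.T, ω) ∈ S.levelSet V n) :
    slice (S.levelField V n C) ω = Ioc 0 S.T ×ˢ (C ∩ S.marks V) := by
  ext q
  exact ⟨fun hq => ⟨hq.1.2.1, hq.2⟩,
    fun hq => ⟨⟨S.mem_levelSet_of_le n ω _ _ hq.1.2 h, hq.1, mem_univ _⟩, hq.2⟩⟩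

lemma IsReference.ae_measure_lt_top {Ω ι J : Type*} [MeasurableSpace Ω]
    [MeasurableSpace J] {S : ModuleSystem Ω ι J} {Q : Measure Ω} [IsProbabilityMeasure Q]
    (hQ : S.IsReference Q) {U : Kernel Ω (ℝ≥0 × J)}
    (hU : IsDualPredictableProjection (S.filtration Q univ) Q S.N U) (V : ι) :
    ∀ᵐ ω ∂Q, U ω (Ioc 0 S.T ×ˢ S.marks V) < ∞ := by
  have hlev : ∀ n : ℕ, ∀ᵐ ω ∂Q, U ω (slice (S.levelField V n univ) ω) < ∞ := by
    intro n
    refine ae_lt_top ?_ ((hQ.lintegral_levelField_le hU V n MeasurableSet.univ).trans_lt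
      (by simp : (n : ℝ≥0∞) + 1 < ∞)).ne
    have h := (hU.measurable_slice (S.predictable_prod_mono Q (subset_univ {V}) _
      (S.measurableSet_levelField (hQ.measurableSet_marks V) n MeasurableSet.univ))).comp
      (measurable_prodMk_predictable _ S.T)
    have h' : Measurable fun ω =>
        U ω (slice (S.levelField V n univ) ω ∩ Iic S.T ×ˢ univ) :=
      h.mono ((S.filtration Q univ).le _) le_rfl
    convert h' using 3
    rw [eq_comm, inter_eq_left]
    exact fun q hq => ⟨hq.1.2.1.2, mem_univ _⟩
  filter_upwards [ae_all_iff.2 hlev] with ω hω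
  obtain ⟨n, hn⟩ := hQ.exists_mem_levelSet V S.T ω
  have h := hω n
  rwa [slice_levelField_eq S V univ hn, univ_inter] at h

/-- The restriction of the random measure `U` to `(0, T] × J_V`, set to `0` for the outcomes where
its mass is infinite. For a compensator these are negligible. -/
noncomputable def locComp {Ω ι J : Type*} [MeasurableSpace Ω] [MeasurableSpace J]
    (S : ModuleSystem Ω ι J) (U : Kernel Ω (ℝ≥0 × J)) {V : ι} (hV : MeasurableSet (S.marks V)) :
    Kernel Ω (ℝ≥0 × J) :=
  finitePart (U.restrict (measurableSet_Ioc.prod hV : MeasurableSet (Ioc 0 S.T ×ˢ S.marks V)))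

instance {Ω ι J : Type*} [MeasurableSpace Ω] [MeasurableSpace J]
    (S : ModuleSystem Ω ι J) (U : Kernel Ω (ℝ≥0 × J)) {V : ι} (hV : MeasurableSet (S.marks V)) :
    IsSFiniteKernel (S.locComp U hV) :=
  inferInstanceAs (IsSFiniteKernel (finitePart _))

instance {Ω ι J : Type*} [MeasurableSpace Ω] [MeasurableSpace J]
    (S : ModuleSystem Ω ι J) (U : Kernel Ω (ℝ≥0 × J)) {V : ι} (hV : MeasurableSet (S.marks V))
    (ω : Ω) : IsFiniteMeasure (S.locComp U hV ω) :=
  inferInstanceAs (IsFiniteMeasure (finitePart _ ω))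

lemma locComp_eq_restrict {Ω ι J : Type*} [MeasurableSpace Ω] [MeasurableSpace J]
    (S : ModuleSystem Ω ι J) (U : Kernel Ω (ℝ≥0 × J)) {V : ι} (hV : MeasurableSet (S.marks V))
    {ω : Ω} (h : U ω (Ioc 0 S.T ×ˢ S.marks V) < ∞) :
    S.locComp U hV ω = (U ω).restrict (Ioc 0 S.T ×ˢ S.marks V) := by
  rw [locComp, finitePart_apply_of_lt_top, Kernel.restrict_apply]
  rwa [Kernel.restrict_apply, Measure.restrict_apply_univ]

lemma locComp_apply_compl {Ω ι J : Type*} [MeasurableSpace Ω] [MeasurableSpace J]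
    (S : ModuleSystem Ω ι J) (U : Kernel Ω (ℝ≥0 × J)) {V : ι} (hV : MeasurableSet (S.marks V))
    (ω : Ω) : S.locComp U hV ω (Ioc 0 S.T ×ˢ S.marks V)ᶜ = 0 := by
  classical
  rw [locComp, finitePart, Kernel.piecewise_apply]
  split_ifs
  · rw [Kernel.restrict_apply, Measure.restrict_apply (measurableSet_Ioc.prod hV).compl,
      compl_inter_self, measure_empty]
  · simp

lemma locComp_zero {Ω ι J : Type*} [MeasurableSpace Ω] [MeasurableSpace J]
    (S : ModuleSystem Ω ι J) (U : Kernel Ω (ℝ≥0 × J)) {V : ι} (hV : MeasurableSet (S.marks V))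
    (ω : Ω) : S.locComp U hV ω ({0} ×ˢ univ) = 0 := by
  refine measure_mono_null (t := (Ioc 0 S.T ×ˢ S.marks V)ᶜ) ?_ (S.locComp_apply_compl U hV ω)
  exact fun q hq hq' => absurd hq.1 hq'.1.1.ne'

/-- The compensator of `N|_{J_V}` can be chosen predictable with respect to the history of `V`,
since the other modules are independent of `V`. This is the version on a level set. -/
lemma IsReference.exists_predictable_levelField {Ω ι J : Type*} [mΩ : MeasurableSpace Ω]
    [mJ : MeasurableSpace J] {S : ModuleSystem Ω ι J} {Q : Measure Ω} [IsProbabilityMeasure Q]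
    (hQ : S.IsReference Q) {U : Kernel Ω (ℝ≥0 × J)}
    (hU : IsDualPredictableProjection (S.filtration Q univ) Q S.N U) (V : ι) (n : ℕ) {C : Set J}
    (hC : MeasurableSet C) :
    ∃ p : ℝ≥0 × Ω → ℝ≥0∞, Measurable[(S.rawFiltration {V}).predictable] p ∧
      ∀ᵐ ω ∂Q, ∀ t ≤ S.T, p (t, ω) = S.locComp U (hQ.measurableSet_marks V) ω
        (slice (S.levelField V n C) ω ∩ Iic t ×ˢ univ) := by
  classical
  have hV := hQ.measurableSet_marks V
  set E := S.levelField V n C with hE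
  have hEr := S.measurableSet_levelField hV n hC
  have hEu := S.predictable_prod_mono Q (subset_univ {V}) _ hEr
  have hEm : MeasurableSet E := predictable_prod_le _ _ hEr
  have hae : ∀ᵐ ω ∂Q, S.locComp U hV ω = (U ω).restrict (Ioc 0 S.T ×ˢ S.marks V) :=
    (hQ.ae_measure_lt_top hU V).mono fun ω h => S.locComp_eq_restrict U hV h
  have hUE : ∀ {ω}, S.locComp U hV ω = (U ω).restrict (Ioc 0 S.T ×ˢ S.marks V) →
      ∀ {A}, A ⊆ slice E ω → S.locComp U hV ω A = U ω A := by
    intro ω h A hA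
    rw [h, Measure.restrict_eq_self _ (hA.trans (S.slice_levelField_subset V n C ω))]
  let κ : Kernel Ω ℝ≥0 := timeMarginal (S.locComp U hV) hEm
  have hκ : ∀ ω {B : Set ℝ≥0}, MeasurableSet B →
      κ ω B = S.locComp U hV ω (slice E ω ∩ B ×ˢ univ) :=
    fun ω B hB => timeMarginal_apply _ hEm ω hB
  have hκf : ∀ ω, IsFiniteMeasure (κ ω) := fun ω => ⟨by
    rw [hκ ω MeasurableSet.univ]
    exact measure_lt_top _ _⟩
  have hfin : ∫⁻ ω, κ ω univ ∂Q < ∞ := by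
    refine lt_of_le_of_lt (le_trans (lintegral_mono_ae ?_)
      (hQ.lintegral_levelField_le hU V n hC)) (by simp : (n : ℝ≥0∞) + 1 < ∞)
    filter_upwards [hae] with ω hω
    rw [hκ ω MeasurableSet.univ, hUE hω inter_subset_left]
    exact measure_mono inter_subset_left
  have h0 : ∀ ω, κ ω {0} = 0 := fun ω => by
    rw [hκ ω (measurableSet_singleton 0)]
    exact measure_mono_null inter_subset_right (S.locComp_zero U hV ω)
  -- A version of the compensator that is predictable for the joint history without null sets: only
  -- there do the two components of the information separate.
  obtain ⟨a₀, ha₀, hae₀⟩ := exists_predictable_ae_eq (𝓕 := S.rawFiltration univ) (Q := Q)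
    (hU.measurable_slice hEu)
  let a : ℝ≥0 × Ω → ℝ≥0∞ := (Ioi 0 ×ˢ univ).indicator a₀
  have ha : Measurable[(S.rawFiltration univ).predictable] a :=
    ha₀.indicator (measurableSet_predictable_Ioi_prod MeasurableSet.univ)
  have haκ : ∀ᵐ ω ∂Q, ∀ t, a (t, ω) = κ ω (Iic t) := by
    filter_upwards [hae, hae₀] with ω h1 h2 t
    rcases eq_or_ne t 0 with rfl | ht
    · have hI : (Iic 0 : Set ℝ≥0) = {0} := by
        ext
        simp
      simp [a, hI, h0]
    · have ht' : 0 < t := pos_iff_ne_zero.2 ht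
      have hmem : (t, ω) ∈ (Ioi 0 ×ˢ univ : Set (ℝ≥0 × Ω)) := ⟨ht', mem_univ _⟩
      simp only [a]
      rw [indicator_of_mem hmem, hκ ω measurableSet_Iic, hUE h1 inter_subset_left, ← h2 t ht']
  -- The expected compensator is the expected number of events, which depends on `V` only.
  let ν : ℝ≥0 → Ω → ℝ≥0∞ := fun s ω => S.N ω (slice E ω ∩ Ioi s ×ˢ univ)
  have hν : ∀ s F, MeasurableSet[S.rawFiltration univ s] F →
      ∫⁻ ω in F, κ ω (Ioi s) ∂Q = ∫⁻ ω in F, ν s ω ∂Q := by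
    intro s F hF
    have hFm : MeasurableSet F := (S.rawFiltration univ).le s _ hF
    have hEF : MeasurableSet[(S.filtration Q univ).predictable.prod mJ]
        ((Ioi s ×ˢ F) ×ˢ univ ∩ E) :=
      (@MeasurableSet.prod _ _ (S.filtration Q univ).predictable mJ _ _
        (measurableSet_predictable_Ioi_prod
          (S.rawFiltration_le_filtration Q subset_rfl s _ hF)) MeasurableSet.univ).inter hEu
    have hsl : ∀ (μ : Measure (ℝ≥0 × J)) ω, μ (slice ((Ioi s ×ˢ F) ×ˢ univ ∩ E) ω) =
        F.indicator (fun _ => μ (slice E ω ∩ Ioi s ×ˢ univ)) ω := by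
      intro μ ω
      by_cases h : ω ∈ F
      · rw [indicator_of_mem h]
        congr 1
        ext q
        simp [slice, h, and_comm]
      · rw [indicator_of_notMem h]
        have : slice ((Ioi s ×ˢ F) ×ˢ univ ∩ E) ω = ∅ :=
          eq_empty_of_forall_notMem fun q hq => h hq.1.1.2
        rw [this, measure_empty]
    rw [← lintegral_indicator hFm, ← lintegral_indicator hFm]
    calc ∫⁻ ω, F.indicator (fun ω => κ ω (Ioi s)) ω ∂Q
        = ∫⁻ ω, U ω (slice ((Ioi s ×ˢ F) ×ˢ univ ∩ E) ω) ∂Q := by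
          refine lintegral_congr_ae ?_
          filter_upwards [hae] with ω hω
          rw [hsl, indicator_apply, indicator_apply, hκ ω measurableSet_Ioi,
            hUE hω inter_subset_left]
      _ = ∫⁻ ω, S.N ω (slice ((Ioi s ×ˢ F) ×ˢ univ ∩ E) ω) ∂Q := (hU.lintegral_slice hEF).symm
      _ = ∫⁻ ω, F.indicator (ν s) ω ∂Q := lintegral_congr fun ω => hsl (S.N ω) ω
  have hmV := S.historySigma_le hQ.measurableSet_marks {V}
  -- The number of events is a function of `N|_{J_V}`; `N` is replaced by this restriction, which
  -- is a kernel for the history of `V`.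
  have hνm : ∀ s, Measurable[S.historySigma {V}] (ν s) := by
    intro s
    let NV : @Kernel Ω (ℝ≥0 × J) (S.historySigma {V}) _ :=
      @Kernel.mk Ω (ℝ≥0 × J) (S.historySigma {V}) _
        (fun ω => (S.N ω).restrict (univ ×ˢ S.marks V))
        (Measurable.of_comap_le (le_sup_of_le_right (le_iSup₂_of_le V rfl le_rfl)))
    have hs : @IsSFiniteKernel Ω (ℝ≥0 × J) (S.historySigma {V}) _ NV :=
      @isSFiniteKernel_of_forall_lt_top Ω (ℝ≥0 × J) (S.historySigma {V}) _ NV fun ω => by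
        have := hQ.isFiniteMeasure_N ω
        exact measure_lt_top ((S.N ω).restrict (univ ×ˢ S.marks V)) univ
    have hle : @Prod.instMeasurableSpace (ℝ≥0 × Ω) J (S.rawFiltration {V}).predictable mJ ≤
        @Prod.instMeasurableSpace (ℝ≥0 × Ω) J
          (@Prod.instMeasurableSpace ℝ≥0 Ω _ (S.historySigma {V})) mJ :=
      sup_le_sup (MeasurableSpace.comap_mono
        (predictable_le_prod_of_le (S.rawFiltration_le_historySigma {V}))) le_rfl
    have hEs : @MeasurableSet _ (@Prod.instMeasurableSpace (ℝ≥0 × Ω) J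
          (@Prod.instMeasurableSpace ℝ≥0 Ω _ (S.historySigma {V})) mJ)
        ((Ioi s ×ˢ univ) ×ˢ univ ∩ E) :=
      hle _ ((@MeasurableSet.prod _ _ (S.rawFiltration {V}).predictable mJ _ _
        (measurableSet_predictable_Ioi_prod MeasurableSet.univ) MeasurableSet.univ).inter hEr)
    have hfin := @measurable_measure_slice Ω J (S.historySigma {V}) mJ NV hs _ hEs
    convert hfin using 1
    funext ω
    change S.N ω _ = (S.N ω).restrict (univ ×ˢ S.marks V) _
    rw [Measure.restrict_eq_self]
    · congr 1
      ext q
      simp [slice, and_comm]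
    · exact fun q hq => ⟨mem_univ _, hq.2.2.2⟩
  obtain ⟨p, hp, hpκ⟩ := exists_predictable_version_of_indep (Q := Q)
    (S.rawFiltration_mono (subset_univ {V})) (S.rawFiltration_univ_le V) hmV
    (S.historySigma_le hQ.measurableSet_marks {V}ᶜ) (S.rawFiltration_le_historySigma {V})
    (S.rawFiltration_le_historySigma {V}ᶜ) (hQ.indep_historySigma V) hfin h0 ha haκ (by
      intro s F₁ F₂ hF₁ hF₂
      have hF₁u := S.rawFiltration_mono (subset_univ {V}) s _ hF₁
      have hF₂u := S.rawFiltration_mono (subset_univ {V}ᶜ) s _ hF₂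
      have hF₁m : MeasurableSet F₁ := (S.rawFiltration univ).le s _ hF₁u
      have hF₂m : MeasurableSet F₂ := (S.rawFiltration univ).le s _ hF₂u
      have hi₁ : Measurable[S.historySigma {V}] (F₁.indicator (ν s)) :=
        (hνm s).indicator (S.rawFiltration_le_historySigma {V} s _ hF₁)
      have hi₂ : Measurable[S.historySigma {V}ᶜ] (F₂.indicator (1 : Ω → ℝ≥0∞)) :=
        (@measurable_const ℝ≥0∞ Ω _ (S.historySigma {V}ᶜ) 1).indicator
          (S.rawFiltration_le_historySigma {V}ᶜ s _ hF₂)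
      rw [hν s _ (hF₁u.inter hF₂u), hν s _ hF₁u, ← lintegral_indicator (hF₁m.inter hF₂m),
        ← lintegral_indicator hF₁m, ← lintegral_indicator_one hF₂m,
        ← lintegral_mul_eq_lintegral_mul_lintegral_of_independent_measurableSpace hmV
          (S.historySigma_le hQ.measurableSet_marks {V}ᶜ) (hQ.indep_historySigma V) hi₁ hi₂]
      refine lintegral_congr fun ω => ?_
      by_cases h1 : ω ∈ F₁ <;> by_cases h2 : ω ∈ F₂ <;> simp [h1, h2]) S.T
  refine ⟨p, hp, ?_⟩
  filter_upwards [hpκ] with ω hω t ht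
  rw [hω t ht, hκ ω measurableSet_Iic]

/-- Integrals of predictable fields against the compensator of `N|_{J_V}` are predictable with
respect to every history that contains the one of `V`. -/
theorem IsReference.exists_predictable_compensator_lintegral {Ω ι J : Type*}
    [mΩ : MeasurableSpace Ω] [mJ : MeasurableSpace J] {S : ModuleSystem Ω ι J} {Q : Measure Ω}
    [IsProbabilityMeasure Q] (hQ : S.IsReference Q) {U : Kernel Ω (ℝ≥0 × J)}
    (hU : IsDualPredictableProjection (S.filtration Q univ) Q S.N U) {V : ι} {W : Set ι}
    (hVW : V ∈ W) {G : (ℝ≥0 × Ω) × J → ℝ≥0∞}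
    (hG : Measurable[(S.filtration Q W).predictable.prod mJ] G) :
    ∃ p : ℝ≥0 × Ω → ℝ≥0∞, Measurable[(S.filtration Q W).predictable] p ∧
      ∀ᵐ ω ∂Q, ∀ t ≤ S.T, p (t, ω) = ∫⁻ q in Iic t ×ˢ univ, G ((q.1, ω), q.2)
        ∂(S.locComp U (hQ.measurableSet_marks V) ω) := by
  have hV := hQ.measurableSet_marks V
  refine exists_predictable_lintegral (S.locComp_zero U hV) (fun C hC => ?_) hG
  choose p hp hpκ using fun n => hQ.exists_predictable_levelField hU V n hC
  refine ⟨fun x => ⨆ n, p n x, Measurable.iSup fun n => (hp n).mono (predictable_mono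
    (S.rawFiltration_le_filtration Q (singleton_subset_iff.2 hVW))) le_rfl, ?_⟩
  filter_upwards [ae_all_iff.2 hpκ] with ω hω t ht
  have hcompl := S.locComp_apply_compl U hV ω
  refine le_antisymm (iSup_le fun n => ?_) ?_
  · rw [hω n t ht]
    exact measure_mono fun q hq => ⟨hq.2.1, hq.1.2.1⟩
  · obtain ⟨n, hn⟩ := hQ.exists_mem_levelSet V S.T ω
    refine le_iSup_of_le n ?_
    rw [hω n t ht, slice_levelField_eq S V C hn]
    refine (measure_mono (t := (Ioc 0 S.T ×ˢ (C ∩ S.marks V) ∩ Iic t ×ˢ univ) ∪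
      (Ioc 0 S.T ×ˢ S.marks V)ᶜ) fun q hq => ?_).trans
      ((measure_union_le _ _).trans (by rw [hcompl, add_zero]))
    by_cases h : q ∈ Ioc 0 S.T ×ˢ S.marks V
    · exact Or.inl ⟨⟨h.1, hq.2, h.2⟩, hq.1, mem_univ _⟩
    · exact Or.inr h

end ModuleSystem

/-! ### Paths given by integrals -/

lemma isFiniteMeasure_withDensity_map_fst {J : Type*} [MeasurableSpace J]
    {μ : Measure (ℝ≥0 × J)} {f : ℝ≥0 × J → ℝ} (hint : Integrable f μ) :
    IsFiniteMeasure ((μ.withDensity fun q => ENNReal.ofReal (f q)).map Prod.fst) := by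
  have := isFiniteMeasure_withDensity_ofReal hint.2
  infer_instance

lemma integral_withDensity_map_fst {J : Type*} [MeasurableSpace J] {μ : Measure (ℝ≥0 × J)}
    {f : ℝ≥0 × J → ℝ} (hf : Measurable f) {k : ℝ≥0 → ℝ} (hk : Measurable k) (t : ℝ≥0) :
    ∫ s in Ioc 0 t, k s ∂((μ.withDensity fun q => ENNReal.ofReal (f q)).map Prod.fst) =
      ∫ q in Ioc 0 t ×ˢ univ, k q.1 * max (f q) 0 ∂μ := by
  rw [setIntegral_map measurableSet_Ioc hk.aestronglyMeasurable measurable_fst.aemeasurable,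
    ← prod_univ, restrict_withDensity (measurableSet_Ioc.prod MeasurableSet.univ),
    integral_withDensity_eq_integral_toReal_smul hf.ennreal_ofReal
      (ae_of_all _ fun _ => ENNReal.ofReal_lt_top)]
  refine integral_congr_ae (ae_of_all _ fun q => ?_)
  simp only [smul_eq_mul, ENNReal.toReal_ofReal']
  exact mul_comm _ _

/-- The path `t ↦ c + ∫_{(0, t] × J} f dμ` is of finite variation, and Stieltjes integrals against
it are integrals against `f dμ`. -/
lemma isFiniteVariationPath_and_stieltjesIntegral_eq {J : Type*} [MeasurableSpace J]
    {μ : Measure (ℝ≥0 × J)} {f : ℝ≥0 × J → ℝ} (hf : Measurable f) (hint : Integrable f μ)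
    {T : ℝ≥0} {F : ℝ≥0 → ℝ} (hF : ∀ t ≤ T, F t = F 0 + ∫ q in Ioc 0 t ×ˢ univ, f q ∂μ) :
    IsFiniteVariationPath T F ∧
      ∀ k : ℝ≥0 → ℝ, Measurable k → (∃ C : ℝ, ∀ s, |k s| ≤ C) →
        stieltjesIntegral T k F = ∫ q in Ioc 0 T ×ˢ univ, k q.1 * f q ∂μ := by
  have h1 := isFiniteMeasure_withDensity_map_fst hint
  have h2 := isFiniteMeasure_withDensity_map_fst hint.neg
  set μ₁ := (μ.withDensity fun q => ENNReal.ofReal (f q)).map Prod.fst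
  set μ₂ := (μ.withDensity fun q => ENNReal.ofReal ((-f) q)).map Prod.fst
  have hkey : ∀ k : ℝ≥0 → ℝ, Measurable k → (∃ C : ℝ, ∀ s, |k s| ≤ C) → ∀ t,
      ∫ s in Ioc 0 t, k s ∂μ₁ - ∫ s in Ioc 0 t, k s ∂μ₂ =
        ∫ q in Ioc 0 t ×ˢ univ, k q.1 * f q ∂μ := by
    rintro k hk ⟨C, hC⟩ t
    have hi : ∀ {g : ℝ≥0 × J → ℝ}, Integrable g μ →
        IntegrableOn (fun q => k q.1 * max (g q) 0) (Ioc 0 t ×ˢ univ) μ := fun hg =>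
      (hg.pos_part.bdd_mul (hk.comp measurable_fst).aestronglyMeasurable
        (ae_of_all _ fun q => hC q.1)).integrableOn
    rw [integral_withDensity_map_fst hf hk, integral_withDensity_map_fst hf.neg hk,
      ← integral_sub (hi hint) (hi hint.neg)]
    refine integral_congr_ae (ae_of_all _ fun q => ?_)
    simp only [Pi.neg_apply]
    rw [← mul_sub]
    congr 1
    rcases le_total 0 (f q) with h | h
    · rw [max_eq_left h, max_eq_right (by linarith), sub_zero]
    · rw [max_eq_right h, max_eq_left (by linarith), zero_sub, neg_neg]
  have hpath : IsDistributionPath T F μ₁ μ₂ := by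
    intro t ht
    have := hkey (fun _ => 1) measurable_const ⟨1, by simp⟩ t
    simp only [one_mul, setIntegral_const, smul_eq_mul, mul_one] at this
    rw [hF t ht, ← this]
    ring
  refine ⟨hpath.isFiniteVariationPath, fun k hk hC => ?_⟩
  obtain ⟨C, hC'⟩ := hC
  rw [hpath.stieltjesIntegral_eq (integrable_of_abs_le hk hC').integrableOn
    (integrable_of_abs_le hk hC').integrableOn]
  exact hkey k hk ⟨C, hC'⟩ T

lemma stieltjesIntegral_sub {T : ℝ≥0} {F G k : ℝ≥0 → ℝ} (hF : IsFiniteVariationPath T F)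
    (hG : IsFiniteVariationPath T G) (hk : Measurable k) (hC : ∃ C : ℝ, ∀ s, |k s| ≤ C) :
    IsFiniteVariationPath T (fun t => F t - G t) ∧
    stieltjesIntegral T k (fun t => F t - G t) =
      stieltjesIntegral T k F - stieltjesIntegral T k G := by
  obtain ⟨μ₁, μ₂, _, _, h⟩ := hF.exists_isDistributionPath
  obtain ⟨ν₁, ν₂, _, _, h'⟩ := hG.exists_isDistributionPath
  obtain ⟨C, hC⟩ := hC
  have hi : ∀ (μ : Measure ℝ≥0) [IsFiniteMeasure μ], IntegrableOn k (Ioc 0 T) μ :=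
    fun μ _ => (integrable_of_abs_le hk hC).integrableOn
  refine ⟨(h.sub h').isFiniteVariationPath, ?_⟩
  rw [(h.sub h').stieltjesIntegral_eq (hi _) (hi _), h.stieltjesIntegral_eq (hi _) (hi _),
    h'.stieltjesIntegral_eq (hi _) (hi _), Measure.restrict_add, Measure.restrict_add,
    integral_add_measure (hi _) (hi _), integral_add_measure (hi _) (hi _)]
  ring

/-- A random measure puts mass at most `2 c` on the times up to which its mass is at most `c`. -/
lemma measure_setOf_measure_Iic_le (μ : Measure ℝ≥0) [IsFiniteMeasure μ] (c : ℝ≥0∞) :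
    μ {t | μ (Iic t) ≤ c} ≤ 2 * c := by
  set I := {t | μ (Iic t) ≤ c}
  have hI : MeasurableSet I :=
    measurableSet_le (Monotone.measurable fun s t hst => measure_mono (Iic_subset_Iic.2 hst))
      measurable_const
  have h := lintegral_measure_Iic_add_lintegral_measure_Iio (μ.restrict I) (μ.restrict I)
  rw [Measure.restrict_apply_univ] at h
  have hle : ∀ A : ℝ≥0 → Set ℝ≥0, (∀ s, A s ⊆ Iic s) →
      ∫⁻ s, (μ.restrict I) (A s) ∂(μ.restrict I) ≤ c * μ I := by
    intro A hA
    rw [← setLIntegral_const]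
    refine setLIntegral_mono measurable_const fun s hs => ?_
    exact (Measure.restrict_apply_le _ _).trans ((measure_mono (hA s)).trans hs)
  have h1 : μ I * μ I ≤ 2 * c * μ I := by
    rw [← h, mul_assoc, two_mul]
    exact add_le_add (hle _ fun s => subset_rfl) (hle _ fun s => Iio_subset_Iic_self)
  rcases eq_or_ne (μ I) 0 with h0 | h0
  · rw [h0]
    exact zero_le
  · exact (ENNReal.mul_le_mul_iff_left h0 (measure_ne_top μ I)).1 h1

/-! ### Measures on fields -/

/-- The measure `E ↦ E_P[κ(E)]` on the space of times, outcomes and marks. -/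
noncomputable def fieldMeasure {Ω J : Type*} [MeasurableSpace Ω] [MeasurableSpace J]
    (P : Measure Ω) (κ : Kernel Ω (ℝ≥0 × J)) : Measure ((ℝ≥0 × Ω) × J) :=
  (P ⊗ₘ κ).map fun x => ((x.2.1, x.1), x.2.2)

lemma measurable_swap_field {Ω J : Type*} [MeasurableSpace Ω] [MeasurableSpace J] :
    Measurable fun x : Ω × (ℝ≥0 × J) => ((x.2.1, x.1), x.2.2) := by
  fun_prop

lemma lintegral_fieldMeasure {Ω J : Type*} [MeasurableSpace Ω] [MeasurableSpace J]
    {P : Measure Ω} [SFinite P] {κ : Kernel Ω (ℝ≥0 × J)} [IsSFiniteKernel κ]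
    {f : (ℝ≥0 × Ω) × J → ℝ≥0∞} (hf : Measurable f) :
    ∫⁻ z, f z ∂(fieldMeasure P κ) = ∫⁻ ω, ∫⁻ q, f ((q.1, ω), q.2) ∂(κ ω) ∂P := by
  rw [fieldMeasure, lintegral_map hf measurable_swap_field,
    Measure.lintegral_compProd (f := fun x : Ω × (ℝ≥0 × J) => f ((x.2.1, x.1), x.2.2))
      (hf.comp measurable_swap_field)]

lemma fieldMeasure_apply {Ω J : Type*} [MeasurableSpace Ω] [MeasurableSpace J]
    {P : Measure Ω} [SFinite P] {κ : Kernel Ω (ℝ≥0 × J)} [IsSFiniteKernel κ]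
    {E : Set ((ℝ≥0 × Ω) × J)} (hE : MeasurableSet E) :
    fieldMeasure P κ E = ∫⁻ ω, κ ω (slice E ω) ∂P := by
  rw [fieldMeasure, Measure.map_apply measurable_swap_field hE,
    Measure.compProd_apply (measurable_swap_field hE)]
  rfl

lemma integral_fieldMeasure {Ω J : Type*} [MeasurableSpace Ω] [MeasurableSpace J]
    {P : Measure Ω} [SFinite P] {κ : Kernel Ω (ℝ≥0 × J)} [IsSFiniteKernel κ]
    {f : (ℝ≥0 × Ω) × J → ℝ} (hf : Measurable f) (hint : Integrable f (fieldMeasure P κ)) :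
    (∀ᵐ ω ∂P, Integrable (fun q => f ((q.1, ω), q.2)) (κ ω)) ∧
      Integrable (fun ω => ∫ q, f ((q.1, ω), q.2) ∂(κ ω)) P ∧
      ∫ z, f z ∂(fieldMeasure P κ) = ∫ ω, ∫ q, f ((q.1, ω), q.2) ∂(κ ω) ∂P := by
  have hint' : Integrable (fun x : Ω × (ℝ≥0 × J) => f ((x.2.1, x.1), x.2.2)) (P ⊗ₘ κ) :=
    (integrable_map_measure hf.aestronglyMeasurable measurable_swap_field.aemeasurable).1 hint
  refine ⟨((Measure.integrable_compProd_iff hint'.1).1 hint').1,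
    MeasureTheory.Integrable.integral_compProd (a := ()) (κ := Kernel.const Unit P)
      (η := Kernel.prodMkLeft Unit κ) hint', ?_⟩
  rw [fieldMeasure, integral_map measurable_swap_field.aemeasurable hf.aestronglyMeasurable,
    Measure.integral_compProd hint']

/-- If `ρ` is a density of `M₁` relative to `M₂` on a sub-σ-algebra, then it is so for the integrals
of all functions that are measurable for the sub-σ-algebra. -/
lemma integral_eq_of_trim_eq {Z : Type*} {m m₀ : MeasurableSpace Z} (hm : m ≤ m₀)
    {M₁ M₂ : Measure Z} {ρ : Z → ℝ≥0∞} (hρ : Measurable ρ) (hρfin : ∀ᵐ z ∂M₂, ρ z < ∞)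
    (h : M₁.trim hm = (M₂.withDensity ρ).trim hm) {f : Z → ℝ} (hf : Measurable[m] f)
    (hint : Integrable f M₁) :
    Integrable (fun z => f z * (ρ z).toReal) M₂ ∧
      ∫ z, f z ∂M₁ = ∫ z, f z * (ρ z).toReal ∂M₂ := by
  have hs : StronglyMeasurable[m] f := Measurable.stronglyMeasurable hf
  have hi : Integrable f (M₂.withDensity ρ) := by
    refine integrable_of_integrable_trim hm ?_
    rw [← h]
    exact hint.trim hm hs
  refine ⟨?_, ?_⟩
  · have := (integrable_withDensity_iff hρ hρfin).1 hi
    exact this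
  · rw [integral_trim hm hs, h, ← integral_trim hm hs,
      integral_withDensity_eq_integral_toReal_smul hρ hρfin]
    refine integral_congr_ae (ae_of_all _ fun z => ?_)
    simp only [smul_eq_mul]
    exact mul_comm _ _

lemma withDensity_trim {Z : Type*} {m m₀ : MeasurableSpace Z} (hm : m ≤ m₀) {M : Measure Z}
    {ρ : Z → ℝ≥0∞} (hρ : Measurable[m] ρ) :
    (M.withDensity ρ).trim hm = (M.trim hm).withDensity ρ := by
  refine @Measure.ext _ m _ _ fun s hs => ?_
  rw [trim_measurableSet_eq hm hs, withDensity_apply _ (hm s hs), @withDensity_apply _ m _ _ _ hs,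
    restrict_trim hm _ hs, lintegral_trim hm hρ]

namespace ModuleSystem

/-! ### The density of the events relative to the compensator -/

/-- The restriction of `N` to `(0, T] × J_V`. -/
noncomputable def locN {Ω ι J : Type*} [MeasurableSpace Ω] [MeasurableSpace J]
    (S : ModuleSystem Ω ι J) {V : ι} (hV : MeasurableSet (S.marks V)) : Kernel Ω (ℝ≥0 × J) :=
  S.N.restrict (measurableSet_Ioc.prod hV : MeasurableSet (Ioc 0 S.T ×ˢ S.marks V))

lemma locN_apply {Ω ι J : Type*} [MeasurableSpace Ω] [MeasurableSpace J]
    (S : ModuleSystem Ω ι J) {V : ι} (hV : MeasurableSet (S.marks V)) (ω : Ω) :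
    S.locN hV ω = (S.N ω).restrict (Ioc 0 S.T ×ˢ S.marks V) :=
  Kernel.restrict_apply _ _ _

lemma IsReference.isFiniteMeasure_locN {Ω ι J : Type*} [MeasurableSpace Ω] [MeasurableSpace J]
    {S : ModuleSystem Ω ι J} {Q : Measure Ω} (hQ : S.IsReference Q) {V : ι}
    (hV : MeasurableSet (S.marks V)) (ω : Ω) : IsFiniteMeasure (S.locN hV ω) := by
  have := hQ.isFiniteMeasure_N ω
  rw [locN_apply]
  infer_instance

lemma IsReference.isSFiniteKernel_locN {Ω ι J : Type*} [MeasurableSpace Ω] [MeasurableSpace J]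
    {S : ModuleSystem Ω ι J} {Q : Measure Ω} (hQ : S.IsReference Q) {V : ι}
    (hV : MeasurableSet (S.marks V)) : IsSFiniteKernel (S.locN hV) :=
  isSFiniteKernel_of_forall_lt_top _ fun ω =>
    have := hQ.isFiniteMeasure_locN hV ω
    measure_lt_top _ _

lemma IsReference.ae_locComp_eq {Ω ι J : Type*} [MeasurableSpace Ω]
    [MeasurableSpace J] {S : ModuleSystem Ω ι J} {Q : Measure Ω} [IsProbabilityMeasure Q]
    (hQ : S.IsReference Q) {U : Kernel Ω (ℝ≥0 × J)}
    (hU : IsDualPredictableProjection (S.filtration Q univ) Q S.N U) (V : ι) :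
    ∀ᵐ ω ∂Q, S.locComp U (hQ.measurableSet_marks V) ω =
      (U ω).restrict (Ioc 0 S.T ×ˢ S.marks V) :=
  (hQ.ae_measure_lt_top hU V).mono fun _ h => S.locComp_eq_restrict U _ h

/-- A predictable field that the compensator does not charge is not charged by `N|_{J_V}` either,
under `P` as well as under `Q`. Since the `P`-null set where the compensator charges the field may
have positive `Q`-measure, the field is first cut off when the compensator starts to charge it. -/
lemma IsReference.fieldMeasure_locN_eq_zero {Ω ι J : Type*} [mΩ : MeasurableSpace Ω]
    [mJ : MeasurableSpace J] {S : ModuleSystem Ω ι J} {Q P : Measure Ω} [IsProbabilityMeasure Q]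
    [IsProbabilityMeasure P] (hQ : S.IsReference Q) (hPQ : P ≪ Q) {U : Kernel Ω (ℝ≥0 × J)}
    (hU : IsDualPredictableProjection (S.filtration Q univ) Q S.N U) (V : ι)
    {E : Set ((ℝ≥0 × Ω) × J)} (hE : MeasurableSet[(S.filtration Q univ).predictable.prod mJ] E)
    (h0 : fieldMeasure P (S.locComp U (hQ.measurableSet_marks V)) E = 0) :
    fieldMeasure P (S.locN (hQ.measurableSet_marks V)) E = 0 := by
  have hV := hQ.measurableSet_marks V
  have hsN := hQ.isSFiniteKernel_locN hV
  have hEm := predictable_prod_le _ _ hE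
  rw [fieldMeasure_apply hEm, lintegral_eq_zero_iff (measurable_measure_slice hEm)] at h0
  rw [fieldMeasure_apply hEm, lintegral_eq_zero_iff (measurable_measure_slice hEm)]
  let E' : Set ((ℝ≥0 × Ω) × J) := E ∩ (Ioc 0 S.T ×ˢ univ) ×ˢ S.marks V
  have hE' : MeasurableSet[(S.filtration Q univ).predictable.prod mJ] E' :=
    hE.inter (@MeasurableSet.prod _ _ (S.filtration Q univ).predictable mJ _ _
      (measurableSet_predictable_Ioc_prod 0 S.T MeasurableSet.univ) hV)
  have hsl : ∀ ω, slice E ω ∩ Ioc 0 S.T ×ˢ S.marks V = slice E' ω := by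
    intro ω
    ext q
    simp [slice, E']
  have hUp : ∀ᵐ ω ∂P, U ω (slice E' ω) = 0 := by
    filter_upwards [h0, hPQ.ae_le (hQ.ae_locComp_eq hU V)] with ω h1 h2
    rwa [h2, Measure.restrict_apply (measurableSet_slice hEm ω), hsl] at h1
  -- The predictable set of times up to which the compensator does not charge `E'`; for `P`-almost
  -- all paths it consists of all times.
  let R : Set (ℝ≥0 × Ω) := {p | U p.2 (slice E' p.2 ∩ Iic p.1 ×ˢ univ) = 0}
  have hR : MeasurableSet[(S.filtration Q univ).predictable] R :=
    hU.measurable_slice hE' (measurableSet_singleton 0)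
  have hE'' : MeasurableSet[(S.filtration Q univ).predictable.prod mJ] (E' ∩ R ×ˢ univ) :=
    hE'.inter (@MeasurableSet.prod _ _ (S.filtration Q univ).predictable mJ _ _ hR
      MeasurableSet.univ)
  have hzero : ∫⁻ ω, S.N ω (slice (E' ∩ R ×ˢ univ) ω) ∂Q = 0 := by
    rw [hU.lintegral_slice hE'']
    refine lintegral_eq_zero_of_ae_eq_zero ?_
    filter_upwards [hQ.ae_measure_lt_top hU V] with ω hω
    have hE'm := measurableSet_slice (predictable_prod_le _ _ hE') ω
    let μ : Measure ℝ≥0 := ((U ω).restrict (slice E' ω)).map Prod.fst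
    have hμ : ∀ {B : Set ℝ≥0}, MeasurableSet B → μ B = U ω (slice E' ω ∩ B ×ˢ univ) := by
      intro B hB
      rw [Measure.map_apply measurable_fst hB, Measure.restrict_apply (measurable_fst hB),
        inter_comm, prod_univ]
    have hfin : IsFiniteMeasure μ := ⟨by
      rw [hμ MeasurableSet.univ]
      exact (measure_mono fun q hq => hq.1.2).trans_lt (lt_of_le_of_lt (measure_mono
        (fun q (hq : q ∈ {q : ℝ≥0 × J | ((q.1, ω), q.2) ∈ (Ioc 0 S.T ×ˢ univ) ×ˢ S.marks V}) =>
          (⟨hq.1.1, hq.2⟩ : q ∈ Ioc 0 S.T ×ˢ S.marks V))) hω)⟩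
    have hI : MeasurableSet {t | μ (Iic t) ≤ 0} :=
      measurableSet_le (Monotone.measurable fun s t hst => measure_mono (Iic_subset_Iic.2 hst))
        measurable_const
    have h := measure_setOf_measure_Iic_le μ 0
    rw [mul_zero, nonpos_iff_eq_zero, hμ hI] at h
    have hsub : slice (E' ∩ R ×ˢ univ) ω ⊆ slice E' ω ∩ {t | μ (Iic t) ≤ 0} ×ˢ univ := by
      intro q hq
      have h2 : U ω (slice E' ω ∩ Iic q.1 ×ˢ univ) = 0 := hq.2.1
      have h3 : μ (Iic q.1) ≤ 0 := by rw [hμ measurableSet_Iic, h2]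
      exact ⟨hq.1, h3, mem_univ _⟩
    exact measure_mono_null hsub h
  have hsE'' : Measurable fun ω => S.locN hV ω (slice (E' ∩ R ×ˢ univ) ω) :=
    measurable_measure_slice (predictable_prod_le _ _ hE'')
  have hlocN : ∀ ω, S.locN hV ω (slice (E' ∩ R ×ˢ univ) ω) ≤
      S.N ω (slice (E' ∩ R ×ˢ univ) ω) := fun ω => by
    rw [locN_apply]
    exact Measure.restrict_apply_le _ _
  have hNQ : ∀ᵐ ω ∂Q, S.locN hV ω (slice (E' ∩ R ×ˢ univ) ω) = 0 :=
    (lintegral_eq_zero_iff hsE'').1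
      (nonpos_iff_eq_zero.1 ((lintegral_mono hlocN).trans hzero.le))
  filter_upwards [hPQ.ae_le hNQ, hUp] with ω h1 h2
  have hRω : slice (E' ∩ R ×ˢ univ) ω = slice E' ω := by
    ext q
    refine ⟨fun hq => hq.1, fun hq => ⟨hq, ?_, mem_univ _⟩⟩
    exact measure_mono_null inter_subset_left h2
  rw [hRω, locN_apply, Measure.restrict_apply
    (measurableSet_slice (predictable_prod_le _ _ hE') ω)] at h1
  change S.locN hV ω (slice E ω) = 0
  rw [locN_apply, Measure.restrict_apply (measurableSet_slice hEm ω), hsl]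
  rwa [← hsl, inter_assoc, inter_self, hsl] at h1

lemma IsReference.fieldMeasure_locN_levelSet_le {Ω ι J : Type*} [MeasurableSpace Ω]
    [MeasurableSpace J] {S : ModuleSystem Ω ι J} {Q P : Measure Ω}
    [IsProbabilityMeasure P] (hQ : S.IsReference Q) (V : ι) (n : ℕ) :
    fieldMeasure P (S.locN (hQ.measurableSet_marks V)) (S.levelSet V n ×ˢ univ) ≤ n + 1 := by
  have hV := hQ.measurableSet_marks V
  have hsN := hQ.isSFiniteKernel_locN hV
  have hL : MeasurableSet (S.levelSet V n) :=
    predictable_le_prod _ _ (S.measurableSet_levelSet hV n)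
  have hEm : MeasurableSet (S.levelSet V n ×ˢ (univ : Set J)) := hL.prod MeasurableSet.univ
  rw [fieldMeasure_apply hEm]
  refine (lintegral_mono (g := fun _ => (n : ℝ≥0∞) + 1) fun ω => ?_).trans (by simp)
  rw [locN_apply, Measure.restrict_apply (measurableSet_slice hEm ω)]
  refine (measure_mono fun q hq => ?_).trans (hQ.measure_levelSet_le V n ω)
  exact ⟨hq.1.1, hq.2.2⟩

lemma IsReference.iUnion_levelSet {Ω ι J : Type*} [MeasurableSpace Ω] [MeasurableSpace J]
    {S : ModuleSystem Ω ι J} {Q : Measure Ω} (hQ : S.IsReference Q) (V : ι) :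
    ⋃ n, S.levelSet V n = univ :=
  eq_univ_of_forall fun p => mem_iUnion.2 (hQ.exists_mem_levelSet V p.1 p.2)

lemma IsReference.sigmaFinite_trim_locN {Ω ι J : Type*} [MeasurableSpace Ω]
    [mJ : MeasurableSpace J] {S : ModuleSystem Ω ι J} {Q P : Measure Ω}
    [IsProbabilityMeasure P] (hQ : S.IsReference Q) {V : ι} {W : Set ι} (hVW : V ∈ W) :
    SigmaFinite ((fieldMeasure P (S.locN (hQ.measurableSet_marks V))).trim
      (predictable_prod_le (J := J) (S.filtration Q W))) := by
  have hV := hQ.measurableSet_marks V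
  have hm : ∀ n, MeasurableSet[(S.filtration Q W).predictable.prod mJ]
      (S.levelSet V n ×ˢ (univ : Set J)) := fun n =>
    @MeasurableSet.prod _ _ (S.filtration Q W).predictable mJ _ _
      (predictable_mono (S.rawFiltration_le_filtration Q (singleton_subset_iff.2 hVW)) _
        (S.measurableSet_levelSet hV n)) MeasurableSet.univ
  refine ⟨⟨⟨fun n => S.levelSet V n ×ˢ univ, fun n => mem_univ _, fun n => ?_, ?_⟩⟩⟩
  · rw [trim_measurableSet_eq _ (hm n)]
    exact (hQ.fieldMeasure_locN_levelSet_le V n).trans_lt (by simp)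
  · rw [← iUnion_prod_const, hQ.iUnion_levelSet V, univ_prod_univ]

/-- The expected compensator is σ-finite on the predictable fields: the times up to which its mass
is at most `n` form a predictable set. -/
lemma IsReference.sigmaFinite_trim_locComp {Ω ι J : Type*} [MeasurableSpace Ω]
    [mJ : MeasurableSpace J] {S : ModuleSystem Ω ι J} {Q P : Measure Ω} [IsProbabilityMeasure Q]
    [IsProbabilityMeasure P] (hQ : S.IsReference Q) (hPQ : P ≪ Q) {U : Kernel Ω (ℝ≥0 × J)}
    (hU : IsDualPredictableProjection (S.filtration Q univ) Q S.N U) {V : ι} {W : Set ι}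
    (hVW : V ∈ W) :
    SigmaFinite ((fieldMeasure P (S.locComp U (hQ.measurableSet_marks V))).trim
      (predictable_prod_le (J := J) (S.filtration Q W))) := by
  have hV := hQ.measurableSet_marks V
  obtain ⟨p, hp, hpU⟩ := hQ.exists_predictable_compensator_lintegral hU hVW
    (G := fun _ => 1) (@measurable_const _ _ _ ((S.filtration Q W).predictable.prod mJ) 1)
  -- The infinite values of `p` form a negligible set, which is added to make the sets exhaustive.
  let R : ℕ → Set (ℝ≥0 × Ω) := fun n => p ⁻¹' (Iic n ∪ {∞})
  have hm : ∀ n, MeasurableSet[(S.filtration Q W).predictable.prod mJ]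
      (R n ×ˢ (univ : Set J)) := fun n =>
    @MeasurableSet.prod _ _ (S.filtration Q W).predictable mJ _ _
      (hp (measurableSet_Iic.union (measurableSet_singleton ∞))) MeasurableSet.univ
  refine ⟨⟨⟨fun n => R n ×ˢ univ, fun n => mem_univ _, fun n => ?_, ?_⟩⟩⟩
  · have hEm := predictable_prod_le _ _ (hm n)
    rw [trim_measurableSet_eq _ (hm n), fieldMeasure_apply hEm]
    refine lt_of_le_of_lt (lintegral_mono_ae (g := fun _ => 2 * (n : ℝ≥0∞)) ?_) ?_
    · filter_upwards [hPQ.ae_le hpU] with ω hω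
      let K : Measure (ℝ≥0 × J) := S.locComp U hV ω
      let μ : Measure ℝ≥0 := K.map Prod.fst
      have hI : MeasurableSet {t | μ (Iic t) ≤ n} :=
        measurableSet_le (Monotone.measurable fun s t hst => measure_mono (Iic_subset_Iic.2 hst))
          measurable_const
      have h1 := measure_setOf_measure_Iic_le μ n
      rw [Measure.map_apply measurable_fst hI] at h1
      refine le_trans ?_ h1
      refine (measure_mono (t := Prod.fst ⁻¹' {t | μ (Iic t) ≤ n} ∪
        (Ioc 0 S.T ×ˢ S.marks V)ᶜ) fun q hq => ?_).trans ((measure_union_le _ _).trans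
          (by rw [S.locComp_apply_compl U hV ω, add_zero]))
      by_cases hqT : q ∈ Ioc 0 S.T ×ˢ S.marks V
      · left
        have hpq : p (q.1, ω) = μ (Iic q.1) := by
          rw [hω q.1 hqT.1.2, Measure.map_apply measurable_fst measurableSet_Iic, prod_univ,
            setLIntegral_one]
        have hne : p (q.1, ω) ≠ ∞ := by
          rw [hpq]
          exact measure_ne_top _ _
        rcases hq.1 with h | h
        · have h' : p (q.1, ω) ≤ n := h
          rwa [hpq] at h'
        · exact absurd h hne
      · exact Or.inr hqT
    · simp only [lintegral_const, measure_univ, mul_one]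
      exact ENNReal.mul_lt_top (by simp) (by simp)
  · rw [← iUnion_prod_const]
    have : ⋃ n, R n = univ := by
      refine eq_univ_of_forall fun x => mem_iUnion.2 ?_
      by_cases h : p x = ∞
      · exact ⟨0, Or.inr h⟩
      · obtain ⟨n, hn⟩ := ENNReal.exists_nat_gt h
        exact ⟨n, Or.inl hn.le⟩
    rw [this, univ_prod_univ]

/-- On the predictable fields of a history that contains the one of `V`, the events of `N|_{J_V}`
have a density under `P` relative to the compensator. -/
theorem IsReference.exists_density {Ω ι J : Type*} [MeasurableSpace Ω]
    [mJ : MeasurableSpace J] {S : ModuleSystem Ω ι J} {Q P : Measure Ω} [IsProbabilityMeasure Q]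
    [IsProbabilityMeasure P] (hQ : S.IsReference Q) (hPQ : P ≪ Q) {U : Kernel Ω (ℝ≥0 × J)}
    (hU : IsDualPredictableProjection (S.filtration Q univ) Q S.N U) {V : ι} {W : Set ι}
    (hVW : V ∈ W) :
    ∃ ρ : (ℝ≥0 × Ω) × J → ℝ≥0∞, Measurable[(S.filtration Q W).predictable.prod mJ] ρ ∧
      (∀ᵐ z ∂(fieldMeasure P (S.locComp U (hQ.measurableSet_marks V))), ρ z < ∞) ∧
      (fieldMeasure P (S.locN (hQ.measurableSet_marks V))).trim
          (predictable_prod_le (J := J) (S.filtration Q W)) =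
        ((fieldMeasure P (S.locComp U (hQ.measurableSet_marks V))).withDensity ρ).trim
          (predictable_prod_le (J := J) (S.filtration Q W)) := by
  have hV := hQ.measurableSet_marks V
  have hle := predictable_prod_le (J := J) (S.filtration Q W)
  have h1 := hQ.sigmaFinite_trim_locN (P := P) hVW
  have h2 := hQ.sigmaFinite_trim_locComp hPQ hU hVW
  -- The two measures are compared on the σ-algebra of the predictable fields, where both are
  -- σ-finite.
  set μ := (fieldMeasure P (S.locN hV)).trim hle
  set ν := (fieldMeasure P (S.locComp U hV)).trim hle
  have hac : μ ≪ ν := by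
    refine @Measure.AbsolutelyContinuous.mk _ ((S.filtration Q W).predictable.prod mJ) _ _
      fun E hE hE0 => ?_
    rw [trim_measurableSet_eq hle hE] at hE0 ⊢
    refine hQ.fieldMeasure_locN_eq_zero hPQ hU V ?_ hE0
    exact sup_le_sup (MeasurableSpace.comap_mono
      (predictable_mono (S.filtration_mono Q (subset_univ W)))) le_rfl E hE
  refine ⟨μ.rnDeriv ν, Measure.measurable_rnDeriv μ ν,
    ae_of_ae_trim hle (Measure.rnDeriv_lt_top μ ν), ?_⟩
  rw [withDensity_trim hle (Measure.measurable_rnDeriv μ ν)]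
  exact (Measure.withDensity_rnDeriv_eq μ ν hac).symm

/-! ### Integral processes -/

lemma locComp_ae_mem {Ω ι J : Type*} [MeasurableSpace Ω] [MeasurableSpace J]
    (S : ModuleSystem Ω ι J) (U : Kernel Ω (ℝ≥0 × J)) {V : ι} (hV : MeasurableSet (S.marks V))
    (ω : Ω) : ∀ᵐ q ∂(S.locComp U hV ω), q ∈ Ioc 0 S.T ×ˢ S.marks V :=
  S.locComp_apply_compl U hV ω

/-- Integrals of predictable fields against the compensator of `N|_{J_V}` form a predictable
process with paths of finite variation. -/
lemma IsReference.exists_predictable_integral_path {Ω ι J : Type*} [MeasurableSpace Ω]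
    [mJ : MeasurableSpace J] {S : ModuleSystem Ω ι J} {Q P : Measure Ω} [IsProbabilityMeasure Q]
    (hQ : S.IsReference Q) (hPQ : P ≪ Q) {U : Kernel Ω (ℝ≥0 × J)}
    (hU : IsDualPredictableProjection (S.filtration Q univ) Q S.N U) {V : ι} {W : Set ι}
    (hVW : V ∈ W) {f : (ℝ≥0 × Ω) × J → ℝ}
    (hf : Measurable[(S.filtration Q W).predictable.prod mJ] f)
    (hint : ∀ᵐ ω ∂P, Integrable (fun q => f ((q.1, ω), q.2))
      (S.locComp U (hQ.measurableSet_marks V) ω)) :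
    ∃ A : ℝ≥0 → Ω → ℝ, IsPredictable (S.filtration Q W) A ∧
      ∀ᵐ ω ∂P, ∀ t ≤ S.T, A t ω = A 0 ω +
        ∫ q in Ioc 0 t ×ˢ univ, f ((q.1, ω), q.2) ∂(S.locComp U (hQ.measurableSet_marks V) ω) := by
  have hV := hQ.measurableSet_marks V
  obtain ⟨p, hp, hpU⟩ := hQ.exists_predictable_compensator_lintegral hU hVW
    (G := fun z => ENNReal.ofReal (f z)) hf.ennreal_ofReal
  obtain ⟨r, hr, hrU⟩ := hQ.exists_predictable_compensator_lintegral hU hVW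
    (G := fun z => ENNReal.ofReal (-f z)) hf.neg.ennreal_ofReal
  refine ⟨fun t ω => (p (t, ω)).toReal - (r (t, ω)).toReal,
    hp.ennreal_toReal.sub hr.ennreal_toReal, ?_⟩
  filter_upwards [hint, hPQ.ae_le hpU, hPQ.ae_le hrU] with ω h1 h2 h3
  have key : ∀ t ≤ S.T, (p (t, ω)).toReal - (r (t, ω)).toReal =
      ∫ q in Ioc 0 t ×ˢ univ, f ((q.1, ω), q.2) ∂(S.locComp U hV ω) := by
    intro t ht
    rw [h2 t ht, h3 t ht, ← integral_eq_lintegral_pos_part_sub_lintegral_neg_part h1.integrableOn]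
    refine setIntegral_congr_set ?_
    filter_upwards [S.locComp_ae_mem U hV ω] with q hq
    refine propext ⟨fun h => ⟨⟨hq.1.1, h.1⟩, h.2⟩, fun h => ⟨h.1.2, h.2⟩⟩
  intro t ht
  rw [key t ht, key 0 zero_le]
  simp

lemma HasModuleForm.stieltjesIntegral_eq {Ω ι J : Type*} [MeasurableSpace Ω]
    [MeasurableSpace J] {S : ModuleSystem Ω ι J} {Q : Measure Ω} (hQ : S.IsReference Q) {V : ι}
    {X : ℝ≥0 → Ω → ℝ} {g : ℝ≥0 → Ω → J → ℝ} (hg : IsPredictableField (S.rawFiltration {V}) g)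
    (hC : ∃ C : ℝ, ∀ s ω x, |g s ω x| ≤ C)
    (hX : ∀ t ≤ S.T, ∀ ω,
      X t ω = S.init V ω + ∫ q in Ioc 0 t ×ˢ S.marks V, g q.1 ω q.2 ∂(S.N ω))
    (ω : Ω) {k : ℝ≥0 → ℝ} (hk : Measurable k) (hkC : ∃ C : ℝ, ∀ s, |k s| ≤ C) :
    stieltjesIntegral S.T k (fun t => X t ω) =
      ∫ q in Ioc 0 S.T ×ˢ S.marks V, k q.1 * g q.1 ω q.2 ∂(S.N ω) := by
  have hV := hQ.measurableSet_marks V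
  have := hQ.isFiniteMeasure_N ω
  obtain ⟨C, hC⟩ := hC
  have hgm : Measurable fun q : ℝ≥0 × J => g q.1 ω q.2 :=
    (Measurable.mono hg (predictable_prod_le _) le_rfl).comp (measurable_slice_map ω)
  have hr : ∀ t (f : ℝ≥0 × J → ℝ), ∫ q in Ioc 0 t ×ˢ univ, f q
      ∂((S.N ω).restrict (univ ×ˢ S.marks V)) = ∫ q in Ioc 0 t ×ˢ S.marks V, f q ∂(S.N ω) := by
    intro t f
    rw [Measure.restrict_restrict (measurableSet_Ioc.prod MeasurableSet.univ), prod_inter_prod,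
      inter_univ, univ_inter]
  rw [(isFiniteVariationPath_and_stieltjesIntegral_eq
    (μ := (S.N ω).restrict (univ ×ˢ S.marks V)) hgm
    (Integrable.of_bound hgm.aestronglyMeasurable C (ae_of_all _ fun q => hC _ _ _))
    (F := fun t => X t ω) (fun t ht => ?_)).2 k hk hkC, hr]
  rw [hr, hX t ht, hX 0 zero_le]
  simp

/-- Bounded test fields that vanish off a level set satisfy the integrability condition. -/
lemma IsReference.lintegral_enorm_lt_top {Ω ι J : Type*} [MeasurableSpace Ω]
    [MeasurableSpace J] {S : ModuleSystem Ω ι J} {Q P : Measure Ω} [IsProbabilityMeasure P]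
    (hQ : S.IsReference Q) (V : ι) {h : ℝ≥0 → Ω → J → ℝ} {C : ℝ}
    (hC : ∀ s ω x, |h s ω x| ≤ C) {n : ℕ}
    (hn : ∀ s ω x, (s, ω) ∉ S.levelSet V n → h s ω x = 0) :
    ∫⁻ ω, ∫⁻ q in Ioc 0 S.T ×ˢ S.marks V, ‖h q.1 ω q.2‖ₑ ∂(S.N ω) ∂P < ∞ := by
  have hV := hQ.measurableSet_marks V
  refine lt_of_le_of_lt (lintegral_mono (g := fun _ => ENNReal.ofReal C * (n + 1)) fun ω => ?_) ?_
  · have hm : MeasurableSet ({t | (t, ω) ∈ S.levelSet V n} ×ˢ S.marks V) :=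
      (S.measurableSet_levelSet_prod hV n ω).prod hV
    calc ∫⁻ q in Ioc 0 S.T ×ˢ S.marks V, ‖h q.1 ω q.2‖ₑ ∂(S.N ω)
        ≤ ∫⁻ q in Ioc 0 S.T ×ˢ S.marks V,
            ({t | (t, ω) ∈ S.levelSet V n} ×ˢ S.marks V).indicator
              (fun _ => ENNReal.ofReal C) q ∂(S.N ω) := by
          refine setLIntegral_mono (measurable_const.indicator hm) fun q hq => ?_
          by_cases hL : (q.1, ω) ∈ S.levelSet V n
          · rw [indicator_of_mem (show q ∈ {t | (t, ω) ∈ S.levelSet V n} ×ˢ S.marks V from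
              ⟨hL, hq.2⟩), Real.enorm_eq_ofReal_abs]
            exact ENNReal.ofReal_le_ofReal (hC _ _ _)
          · rw [hn _ _ _ hL, enorm_zero]
            exact zero_le
      _ ≤ ∫⁻ q, ({t | (t, ω) ∈ S.levelSet V n} ×ˢ S.marks V).indicator
              (fun _ => ENNReal.ofReal C) q ∂(S.N ω) := setLIntegral_le_lintegral _ _
      _ = ENNReal.ofReal C * S.N ω ({t | (t, ω) ∈ S.levelSet V n} ×ˢ S.marks V) := by
          rw [lintegral_indicator hm, setLIntegral_const]
      _ ≤ ENNReal.ofReal C * (n + 1) := by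
          gcongr
          exact hQ.measure_levelSet_le V n ω
  · simp only [lintegral_const, measure_univ, mul_one]
    exact ENNReal.mul_lt_top ENNReal.ofReal_lt_top (by simp)

lemma IsReference.integrable_fieldMeasure_locN {Ω ι J : Type*} [MeasurableSpace Ω]
    [MeasurableSpace J] {S : ModuleSystem Ω ι J} {Q P : Measure Ω} [IsProbabilityMeasure P]
    (hQ : S.IsReference Q) (V : ι) {h : (ℝ≥0 × Ω) × J → ℝ} (hh : Measurable h)
    (hfin : ∫⁻ ω, ∫⁻ q in Ioc 0 S.T ×ˢ S.marks V, ‖h ((q.1, ω), q.2)‖ₑ ∂(S.N ω) ∂P < ∞) :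
    Integrable h (fieldMeasure P (S.locN (hQ.measurableSet_marks V))) ∧
      ∫ z, h z ∂(fieldMeasure P (S.locN (hQ.measurableSet_marks V))) =
        ∫ ω, ∫ q in Ioc 0 S.T ×ˢ S.marks V, h ((q.1, ω), q.2) ∂(S.N ω) ∂P := by
  have hV := hQ.measurableSet_marks V
  have hsN := hQ.isSFiniteKernel_locN hV
  have hi : Integrable h (fieldMeasure P (S.locN hV)) := by
    refine ⟨hh.aestronglyMeasurable, ?_⟩
    rw [HasFiniteIntegral, lintegral_fieldMeasure hh.enorm]
    simpa only [locN_apply] using hfin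
  refine ⟨hi, ?_⟩
  rw [(integral_fieldMeasure hh hi).2.2]
  simp only [locN_apply]

/-! ### From an intensity to local independence -/

/-- The compensator of `∫ g dN` is `∫ g λ dU`. -/
theorem IsIntensity.locIndepFollowUp {Ω ι J : Type*} [MeasurableSpace Ω]
    [mJ : MeasurableSpace J] {S : ModuleSystem Ω ι J} {Q P : Measure Ω} [IsProbabilityMeasure Q]
    [IsProbabilityMeasure P] (hQ : S.IsReference Q) (hPQ : P ≪ Q) {U : Kernel Ω (ℝ≥0 × J)}
    (hU : IsDualPredictableProjection (S.filtration Q univ) Q S.N U) {V : ι} {B V' : Set ι}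
    {lam : ℝ≥0 → Ω → J → ℝ} (h : S.IsIntensity Q P U V B V' lam) :
    S.LocIndepFollowUp Q P V B V' := by
  have hV := hQ.measurableSet_marks V
  rintro X ⟨g, hg, ⟨Cg, hCg⟩, hX⟩
  have hK := hPQ.ae_le (hQ.ae_locComp_eq hU V)
  have hgW : ∀ W : Set ι, V ∈ W → IsPredictableField (S.filtration Q W) g := fun W hW =>
    Measurable.mono hg (S.predictable_prod_mono Q (singleton_subset_iff.2 hW)) le_rfl
  have hmem : ∀ A : Set ι, V ∈ {V} ∪ A := fun A => Or.inl rfl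
  -- The level sets as test fields show that the intensity is integrable for almost every path.
  have hlam : ∀ᵐ ω ∂P, Integrable (fun q : ℝ≥0 × J => lam q.1 ω q.2) (S.locComp U hV ω) := by
    have hn : ∀ n : ℕ, ∀ᵐ ω ∂P, IntegrableOn (fun q : ℝ≥0 × J =>
        (S.levelSet V n).indicator (fun _ => (1 : ℝ)) (q.1, ω) * lam q.1 ω q.2)
        (Ioc 0 S.T ×ˢ S.marks V) (U ω) := by
      intro n
      have hL : MeasurableSet[(S.filtration Q ({V} ∪ V')).predictable] (S.levelSet V n) :=
        predictable_mono (S.rawFiltration_le_filtration Q (singleton_subset_iff.2 (hmem V'))) _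
          (S.measurableSet_levelSet hV n)
      have hm : Measurable[(S.filtration Q ({V} ∪ V')).predictable]
          ((S.levelSet V n).indicator fun _ => (1 : ℝ)) :=
        (@measurable_const _ _ _ (S.filtration Q ({V} ∪ V')).predictable (1 : ℝ)).indicator hL
      have hb : ∀ (s : ℝ≥0) (ω : Ω) (_ : J),
          |(S.levelSet V n).indicator (fun _ => (1 : ℝ)) (s, ω)| ≤ 1 := by
        intro s ω _
        by_cases hs : (s, ω) ∈ S.levelSet V n <;> simp [hs]
      refine (h.expectation (fun s ω _ => (S.levelSet V n).indicator (fun _ => 1) (s, ω))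
        (hm.comp (@measurable_fst _ _ (S.filtration Q ({V} ∪ V')).predictable mJ))
        ⟨1, hb⟩ (hQ.lintegral_enorm_lt_top V hb (n := n) ?_)).1
      intro s ω _ hs
      exact indicator_of_notMem hs _
    filter_upwards [ae_all_iff.2 hn, hK] with ω h1 h2
    obtain ⟨n, hn⟩ := hQ.exists_mem_levelSet V S.T ω
    rw [h2]
    refine (h1 n).congr_fun_ae ?_
    filter_upwards [ae_restrict_mem (measurableSet_Ioc.prod hV)] with q hq
    have : (q.1, ω) ∈ S.levelSet V n := S.mem_levelSet_of_le n ω _ _ hq.1.2 hn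
    rw [indicator_of_mem this, one_mul]
  let f : (ℝ≥0 × Ω) × J → ℝ := fun z => g z.1.1 z.1.2 z.2 * lam z.1.1 z.1.2 z.2
  have hf : Measurable[(S.filtration Q ({V} ∪ (V' \ B))).predictable.prod mJ] f :=
    Measurable.mul (hgW _ (hmem _)) h.predictable
  have hfm : ∀ ω, Measurable fun q : ℝ≥0 × J => f ((q.1, ω), q.2) := fun ω =>
    (hf.mono (predictable_prod_le _) le_rfl).comp (measurable_slice_map ω)
  have hgm : ∀ ω, Measurable fun q : ℝ≥0 × J => g q.1 ω q.2 := fun ω =>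
    (Measurable.mono hg (predictable_prod_le _) le_rfl).comp (measurable_slice_map ω)
  have hint : ∀ᵐ ω ∂P, Integrable (fun q => f ((q.1, ω), q.2)) (S.locComp U hV ω) := by
    filter_upwards [hlam] with ω hω
    exact hω.bdd_mul (hgm ω).aestronglyMeasurable (ae_of_all _ fun q => hCg _ _ _)
  -- the candidate compensator `∫ g λ dU`
  obtain ⟨A, hA, hpath⟩ := hQ.exists_predictable_integral_path hPQ hU (hmem _) hf hint
  refine ⟨A, hA, ?_, fun k hk ⟨C, hC⟩ hfin => ?_⟩
  · filter_upwards [hint, hpath] with ω h1 h2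
    exact (isFiniteVariationPath_and_stieltjesIntegral_eq (hfm ω) h1 h2).1
  have hA' : (fun ω => stieltjesIntegral S.T (fun s => k s ω) (fun s => A s ω)) =ᵐ[P] fun ω =>
      ∫ q in Ioc 0 S.T ×ˢ S.marks V, k q.1 ω * g q.1 ω q.2 * lam q.1 ω q.2 ∂(U ω) := by
    filter_upwards [hint, hpath, hK] with ω h1 h2 h3
    rw [(isFiniteVariationPath_and_stieltjesIntegral_eq (hfm ω) h1 h2).2 _
      (IsPredictable.measurable_path hk ω) ⟨C, fun s => hC s ω⟩, h3,
      Measure.restrict_restrict (measurableSet_Ioc.prod MeasurableSet.univ), prod_inter_prod,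
      inter_self, univ_inter]
    simp only [f, mul_assoc]
  have hX' : ∀ ω, stieltjesIntegral S.T (fun s => k s ω) (fun s => X s ω) =
      ∫ q in Ioc 0 S.T ×ˢ S.marks V, k q.1 ω * g q.1 ω q.2 ∂(S.N ω) := fun ω =>
    HasModuleForm.stieltjesIntegral_eq hQ hg ⟨Cg, hCg⟩ hX ω (IsPredictable.measurable_path hk ω)
      ⟨C, fun s => hC s ω⟩
  have hkg : IsPredictableField (S.filtration Q ({V} ∪ V')) fun s ω x => k s ω * g s ω x :=
    Measurable.mul (Measurable.comp hk
      (@measurable_fst _ _ (S.filtration Q ({V} ∪ V')).predictable mJ)) (hgW _ (hmem _))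
  obtain ⟨-, h2, h3⟩ := h.expectation _ hkg ⟨C * Cg, fun s ω x => by
      rw [abs_mul]
      exact mul_le_mul (hC s ω) (hCg s ω x) (abs_nonneg _) ((abs_nonneg _).trans (hC s ω))⟩ (by
    have hb : ∀ ω, ∫⁻ q in Ioc 0 S.T ×ˢ S.marks V, ‖k q.1 ω * g q.1 ω q.2‖ₑ ∂(S.N ω) ≤
        ENNReal.ofReal Cg * ∫⁻ q in Ioc 0 S.T ×ˢ S.marks V, ‖k q.1 ω‖ₑ ∂(S.N ω) := by
      intro ω
      rw [← lintegral_const_mul' _ _ ENNReal.ofReal_ne_top]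
      refine lintegral_mono fun q => ?_
      rw [enorm_mul, mul_comm, Real.enorm_eq_ofReal_abs (g _ _ _)]
      gcongr
      exact hCg _ _ _
    refine (lintegral_mono hb).trans_lt ?_
    rw [lintegral_const_mul' _ _ ENNReal.ofReal_ne_top]
    exact ENNReal.mul_lt_top ENNReal.ofReal_lt_top hfin)
  refine ⟨h2.congr hA'.symm, ?_⟩
  rw [integral_congr_ae hA', ← h3]
  exact integral_congr_ae (ae_of_all _ hX')

/-! ### From local independence to an intensity -/

/-- A density `ρ` on the fields of a history is integrable for almost every path. -/
lemma IsReference.integrable_density {Ω ι J : Type*} [MeasurableSpace Ω]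
    [mJ : MeasurableSpace J] {S : ModuleSystem Ω ι J} {Q P : Measure Ω}
    [IsProbabilityMeasure P] (hQ : S.IsReference Q) {U : Kernel Ω (ℝ≥0 × J)} {V : ι} {W : Set ι}
    (hVW : V ∈ W) {ρ : (ℝ≥0 × Ω) × J → ℝ≥0∞}
    (hρ : Measurable[(S.filtration Q W).predictable.prod mJ] ρ)
    (hρfin : ∀ᵐ z ∂(fieldMeasure P (S.locComp U (hQ.measurableSet_marks V))), ρ z < ∞)
    (htr : (fieldMeasure P (S.locN (hQ.measurableSet_marks V))).trim
        (predictable_prod_le (J := J) (S.filtration Q W)) =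
      ((fieldMeasure P (S.locComp U (hQ.measurableSet_marks V))).withDensity ρ).trim
        (predictable_prod_le (J := J) (S.filtration Q W))) :
    (∀ n, Integrable (fun z => (S.levelSet V n ×ˢ univ).indicator (fun _ => (1 : ℝ)) z *
      (ρ z).toReal) (fieldMeasure P (S.locComp U (hQ.measurableSet_marks V)))) ∧
    ∀ᵐ ω ∂P, Integrable (fun q => (ρ ((q.1, ω), q.2)).toReal)
      (S.locComp U (hQ.measurableSet_marks V) ω) := by
  have hV := hQ.measurableSet_marks V
  have hle := predictable_prod_le (J := J) (S.filtration Q W)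
  have hρ' : Measurable ρ := hρ.mono hle le_rfl
  have hL : ∀ n, MeasurableSet[(S.filtration Q W).predictable.prod mJ]
      (S.levelSet V n ×ˢ (univ : Set J)) := fun n =>
    @MeasurableSet.prod _ _ (S.filtration Q W).predictable mJ _ _
      (predictable_mono (S.rawFiltration_le_filtration Q (singleton_subset_iff.2 hVW)) _
        (S.measurableSet_levelSet hV n)) MeasurableSet.univ
  have h1 : ∀ n, Integrable (fun z => (S.levelSet V n ×ˢ univ).indicator (fun _ => (1 : ℝ)) z *
      (ρ z).toReal) (fieldMeasure P (S.locComp U hV)) := by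
    intro n
    refine (integral_eq_of_trim_eq hle hρ' hρfin htr ((@measurable_const _ _ _
      ((S.filtration Q W).predictable.prod mJ) (1 : ℝ)).indicator (hL n)) ?_).1
    refine (integrable_indicator_iff (hle _ (hL n))).2 (integrableOn_const ?_)
    exact ((hQ.fieldMeasure_locN_levelSet_le V n).trans_lt (by simp)).ne
  refine ⟨h1, ?_⟩
  have h2 : ∀ n, ∀ᵐ ω ∂P, Integrable (fun q : ℝ≥0 × J => (S.levelSet V n ×ˢ univ).indicator
      (fun _ => (1 : ℝ)) ((q.1, ω), q.2) * (ρ ((q.1, ω), q.2)).toReal) (S.locComp U hV ω) :=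
    fun n => (integral_fieldMeasure ((measurable_const.indicator (hle _ (hL n))).mul
      hρ'.ennreal_toReal) (h1 n)).1
  filter_upwards [ae_all_iff.2 h2] with ω hω
  obtain ⟨n, hn⟩ := hQ.exists_mem_levelSet V S.T ω
  refine (hω n).congr ?_
  filter_upwards [S.locComp_ae_mem U hV ω] with q hq
  have : ((q.1, ω), q.2) ∈ S.levelSet V n ×ˢ (univ : Set J) :=
    ⟨S.mem_levelSet_of_le n ω _ _ hq.1.2 hn, mem_univ _⟩
  rw [indicator_of_mem this, one_mul]

/-- The density of the events relative to the compensator on the history of `{V} ∪ (V' ∖ B)` gives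
the compensators of the counting processes with marks in `C` for that history. Local independence
says that they are compensators for the history of `{V} ∪ V'` as well. -/
lemma LocIndepFollowUp.integral_mark_eq {Ω ι J : Type*} [MeasurableSpace Ω]
    [mJ : MeasurableSpace J] {S : ModuleSystem Ω ι J} {Q P : Measure Ω} [IsProbabilityMeasure Q]
    [IsProbabilityMeasure P] (hQ : S.IsReference Q) (hPQ : P ≪ Q) {U : Kernel Ω (ℝ≥0 × J)}
    (hU : IsDualPredictableProjection (S.filtration Q univ) Q S.N U) {V : ι} {B V' : Set ι}
    (hloc : S.LocIndepFollowUp Q P V B V') {ρ : (ℝ≥0 × Ω) × J → ℝ≥0∞}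
    (hρ : Measurable[(S.filtration Q ({V} ∪ (V' \ B))).predictable.prod mJ] ρ)
    (hρfin : ∀ᵐ z ∂(fieldMeasure P (S.locComp U (hQ.measurableSet_marks V))), ρ z < ∞)
    (htr : (fieldMeasure P (S.locN (hQ.measurableSet_marks V))).trim
        (predictable_prod_le (J := J) (S.filtration Q ({V} ∪ (V' \ B)))) =
      ((fieldMeasure P (S.locComp U (hQ.measurableSet_marks V))).withDensity ρ).trim
        (predictable_prod_le (J := J) (S.filtration Q ({V} ∪ (V' \ B)))))
    {C : Set J} (hC : MeasurableSet C) {k : ℝ≥0 → Ω → ℝ}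
    (hk : IsPredictable (S.filtration Q ({V} ∪ V')) k) {c : ℝ} (hkc : ∀ s ω, |k s ω| ≤ c) {n : ℕ}
    (hkn : ∀ s ω, (s, ω) ∉ S.levelSet V n → k s ω = 0) :
    ∫ ω, ∫ q, k q.1 ω * C.indicator (fun _ => 1) q.2 ∂(S.locN (hQ.measurableSet_marks V) ω) ∂P =
      ∫ ω, ∫ q, k q.1 ω * (C.indicator (fun _ => 1) q.2 * (ρ ((q.1, ω), q.2)).toReal)
        ∂(S.locComp U (hQ.measurableSet_marks V) ω) ∂P := by
  have hV := hQ.measurableSet_marks V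
  set W₀ : Set ι := {V} ∪ (V' \ B)
  have hVW₀ : V ∈ W₀ := Or.inl rfl
  have hW : W₀ ⊆ {V} ∪ V' := union_subset_union_right _ sdiff_subset
  have hle := predictable_prod_le (J := J) (S.filtration Q W₀)
  have hρ' : Measurable ρ := hρ.mono hle le_rfl
  have hsN := hQ.isSFiniteKernel_locN hV
  have hpm : (S.filtration Q W₀).predictable ≤ (S.filtration Q ({V} ∪ V')).predictable :=
    predictable_mono (S.filtration_mono Q hW)
  let χ : J → ℝ := C.indicator fun _ => 1
  have hχ : Measurable χ := measurable_const.indicator hC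
  have hχb : ∀ x, |χ x| ≤ 1 := fun x => by
    by_cases hx : x ∈ C <;> simp [χ, hx]
  -- the process that counts the events with marks in `C`
  have hg : IsPredictableField (S.rawFiltration {V}) fun _ _ x => χ x :=
    hχ.comp (@measurable_snd _ _ (S.rawFiltration {V}).predictable mJ)
  let X : ℝ≥0 → Ω → ℝ := fun t ω =>
    S.init V ω + ∫ q in Ioc 0 t ×ˢ S.marks V, χ q.2 ∂(S.N ω)
  have hX : ∀ t ≤ S.T, ∀ ω, X t ω = S.init V ω + ∫ q in Ioc 0 t ×ˢ S.marks V, χ q.2 ∂(S.N ω) :=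
    fun _ _ _ => rfl
  obtain ⟨Λ, hΛ, hΛfv, hΛint⟩ := hloc X ⟨fun _ _ x => χ x, hg, ⟨1, fun _ _ => hχb⟩, hX⟩
  have hXst : ∀ {u : ℝ≥0 → Ω → ℝ}, IsPredictable (S.filtration Q ({V} ∪ V')) u →
      (∃ c : ℝ, ∀ s ω, |u s ω| ≤ c) → ∀ ω,
      stieltjesIntegral S.T (fun s => u s ω) (fun s => X s ω) =
        ∫ q, u q.1 ω * χ q.2 ∂(S.locN hV ω) := by
    rintro u hu ⟨c, hc⟩ ω
    rw [HasModuleForm.stieltjesIntegral_eq hQ hg ⟨1, fun _ _ => hχb⟩ hX ω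
      (IsPredictable.measurable_path hu ω) ⟨c, fun s => hc s ω⟩, locN_apply]
  have hfinite : ∀ {u : ℝ≥0 → Ω → ℝ} {c : ℝ}, (∀ s ω, |u s ω| ≤ c) → ∀ {m : ℕ},
      (∀ s ω, (s, ω) ∉ S.levelSet V m → u s ω = 0) →
      ∫⁻ ω, ∫⁻ q in Ioc 0 S.T ×ˢ S.marks V, ‖u q.1 ω‖ₑ ∂(S.N ω) ∂P < ∞ := fun hc _ hm =>
    hQ.lintegral_enorm_lt_top V (h := fun s ω _ => _) (fun s ω _ => hc s ω) fun s ω _ => hm s ω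
  -- the compensator given by the density
  let f : (ℝ≥0 × Ω) × J → ℝ := fun z => χ z.2 * (ρ z).toReal
  have hf : Measurable[(S.filtration Q W₀).predictable.prod mJ] f :=
    Measurable.mul (hχ.comp (@measurable_snd _ _ (S.filtration Q W₀).predictable mJ))
      hρ.ennreal_toReal
  have hfm : ∀ ω, Measurable fun q : ℝ≥0 × J => f ((q.1, ω), q.2) := fun ω =>
    (hf.mono hle le_rfl).comp (measurable_slice_map ω)
  have hfint : ∀ᵐ ω ∂P, Integrable (fun q => f ((q.1, ω), q.2)) (S.locComp U hV ω) := by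
    filter_upwards [(hQ.integrable_density hVW₀ hρ hρfin htr).2] with ω hω
    exact hω.bdd_mul (hχ.comp measurable_snd).aestronglyMeasurable (ae_of_all _ fun q => hχb _)
  obtain ⟨A, hA, hpath⟩ := hQ.exists_predictable_integral_path hPQ hU hVW₀ hf hfint
  have hfull : ∀ ω (F : ℝ≥0 × J → ℝ), ∫ q in Ioc 0 S.T ×ˢ univ, F q ∂(S.locComp U hV ω) =
      ∫ q, F q ∂(S.locComp U hV ω) := by
    intro ω F
    rw [Measure.restrict_eq_self_of_ae_mem]
    filter_upwards [S.locComp_ae_mem U hV ω] with q hq using ⟨hq.1, mem_univ _⟩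
  have hAst : ∀ {G : ℝ≥0 → Ω → ℝ} {ω}, Integrable (fun q => f ((q.1, ω), q.2))
      (S.locComp U hV ω) → (∀ t ≤ S.T, G t ω = G 0 ω +
        ∫ q in Ioc 0 t ×ˢ univ, f ((q.1, ω), q.2) ∂(S.locComp U hV ω)) →
      IsFiniteVariationPath S.T (fun t => G t ω) ∧ ∀ u : ℝ≥0 → ℝ, Measurable u →
        (∃ c : ℝ, ∀ s, |u s| ≤ c) → stieltjesIntegral S.T u (fun t => G t ω) =
          ∫ q, u q.1 * f ((q.1, ω), q.2) ∂(S.locComp U hV ω) := by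
    intro G ω h1 h2
    obtain ⟨h3, h4⟩ := isFiniteVariationPath_and_stieltjesIntegral_eq (hfm ω) h1 h2
    exact ⟨h3, fun u hu hc => by rw [h4 u hu hc, hfull]⟩
  -- Both compensators are predictable for the small history, hence they agree.
  have huniq : ∀ᵐ ω ∂P, ∀ t ≤ S.T, Λ t ω - A t ω = Λ 0 ω - A 0 ω := by
    refine eq_initial_of_integral_stieltjesIntegral_eq_zero (D := fun t ω => Λ t ω - A t ω)
      (𝓕 := S.filtration Q W₀) (Measurable.sub hΛ hA) ?_ (L := S.levelSet V)
      (fun m => predictable_mono (S.rawFiltration_le_filtration Q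
        (singleton_subset_iff.2 hVW₀)) _ (S.measurableSet_levelSet hV m))
      (fun m ω s t hst h => S.mem_levelSet_of_le m ω s t hst h)
      (hQ.exists_mem_levelSet V S.T) ?_
    · filter_upwards [hΛfv, hfint, hpath] with ω h1 h2 h3
      exact (stieltjesIntegral_sub h1 (hAst h2 h3).1 (measurable_const (a := (0 : ℝ)))
        ⟨0, by simp⟩).1
    · rintro u hu ⟨c, hc⟩ ⟨m, hm⟩
      have hu' : IsPredictable (S.filtration Q ({V} ∪ V')) u := Measurable.mono hu hpm le_rfl
      obtain ⟨i1, e1⟩ := hΛint u hu' ⟨c, hc⟩ (hfinite hc hm)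
      let F : (ℝ≥0 × Ω) × J → ℝ := fun z => u z.1.1 z.1.2 * χ z.2
      have hF : Measurable[(S.filtration Q W₀).predictable.prod mJ] F :=
        Measurable.mul (Measurable.comp hu
          (@measurable_fst _ _ (S.filtration Q W₀).predictable mJ))
          (hχ.comp (@measurable_snd _ _ (S.filtration Q W₀).predictable mJ))
      have hFm : Measurable F := hF.mono hle le_rfl
      obtain ⟨j1, j2⟩ := hQ.integrable_fieldMeasure_locN (P := P) V hFm
        (hQ.lintegral_enorm_lt_top V (h := fun s ω x => u s ω * χ x) (C := c * 1) (n := m)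
          (fun s ω x => by
            rw [abs_mul]
            exact mul_le_mul (hc s ω) (hχb x) (abs_nonneg _) ((abs_nonneg _).trans (hc s ω)))
          (fun s ω x hs => by rw [hm s ω hs, zero_mul]))
      obtain ⟨l1, l2⟩ := integral_eq_of_trim_eq hle hρ' hρfin htr hF j1
      obtain ⟨-, i2, e2⟩ := integral_fieldMeasure (f := fun z => F z * (ρ z).toReal)
        (hFm.mul hρ'.ennreal_toReal) l1
      have hst : (fun ω => stieltjesIntegral S.T (fun s => u s ω) (fun s => Λ s ω - A s ω)) =ᵐ[P]
          fun ω => stieltjesIntegral S.T (fun s => u s ω) (fun s => Λ s ω) -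
            ∫ q, F ((q.1, ω), q.2) * (ρ ((q.1, ω), q.2)).toReal ∂(S.locComp U hV ω) := by
        filter_upwards [hΛfv, hfint, hpath] with ω h1 h2 h3
        have hum := IsPredictable.measurable_path hu ω
        rw [(stieltjesIntegral_sub h1 (hAst h2 h3).1 hum ⟨c, fun s => hc s ω⟩).2,
          (hAst h2 h3).2 _ hum ⟨c, fun s => hc s ω⟩]
        simp only [F, f, mul_assoc]
      refine ⟨(i1.sub i2).congr hst.symm, ?_⟩
      rw [integral_congr_ae hst, integral_sub i1 i2, ← e1, sub_eq_zero]
      refine Eq.trans ?_ (l2.trans e2)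
      rw [(integral_fieldMeasure hFm j1).2.2]
      exact integral_congr_ae (ae_of_all _ fun ω => hXst hu' ⟨c, hc⟩ ω)
  obtain ⟨-, e⟩ := hΛint k hk ⟨c, hkc⟩ (hfinite hkc hkn)
  rw [integral_congr_ae (ae_of_all _ (hXst hk ⟨c, hkc⟩))] at e
  refine e.trans (integral_congr_ae ?_)
  filter_upwards [hfint, hpath, huniq] with ω h1 h2 h3
  refine (hAst (G := Λ) h1 fun t ht => ?_).2 _ (IsPredictable.measurable_path hk ω)
    ⟨c, fun s => hkc s ω⟩
  have := h3 t ht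
  have := h2 t ht
  linarith

/-- Under local independence, a density on the fields of the history of `{V} ∪ (V' ∖ B)` is a
density on the fields of the history of `{V} ∪ V'`. -/
lemma LocIndepFollowUp.trim_eq {Ω ι J : Type*} [MeasurableSpace Ω]
    [mJ : MeasurableSpace J] {S : ModuleSystem Ω ι J} {Q P : Measure Ω} [IsProbabilityMeasure Q]
    [IsProbabilityMeasure P] (hQ : S.IsReference Q) (hPQ : P ≪ Q) {U : Kernel Ω (ℝ≥0 × J)}
    (hU : IsDualPredictableProjection (S.filtration Q univ) Q S.N U) {V : ι} {B V' : Set ι}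
    (hloc : S.LocIndepFollowUp Q P V B V') {ρ : (ℝ≥0 × Ω) × J → ℝ≥0∞}
    (hρ : Measurable[(S.filtration Q ({V} ∪ (V' \ B))).predictable.prod mJ] ρ)
    (hρfin : ∀ᵐ z ∂(fieldMeasure P (S.locComp U (hQ.measurableSet_marks V))), ρ z < ∞)
    (htr : (fieldMeasure P (S.locN (hQ.measurableSet_marks V))).trim
        (predictable_prod_le (J := J) (S.filtration Q ({V} ∪ (V' \ B)))) =
      ((fieldMeasure P (S.locComp U (hQ.measurableSet_marks V))).withDensity ρ).trim
        (predictable_prod_le (J := J) (S.filtration Q ({V} ∪ (V' \ B))))) :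
    (fieldMeasure P (S.locN (hQ.measurableSet_marks V))).trim
        (predictable_prod_le (J := J) (S.filtration Q ({V} ∪ V'))) =
      ((fieldMeasure P (S.locComp U (hQ.measurableSet_marks V))).withDensity ρ).trim
        (predictable_prod_le (J := J) (S.filtration Q ({V} ∪ V'))) := by
  have hV := hQ.measurableSet_marks V
  set W : Set ι := {V} ∪ V'
  have hle := predictable_prod_le (J := J) (S.filtration Q W)
  have hρ' : Measurable ρ := hρ.mono (predictable_prod_le _) le_rfl
  have hsN := hQ.isSFiniteKernel_locN hV
  have hL : ∀ n, MeasurableSet[(S.filtration Q W).predictable] (S.levelSet V n) := fun n =>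
    predictable_mono (S.rawFiltration_le_filtration Q (singleton_subset_iff.2 (Or.inl rfl))) _
      (S.measurableSet_levelSet hV n)
  have hprod : ∀ {D : Set (ℝ≥0 × Ω)} {C : Set J}, MeasurableSet[(S.filtration Q W).predictable] D →
      MeasurableSet C → MeasurableSet[(S.filtration Q W).predictable.prod mJ] (D ×ˢ C) :=
    fun hD hC => @MeasurableSet.prod _ _ (S.filtration Q W).predictable mJ _ _ hD hC
  set M₁ := fieldMeasure P (S.locN hV)
  set M₂ := fieldMeasure P (S.locComp U hV)
  have hint := (hQ.integrable_density (Or.inl rfl) hρ hρfin htr).1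
  -- rectangles inside a level set
  have hrect : ∀ n D C, MeasurableSet[(S.filtration Q W).predictable] D → MeasurableSet C →
      M₁ ((D ∩ S.levelSet V n) ×ˢ C) = M₂.withDensity ρ ((D ∩ S.levelSet V n) ×ˢ C) := by
    intro n D C hD hC
    have hE := hle _ (hprod (hD.inter (hL n)) hC)
    have hsub : (D ∩ S.levelSet V n) ×ˢ C ⊆ S.levelSet V n ×ˢ univ :=
      prod_mono inter_subset_right (subset_univ _)
    have hM₁ : M₁ ((D ∩ S.levelSet V n) ×ˢ C) ≠ ∞ :=
      ((measure_mono hsub).trans_lt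
        ((hQ.fieldMeasure_locN_levelSet_le V n).trans_lt (by simp))).ne
    let k : ℝ≥0 → Ω → ℝ := fun s ω => (D ∩ S.levelSet V n).indicator (fun _ => 1) (s, ω)
    have hk : IsPredictable (S.filtration Q W) k :=
      (@measurable_const _ _ _ (S.filtration Q W).predictable (1 : ℝ)).indicator (hD.inter (hL n))
    have hk1 : ∀ s ω, |k s ω| ≤ 1 := by
      intro s ω
      by_cases hs : (s, ω) ∈ D ∩ S.levelSet V n
      · simp only [k, indicator_of_mem hs, abs_one, le_refl]
      · simp only [k, indicator_of_notMem hs, abs_zero, zero_le_one]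
    have hkn : ∀ s ω, (s, ω) ∉ S.levelSet V n → k s ω = 0 := fun s ω hs =>
      indicator_of_notMem (fun h => hs h.2) _
    have hkey := hloc.integral_mark_eq hQ hPQ hU hρ hρfin htr hC hk hk1 hkn
    have hind : ∀ z : (ℝ≥0 × Ω) × J, k z.1.1 z.1.2 * C.indicator (fun _ => 1) z.2 =
        ((D ∩ S.levelSet V n) ×ˢ C).indicator (fun _ => 1) z := by
      intro z
      by_cases h1 : z.1 ∈ D ∩ S.levelSet V n
      · by_cases h2 : z.2 ∈ C
        · rw [indicator_of_mem (show z ∈ (D ∩ S.levelSet V n) ×ˢ C from ⟨h1, h2⟩),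
            indicator_of_mem h2, mul_one]
          exact indicator_of_mem h1 _
        · rw [indicator_of_notMem (fun h : z ∈ (D ∩ S.levelSet V n) ×ˢ C => h2 h.2),
            indicator_of_notMem h2, mul_zero]
      · rw [indicator_of_notMem (fun h : z ∈ (D ∩ S.levelSet V n) ×ˢ C => h1 h.1)]
        have : k z.1.1 z.1.2 = 0 := indicator_of_notMem h1 _
        rw [this, zero_mul]
    have hi₁ : Integrable (((D ∩ S.levelSet V n) ×ˢ C).indicator fun _ => (1 : ℝ)) M₁ :=
      (integrable_indicator_iff hE).2 (integrableOn_const hM₁)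
    have hmeas : Measurable (((D ∩ S.levelSet V n) ×ˢ C).indicator fun _ => (1 : ℝ)) :=
      measurable_const.indicator hE
    have hi₂ : Integrable (fun z => ((D ∩ S.levelSet V n) ×ˢ C).indicator (fun _ => (1 : ℝ)) z *
        (ρ z).toReal) M₂ := by
      refine (hint n).mono (hmeas.mul hρ'.ennreal_toReal).aestronglyMeasurable (ae_of_all _ ?_)
      intro z
      rw [norm_mul, norm_mul]
      refine mul_le_mul_of_nonneg_right ?_ (norm_nonneg _)
      by_cases hz : z ∈ (D ∩ S.levelSet V n) ×ˢ C
      · rw [indicator_of_mem hz, indicator_of_mem (hsub hz)]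
      · rw [indicator_of_notMem hz, norm_zero]
        exact norm_nonneg _
    have h1 := (integral_fieldMeasure hmeas hi₁).2.2
    have h2 := (integral_fieldMeasure (f := fun z =>
      ((D ∩ S.levelSet V n) ×ˢ C).indicator (fun _ => (1 : ℝ)) z * (ρ z).toReal)
      (hmeas.mul hρ'.ennreal_toReal) hi₂).2.2
    have hreal : ∫ z, ((D ∩ S.levelSet V n) ×ˢ C).indicator (fun _ => (1 : ℝ)) z ∂M₁ =
        ∫ z, ((D ∩ S.levelSet V n) ×ˢ C).indicator (fun _ => (1 : ℝ)) z * (ρ z).toReal ∂M₂ := by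
      refine h1.trans (Eq.trans ?_ h2.symm)
      simp only [← hind, mul_assoc]
      exact hkey
    have hρint : IntegrableOn (fun z => (ρ z).toReal) ((D ∩ S.levelSet V n) ×ˢ C) M₂ := by
      refine (integrable_indicator_iff hE).1 (hi₂.congr (ae_of_all _ fun z => ?_))
      by_cases hz : z ∈ (D ∩ S.levelSet V n) ×ˢ C <;> simp only [indicator_of_mem,
        indicator_of_notMem, hz, not_false_eq_true, one_mul, zero_mul]
    have hreal' : M₁.real ((D ∩ S.levelSet V n) ×ˢ C) =
        ∫ z in (D ∩ S.levelSet V n) ×ˢ C, (ρ z).toReal ∂M₂ := by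
      rw [integral_indicator hE, setIntegral_const, smul_eq_mul, mul_one] at hreal
      rw [hreal, ← integral_indicator hE]
      refine integral_congr_ae (ae_of_all _ fun z => ?_)
      by_cases hz : z ∈ (D ∩ S.levelSet V n) ×ˢ C <;> simp only [indicator_of_mem,
        indicator_of_notMem, hz, not_false_eq_true, one_mul, zero_mul]
    rw [withDensity_apply _ hE, ← ENNReal.ofReal_toReal hM₁, ← measureReal_def, hreal',
      ofReal_integral_eq_lintegral_ofReal hρint (ae_of_all _ fun z => ENNReal.toReal_nonneg)]
    refine lintegral_congr_ae ?_
    filter_upwards [ae_restrict_of_ae hρfin] with z hz using ENNReal.ofReal_toReal hz.ne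
  -- The level sets increase to the whole space.
  have hall : ∀ D C, MeasurableSet[(S.filtration Q W).predictable] D → MeasurableSet C →
      M₁ (D ×ˢ C) = M₂.withDensity ρ (D ×ˢ C) := by
    intro D C hD hC
    have hU : D ×ˢ C = ⋃ n, (D ∩ S.levelSet V n) ×ˢ C := by
      rw [← iUnion_prod_const, ← inter_iUnion, hQ.iUnion_levelSet V, inter_univ]
    have hmono : Monotone fun n => (D ∩ S.levelSet V n) ×ˢ C := fun i j hij =>
      prod_mono (inter_subset_inter_right _ (S.levelSet_mono V hij)) subset_rfl
    rw [hU, hmono.measure_iUnion, hmono.measure_iUnion]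
    exact iSup_congr fun n => hrect n D C hD hC
  refine @Measure.ext_of_generateFrom_of_iUnion _ ((S.filtration Q W).predictable.prod mJ) _ _
    (image2 (· ×ˢ ·) {D | MeasurableSet[(S.filtration Q W).predictable] D}
      {C : Set J | MeasurableSet C}) (fun n => S.levelSet V n ×ˢ univ)
    (@generateFrom_prod _ _ (S.filtration Q W).predictable mJ).symm
    (@isPiSystem_prod _ _ (S.filtration Q W).predictable mJ) ?_ ?_ ?_ ?_
  · rw [← iUnion_prod_const, hQ.iUnion_levelSet V, univ_prod_univ]
  · exact fun n => ⟨_, hL n, univ, MeasurableSet.univ, rfl⟩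
  · intro n
    rw [trim_measurableSet_eq hle (hprod (hL n) MeasurableSet.univ)]
    exact ((hQ.fieldMeasure_locN_levelSet_le V n).trans_lt (by simp)).ne
  · rintro _ ⟨D, hD, C, hC, rfl⟩
    change M₁.trim hle (D ×ˢ C) = (M₂.withDensity ρ).trim hle (D ×ˢ C)
    rw [trim_measurableSet_eq hle (hprod hD hC), trim_measurableSet_eq hle (hprod hD hC),
      hall D C hD hC]

/-- The intensity is the density of the events relative to the compensator on the fields of the
smaller history. -/
theorem LocIndepFollowUp.exists_isIntensity {Ω ι J : Type*} [MeasurableSpace Ω]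
    [mJ : MeasurableSpace J] {S : ModuleSystem Ω ι J} {Q P : Measure Ω} [IsProbabilityMeasure Q]
    [IsProbabilityMeasure P] (hQ : S.IsReference Q) (hPQ : P ≪ Q) {U : Kernel Ω (ℝ≥0 × J)}
    (hU : IsDualPredictableProjection (S.filtration Q univ) Q S.N U) {V : ι} {B V' : Set ι}
    (hloc : S.LocIndepFollowUp Q P V B V') :
    ∃ lam : ℝ≥0 → Ω → J → ℝ, S.IsIntensity Q P U V B V' lam := by
  have hV := hQ.measurableSet_marks V
  obtain ⟨ρ, hρ, hρfin, htr⟩ := hQ.exists_density hPQ hU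
    (W := {V} ∪ (V' \ B)) (V := V) (Or.inl rfl)
  have hρ' : Measurable ρ := hρ.mono (predictable_prod_le _) le_rfl
  have htrW := hloc.trim_eq hQ hPQ hU hρ hρfin htr
  refine ⟨fun s ω x => (ρ ((s, ω), x)).toReal, fun _ _ _ => ENNReal.toReal_nonneg,
    hρ.ennreal_toReal, fun h hh _ hfin => ?_⟩
  have hle := predictable_prod_le (J := J) (S.filtration Q ({V} ∪ V'))
  have hhm : Measurable fun z : (ℝ≥0 × Ω) × J => h z.1.1 z.1.2 z.2 := Measurable.mono hh hle le_rfl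
  have hK := hPQ.ae_le (hQ.ae_locComp_eq hU V)
  obtain ⟨j1, j2⟩ := hQ.integrable_fieldMeasure_locN (P := P) V hhm hfin
  obtain ⟨l1, l2⟩ := integral_eq_of_trim_eq hle hρ' hρfin htrW hh j1
  obtain ⟨i0, i1, i2⟩ := integral_fieldMeasure (hhm.mul hρ'.ennreal_toReal) l1
  have hcongr : (fun ω => ∫ q, h q.1 ω q.2 * (ρ ((q.1, ω), q.2)).toReal ∂(S.locComp U hV ω)) =ᵐ[P]
      fun ω => ∫ q in Ioc 0 S.T ×ˢ S.marks V, h q.1 ω q.2 * (ρ ((q.1, ω), q.2)).toReal ∂(U ω) := by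
    filter_upwards [hK] with ω hω
    rw [hω]
  refine ⟨?_, i1.congr hcongr, ?_⟩
  · filter_upwards [hK, i0] with ω h1 h2
    rwa [h1] at h2
  · rw [← j2, l2, ← integral_congr_ae hcongr]
    exact i2

end ModuleSystem

end LocalIndependence

theorem mainTheorem9 {Ω ι J : Type*} [MeasurableSpace Ω] [Finite ι]
    [MeasurableSpace J] [StandardBorelSpace J]
    (S : LocalIndependence.ModuleSystem Ω ι J)
    (Q P : Measure Ω) [IsProbabilityMeasure Q] [IsProbabilityMeasure P]
    (hQ : S.IsReference Q) (hP : S.IsFactual Q P)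
    (U : Kernel Ω (ℝ≥0 × J))
    (hU : LocalIndependence.IsDualPredictableProjection (S.filtration Q univ) Q S.N U)
    (V : ι) (B V' : Set ι) (hbase : S.LocIndepBaseline Q P V B V') :
    S.LocIndep Q P V B V' ↔
      ∃ lam : ℝ≥0 → Ω → J → ℝ, S.IsIntensity Q P U V B V' lam :=
  ⟨fun h => h.2.exists_isIntensity hQ hP.absolutelyContinuous hU,
    fun ⟨_, h⟩ => ⟨hbase, h.locIndepFollowUp hQ hP.absolutelyContinuous hU⟩⟩
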